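/- Let $T\ge 1$ and let $\zeta(j)$, $j\in\mathbb Z$, be a complex, zero-mean, finite-variance sequence that is periodically correlated with (smallest) period $T$, i.e. $\mathsf E\,\zeta(n+T)\overline{\zeta(m+T)}=\mathsf E\,\zeta(n)\overline{\zeta(m)}$ for all $n,m$. Let $\vec\zeta(n)=(\zeta(nT+1),\dots,\zeta(nT+T))^{\top}$ be its $T$-blocking, and assume that it has a spectral density matrix $f(\lambda)$, $\lambda\in(-\pi,\pi]$: $$\mathsf E\,\zeta_\nu(n)\overline{\zeta_\mu(m)}=\frac1{2\pi}\int_{-\pi}^{\pi}e^{i(n-m)\lambda}f_{\nu\mu}(\lambda)\,d\lambda .$$ Assume the minimality condition: $f$ is invertible almost everywhere and $\int_{-\pi}^{\pi}\operatorname{Tr}[f(\lambda)^{-1}]\,d\lambda<\infty$. Let $s\ge 0$, $N_l,K_l\in\mathbb Z_{\ge 0}$ for $1\le l\le s$, $M_l=\sum_{k=1}^{l}(N_k+K_k)$, $S=\bigcup_{l=1}^{s}\{-M_lT+1,\dots,-M_{l-1}T-N_lT\}$, $\tilde S=\bigcup_{l=1}^{s}\{-M_l,\dots,-M_{l-1}-N_l-1\}$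 and $\Gamma=\tilde S\cup\{0,1,2,\dots\}$. Let $\sum_{j\ge1}|a(j)|<\infty$, and put $\vec a(j)=(a(1+jT),\dots,a(T+jT))^{\top}$ for $j\ge0$, $A(e^{i\lambda})=\sum_{j\ge0}\vec a(j)e^{ij\lambda}$, and let $\mathbf a=(\mathbf a(k))_{k\in\Gamma}$ with $\mathbf a(k)=\vec a(k)$ for $k\ge0$ and $\mathbf a(k)=0$ for $k\in\tilde S$. Consider the functional $$A\zeta=\sum_{j=1}^{\infty}a(j)\zeta(j)=\sum_{j=0}^{\infty}\vec a(j)^{\top}\vec\zeta(j)$$ (both series converge in mean square), to be estimated from $\zeta(j)$, $j\le0$, $j\notin S$, equivalently from $\vec\zeta(n)$, $n\le-1$, $n\notin\tilde S$ (both families have the same closed linear span $H^s$). Let $\mathbf B$ be the nonnegative operator in $\ell^2(\Gamma;\mathbb C^T)$ with the block matrix $(B(k-j))_{k,j\in\Gamma}$, $$B(k-j)=\frac1{2\pi}\int_{-\pi}^{\pi}[f(\lambda)^{-1}]^{\top}e^{i(j-k)\lambda}\,d\lambda .$$ It acts by matrix multiplication on finitely supported sequences. If the matrix is unbounded on $\ell^2$,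 then $\mathbf B\mathbf c=\mathbf b$ means that there are finitely supported $p_n\to\mathbf c$ in $\ell^2$ with $\langle\mathbf B(p_m-p_n),p_m-p_n\rangle\to0$ as $m,n\to\infty$ and $(\mathbf Bp_n)(k)\to\mathbf b(k)$ for every $k\in\Gamma$; for a bounded matrix this is ordinary matrix multiplication. Call $\mathbf B$ invertible if it maps its domain bijectively onto $\ell^2(\Gamma;\mathbb C^T)$. If $\mathbf B$ is invertible, then the equation $\mathbf B\mathbf c=\mathbf a$ has a solution $\mathbf c=\mathbf B^{-1}\mathbf a$. More generally, whenever $\mathbf c\in\ell^2(\Gamma;\mathbb C^T)$ satisfies $\mathbf B\mathbf c=\mathbf a$, this $\mathbf c$ is the only solution, and with $C(e^{i\lambda})=\sum_{n\in\Gamma}\vec c(n)e^{in\lambda}$ (convergence in $L^2$) and $$\vec h^{\top}=A^{\top}(e^{i\lambda})-C^{\top}(e^{i\lambda})\,f(\lambda)^{-1}$$ the following hold. 1. The function $\vec h$ belongs to the closed span $L_2^s(f)$ of the functions $e^{in\lambda}\delta_\nu$, $n\le-1$, $n\notin\tilde S$, $1\le\nu\le T$, in $L_2(f)$. Among all $\vec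 g\in L_2^s(f)$ it minimizes $$\Delta(\vec g;f)=\frac1{2\pi}\int_{-\pi}^{\pi}(A-\vec g)^{\top}f\,\overline{(A-\vec g)}\,d\lambda,$$ and it is the only minimizer up to null sets. 2. The orthogonal random spectral measure $Z$ of $\vec\zeta$ exists, and the unique optimal linear mean-square estimate of $A\zeta$ in $H^s$ is $\widehat{A\zeta}=\int_{-\pi}^{\pi}\vec h^{\top}(e^{i\lambda})\,Z(d\lambda)$. 3. The mean-square error is $$\mathsf E|A\zeta-\widehat{A\zeta}|^2=\Delta(\vec h;f)=\langle\mathbf c,\mathbf a\rangle=\sum_{k\in\Gamma}\sum_{\nu=1}^{T}c_\nu(k)\overline{\mathbf a_\nu(k)} .$$ -/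

import Mathlib

open MeasureTheory Filter Topology
open scoped ComplexOrder ENNReal Matrix

noncomputable section

namespace PCExtrapolation

/-! ### Periodically correlated sequences, blocking, observation times -/

section Sequences

variable {Ω : Type*} [MeasurableSpace Ω]

/-- `E X conj(Y)` for square-integrable random variables. -/
def cov (P : Measure Ω) (X Y : Lp ℂ 2 P) : ℂ :=
  ∫ ω, X ω * (starRingEnd ℂ) (Y ω) ∂P

/-- The correlation function of `ζ` is invariant under the shift of both times by `T`. -/
def HasPeriod (P : Measure Ω) (ζ : ℤ → Lp ℂ 2 P) (T : ℕ) : Prop :=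
  ∀ n m : ℤ, cov P (ζ (n + T)) (ζ (m + T)) = cov P (ζ n) (ζ m)

/-- A zero mean, finite variance sequence that is periodically correlated with
(smallest) period `T`. -/
structure IsPC (P : Measure Ω) (ζ : ℤ → Lp ℂ 2 P) (T : ℕ) : Prop where
  pos : 0 < T
  mean_zero : ∀ n, ∫ ω, ζ n ω ∂P = 0
  period : HasPeriod P ζ T
  minimal : ∀ T' : ℕ, 0 < T' → T' < T → ¬ HasPeriod P ζ T'

/-- The `T`-variate blocked sequence: the component with index `ν : Fin T` is the component
number `ν + 1 ∈ {1, …, T}`. -/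
def block {P : Measure Ω} (ζ : ℤ → Lp ℂ 2 P) (T : ℕ) (ν : Fin T) (n : ℤ) : Lp ℂ 2 P :=
  ζ (n * T + (ν : ℤ) + 1)

end Sequences

/-- `M_l = ∑_{k=1}^l (N_k + K_k)`. -/
def bigM (N K : ℕ → ℕ) (l : ℕ) : ℕ := ∑ k ∈ Finset.range l, (N (k + 1) + K (k + 1))

/-- Missing block times `⋃_{l=1}^s {-M_l, …, -M_{l-1} - N_l - 1}`. -/
def missingBlocks (s : ℕ) (N K : ℕ → ℕ) : Set ℤ :=
  {n | ∃ l < s, -(bigM N K (l + 1) : ℤ) ≤ n ∧ n ≤ -(bigM N K l : ℤ) - N (l + 1) - 1}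

/-- Missing times `⋃_{l=1}^s {-M_l T + 1, …, -M_{l-1} T - N_l T}` of the scalar sequence. -/
def missingTimes (T s : ℕ) (N K : ℕ → ℕ) : Set ℤ :=
  {j | ∃ l < s, -(bigM N K (l + 1) : ℤ) * T + 1 ≤ j ∧
    j ≤ -(bigM N K l : ℤ) * T - (N (l + 1) : ℤ) * T}

/-- Observed block times `{…, -2, -1} \ S̃`. -/
def observedBlocks (s : ℕ) (N K : ℕ → ℕ) : Set ℤ := {n | n ≤ -1} \ missingBlocks s N K

/-- `Γ = S̃ ∪ {0, 1, 2, …}`. -/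
def gammaSet (s : ℕ) (N K : ℕ → ℕ) : Set ℤ := missingBlocks s N K ∪ {n | 0 ≤ n}

/-! ### Spectral densities and the spaces `L₂(f)`, `L₂ˢ(f)` -/

/-- Lebesgue measure on the frequency interval `(-π, π]`. -/
def freq : Measure ℝ := volume.restrict (Set.Ioc (-Real.pi) Real.pi)

/-- `e^{i n t}`. -/
def expo (n : ℤ) (t : ℝ) : ℂ := Complex.exp (Complex.I * n * t)

variable {T : ℕ}

/-- `f` is the spectral density matrix of the `T`-variate sequence `ξ`:
`E ξ_ν(n) conj(ξ_μ(m)) = (2π)⁻¹ ∫ e^{i(n-m)t} f_{νμ}(t) dt`. -/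
structure IsSpectralDensity {Ω : Type*} [MeasurableSpace Ω] (P : Measure Ω)
    (ξ : Fin T → ℤ → Lp ℂ 2 P) (f : ℝ → Matrix (Fin T) (Fin T) ℂ) : Prop where
  integrable : ∀ ν μ, Integrable (fun t => f t ν μ) freq
  posSemidef : ∀ᵐ t ∂freq, (f t).PosSemidef
  cov_eq : ∀ ν μ n m, cov P (ξ ν n) (ξ μ m) =
    (2 * Real.pi : ℂ)⁻¹ * ∫ t, expo (n - m) t * f t ν μ ∂freq

/-- The minimality condition `∫ Tr f(t)⁻¹ dt < ∞` (in particular `f` is invertible a.e.). -/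
def MinimalityCondition (f : ℝ → Matrix (Fin T) (Fin T) ℂ) : Prop :=
  (∀ᵐ t ∂freq, IsUnit (f t).det) ∧ Integrable (fun t => ((f t)⁻¹).trace) freq

/-- `bᵀ f conj(b)`. -/
def quad (f : ℝ → Matrix (Fin T) (Fin T) ℂ) (b : ℝ → Fin T → ℂ) (t : ℝ) : ℂ :=
  b t ⬝ᵥ (f t *ᵥ star (b t))

/-- Membership in `L₂(f)`. -/
def MemL2 (f : ℝ → Matrix (Fin T) (Fin T) ℂ) (b : ℝ → Fin T → ℂ) : Prop :=
  AEStronglyMeasurable b freq ∧ Integrable (quad f b) freq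

/-- The squared norm `(2π)⁻¹ ∫ bᵀ f conj(b) dt` of `L₂(f)`. -/
def normSq (f : ℝ → Matrix (Fin T) (Fin T) ℂ) (b : ℝ → Fin T → ℂ) : ℝ :=
  (2 * Real.pi)⁻¹ * ∫ t, (quad f b t).re ∂freq

/-- The vector trigonometric polynomial with coefficients `p`. -/
def trigPoly (p : ℤ →₀ (Fin T → ℂ)) (t : ℝ) : Fin T → ℂ := p.sum fun n v => expo n t • v

/-- Membership in `L₂ˢ(f)`, the closed subspace of `L₂(f)` generated by the functions
`e^{int} δ_ν` with `n ∈ J`, `ν = 1, …, T`. -/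
def MemL2s (f : ℝ → Matrix (Fin T) (Fin T) ℂ) (J : Set ℤ) (h : ℝ → Fin T → ℂ) : Prop :=
  MemL2 f h ∧ ∀ ε > 0, ∃ p : ℤ →₀ (Fin T → ℂ), (p.support : Set ℤ) ⊆ J ∧
    normSq f (fun t => h t - trigPoly p t) < ε

/-! ### Random spectral measures and stochastic integrals -/

section Stochastic

variable {Ω : Type*} [MeasurableSpace Ω]

/-- `Y = ∫ hᵀ(t) Z(dt)`: the `L²` limit of the integrals `∑_D ∑_ν w_ν(D) Z_ν(D)` of vector
valued simple functions `∑_D w(D) 1_D` that converge to `h` in `L₂(f)`. -/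
def HasStochIntegral {P : Measure Ω} (Z : Fin T → Set ℝ → Lp ℂ 2 P)
    (f : ℝ → Matrix (Fin T) (Fin T) ℂ) (h : ℝ → Fin T → ℂ) (Y : Lp ℂ 2 P) : Prop :=
  MemL2 f h ∧ ∀ ε > 0, ∃ (F : Finset (Set ℝ)) (w : Set ℝ → Fin T → ℂ),
    (∀ D ∈ F, MeasurableSet D) ∧
    normSq f (fun t => h t - ∑ D ∈ F, D.indicator (fun _ => w D) t) < ε ∧
    ‖Y - ∑ D ∈ F, ∑ ν, w D ν • Z ν D‖ < ε

/-- `Z` is the orthogonal random spectral measure of the `T`-variate stationary sequence `ξ`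
with spectral density matrix `f`. -/
structure IsRandomSpectralMeasure (P : Measure Ω) (ξ : Fin T → ℤ → Lp ℂ 2 P)
    (f : ℝ → Matrix (Fin T) (Fin T) ℂ) (Z : Fin T → Set ℝ → Lp ℂ 2 P) : Prop where
  mean_zero : ∀ ν D, MeasurableSet D → ∫ ω, Z ν D ω ∂P = 0
  cov_eq : ∀ ν μ D D', MeasurableSet D → MeasurableSet D' →
    cov P (Z ν D) (Z μ D') = (2 * Real.pi : ℂ)⁻¹ * ∫ t in D ∩ D', f t ν μ ∂freq
  repr : ∀ ν n, HasStochIntegral Z f (fun t => expo n t • Pi.single ν 1) (ξ ν n)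

/-- The mean square error `E |X - Y|²`. -/
def mse (P : Measure Ω) (X Y : Lp ℂ 2 P) : ℝ := ∫ ω, ‖X ω - Y ω‖ ^ 2 ∂P

/-- `Y` is an optimal (mean square) estimate of `X` in the subspace `H`. -/
def IsOptimalEstimate (P : Measure Ω) (H : Submodule ℂ (Lp ℂ 2 P)) (X Y : Lp ℂ 2 P) : Prop :=
  Y ∈ H ∧ ∀ Y' ∈ H, mse P X Y ≤ mse P X Y'

/-- The closed linear span of the scalar observations `ζ(j)`, `j ≤ 0`, `j ∉ S`. -/
def observedSpace {P : Measure Ω} (ζ : ℤ → Lp ℂ 2 P) (S : Set ℤ) :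
    Submodule ℂ (Lp ℂ 2 P) :=
  (Submodule.span ℂ (ζ '' ({j | j ≤ 0} \ S))).topologicalClosure

/-- The closed linear span of the vector observations `ξ_ν(n)`, `n ∈ J`, `ν = 1, …, T`. -/
def observedBlockSpace {P : Measure Ω} (ξ : Fin T → ℤ → Lp ℂ 2 P) (J : Set ℤ) :
    Submodule ℂ (Lp ℂ 2 P) :=
  (Submodule.span ℂ {X | ∃ ν, ∃ n ∈ J, X = ξ ν n}).topologicalClosure

/-- The functional `Aζ = ∑_{j ≥ 1} a(j) ζ(j)`. -/
def functional {P : Measure Ω} (a : ℕ → ℂ) (ζ : ℤ → Lp ℂ 2 P) : Lp ℂ 2 P :=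
  ∑' j : ℕ, a (j + 1) • ζ ((j : ℤ) + 1)

end Stochastic

/-! ### Coefficients, the operator `B`, the spectral characteristic -/

/-- The vector coefficients `a_ν(j) = a(ν + jT)`, `ν = 1, …, T`, `j ≥ 0`. -/
def vecCoef (T : ℕ) (a : ℕ → ℂ) (j : ℕ) : Fin T → ℂ := fun ν => a (ν + 1 + j * T)

/-- The coefficient vector on `Γ`: the vectors `a(j)` for `j ≥ 0`, and zero on `S̃`. -/
def gammaCoef (T : ℕ) (a : ℕ → ℂ) (Γ : Set ℤ) (x : Γ × Fin T) : ℂ :=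
  if 0 ≤ (x.1 : ℤ) then vecCoef T a (x.1 : ℤ).toNat x.2 else 0

/-- `A(e^{it}) = ∑_{j ≥ 0} a(j) e^{ijt}`. -/
def symbolA (T : ℕ) (a : ℕ → ℂ) (t : ℝ) : Fin T → ℂ :=
  fun ν => ∑' j : ℕ, vecCoef T a j ν * expo j t

/-- The Hilbert space of square-summable sequences of vectors of `ℂ^T` indexed by `Γ`. -/
abbrev Seq2 (T : ℕ) (Γ : Set ℤ) : Type := lp (fun _ : Γ × Fin T => ℂ) 2

/-- `B(m) = (2π)⁻¹ ∫ (f(t)⁻¹)ᵀ e^{-imt} dt`. -/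
def fourierB (f : ℝ → Matrix (Fin T) (Fin T) ℂ) (m : ℤ) : Matrix (Fin T) (Fin T) ℂ :=
  Matrix.of fun ν μ => (2 * Real.pi : ℂ)⁻¹ * ∫ t, ((f t)⁻¹)ᵀ ν μ * expo (-m) t ∂freq

/-- The matrix of `B`: the blocks are `B(k - j)`, `k, j ∈ Γ`. -/
def matB (f : ℝ → Matrix (Fin T) (Fin T) ℂ) (Γ : Set ℤ) (x y : Γ × Fin T) : ℂ :=
  fourierB f ((x.1 : ℤ) - (y.1 : ℤ)) x.2 y.2

/-- The matrix of `B` applied to a sequence (used for finitely supported sequences). -/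
def applyB (f : ℝ → Matrix (Fin T) (Fin T) ℂ) (Γ : Set ℤ) (p : Γ × Fin T → ℂ)
    (x : Γ × Fin T) : ℂ := ∑' y, matB f Γ x y * p y

/-- The quadratic form `⟨B p, p⟩` (used for finitely supported sequences). -/
def energyB (f : ℝ → Matrix (Fin T) (Fin T) ℂ) (Γ : Set ℤ) (p : Γ × Fin T → ℂ) : ℝ :=
  (∑' x, applyB f Γ p x * (starRingEnd ℂ) (p x)).re

/-- `B c = b`, for the nonnegative operator in `ℓ²(Γ; ℂ^T)` generated by the matrix `B(k - j)`.
On finitely supported sequences `B` acts by matrix multiplication; since `f⁻¹` is only assumed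
integrable, the matrix may define an unbounded operator, and then `B c` is obtained from
finitely supported sequences which converge to `c` in `ℓ²` and are Cauchy for the form
`⟨B p, p⟩` (form closure). If the matrix is bounded on `ℓ²(Γ; ℂ^T)`, this is just
`b(k) = ∑_{j ∈ Γ} B(k - j) c(j)` for all `k ∈ Γ`. -/
def IsImageB (f : ℝ → Matrix (Fin T) (Fin T) ℂ) (Γ : Set ℤ) (c : Seq2 T Γ)
    (b : Γ × Fin T → ℂ) : Prop :=
  ∃ p : ℕ → Seq2 T Γ, (∀ n, {x | p n x ≠ 0}.Finite) ∧ Tendsto p atTop (𝓝 c) ∧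
    (∀ ε > 0, ∃ n₀, ∀ m ≥ n₀, ∀ n ≥ n₀, energyB f Γ (fun x => p m x - p n x) < ε) ∧
    ∀ x, Tendsto (fun n => applyB f Γ (p n) x) atTop (𝓝 (b x))

/-- `B` is invertible: a bijection of its domain onto `ℓ²(Γ; ℂ^T)`. -/
def InvertibleB (f : ℝ → Matrix (Fin T) (Fin T) ℂ) (Γ : Set ℤ) : Prop :=
  ∀ b : Seq2 T Γ, ∃! c : Seq2 T Γ, IsImageB f Γ c b

/-- `C(e^{it}) = ∑_{n ∈ Γ} c(n) e^{int}` (convergence in `L²(-π, π)`). -/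
def IsSymbol (Γ : Set ℤ) (c : Γ × Fin T → ℂ) (C : ℝ → Fin T → ℂ) : Prop :=
  ∀ ν, MemLp (fun t => C t ν) 2 freq ∧
    Tendsto (fun F : Finset Γ =>
        eLpNorm (fun t => C t ν - ∑ n ∈ F, c (n, ν) * expo n t) 2 freq) atTop (𝓝 0)

/-- The spectral characteristic `hᵀ = Aᵀ - Cᵀ f⁻¹`. -/
def spectralChar (a : ℕ → ℂ) (C : ℝ → Fin T → ℂ) (f : ℝ → Matrix (Fin T) (Fin T) ℂ)
    (t : ℝ) : Fin T → ℂ := symbolA T a t - C t ᵥ* (f t)⁻¹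

/-- The mean square error `(2π)⁻¹ ∫ (A - h)ᵀ f conj(A - h) dt` of the estimate with spectral
characteristic `h`. -/
def spectralError (a : ℕ → ℂ) (f : ℝ → Matrix (Fin T) (Fin T) ℂ) (h : ℝ → Fin T → ℂ) : ℝ :=
  normSq f (fun t => symbolA T a t - h t)

end PCExtrapolation

end

/-!
The problem is a projection in `L₂(f)`. Minimality provides a Hermitian square root `R` of
`(2π)⁻¹ f` with inverse `S`, both with square-integrable entries (`exists_isSpectralRoot`), and
`b ↦ bᵀ R` realizes `L₂(f)` as the model space `L²((-π, π]; ℂ^T)`. As the vectors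
`e_{n,ν} = e^{int} δ_νᵀ R` have the Gram matrix of the blocked sequence, `e_{n,ν} ↦ ζ_ν(n)` extends
to an isometry `U` of the model space into `L²(P)` (`exists_spectral_isometry`). It carries `A` to
the functional `Aζ` and the span of the `e_{n,ν}` with observed `n` to `Hˢ`, and integration against
any random spectral measure is given by `U`. It remains to project `A` in the model space.

The vectors `d_{n,ν} = (2π)⁻¹ e^{int} δ_νᵀ S` are biorthogonal to the `e_{n,ν}`, and their Gram
matrix on `Γ` is the matrix of `B`. A form Cauchy sequence of finitely supported `pₙ → c` thus gives
a convergent sequence of combinations of the `d_{n,ν}`, `n ∈ Γ`. Its limit `Q` has inner products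
`c` with the `e_{n,ν}`, `n ∈ Γ`, is orthogonal to those with observed `n`, and satisfies
`⟨Q, d_{n,ν}⟩ = a_ν(n)` on `Γ` (`exists_vec_of_isImageB`). The first two properties say that
`Q` is the image of `Cᵀ f⁻¹` and is orthogonal to `L₂ˢ(f)`; by the third one, `A - Q` is orthogonal
to all `d_{n,ν}`, `n ∈ Γ`. If this implies that `A - Q` lies in `L₂ˢ(f)`, then `A - Q` is the image
of `h` and is the projection of `A`, and `‖Q‖² = ⟨Q, A⟩ = ⟨c, a⟩` (`exists_decomposition`).

The implication is the duality `mem_closure_of_inner_eq_zero`. If `u` is orthogonal to all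
`d_{n,ν}`, `n ∈ Γ`, and `G` to all `e_{n,ν}`, `n ∉ Γ`, then `⟨u, G⟩` is the integral of
`∑ D_ν conj(F_ν)` with integrable `D = Gᵀ R` and `F = uᵀ S` of complementary frequencies. The sum is
integrable, but its terms need not be, so that the integral cannot be read off from Fourier
coefficients. After the finitely many frequencies in `S̃` are removed, `D` is analytic. Then `D` is
replaced by its Fejér means, multiplied by analytic functions `1 / (1 + ε g)` whose denominators
dominate these means (`exists_taming_multiplier`); such products pair to zero with `conj F`, and
dominated convergence leads back to `D` (`integral_sum_mul_eq_zero`).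
-/

namespace PCExtrapolation

/-! ### The square root of the spectral density -/

section SquareRoot

variable {T : ℕ}

open scoped MatrixOrder Matrix.Norms.L2Operator in
/-- The square root of positive semidefinite matrices, as a continuous function. -/
theorem continuous_sqrt_posSemidef (T : ℕ) :
    Continuous fun M : {M : Matrix (Fin T) (Fin T) ℂ // M.PosSemidef} => CFC.sqrt M.1 := by
  have h : Continuous fun M : {M : Matrix (Fin T) (Fin T) ℂ // M.PosSemidef} =>
      cfc NNReal.sqrt M.1 :=
    Continuous.cfc_nnreal_of_mem_nhdsSet (s := Set.univ) NNReal.sqrt Filter.univ_mem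
      continuous_subtype_val (fun M => Matrix.nonneg_iff_posSemidef.2 M.2)
      NNReal.continuous_sqrt.continuousOn
  refine h.congr fun M => ?_
  rw [CFC.sqrt_eq_cfc]

theorem isClosed_posSemidef (T : ℕ) : IsClosed {M : Matrix (Fin T) (Fin T) ℂ | M.PosSemidef} := by
  have : {M : Matrix (Fin T) (Fin T) ℂ | M.PosSemidef} =
      {M | M.conjTranspose = M} ∩ ⋂ x : Fin T → ℂ, {M | 0 ≤ star x ⬝ᵥ (M *ᵥ x)} := by
    ext M
    simp [Matrix.posSemidef_iff_dotProduct_mulVec, Matrix.IsHermitian]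
  rw [this]
  refine IsClosed.inter (isClosed_eq (by fun_prop) continuous_id) (isClosed_iInter fun x => ?_)
  exact isClosed_le continuous_const (by fun_prop)

theorem aestronglyMeasurable_matrix_of_entries {α : Type*} [MeasurableSpace α] {μ : Measure α}
    {f : α → Matrix (Fin T) (Fin T) ℂ}
    (hf : ∀ i j, AEStronglyMeasurable (fun t => f t i j) μ) : AEStronglyMeasurable f μ := by
  have : AEMeasurable (fun t i j => f t i j) μ :=
    aemeasurable_pi_iff.2 fun i => aemeasurable_pi_iff.2 fun j => (hf i j).aemeasurable
  exact this.aestronglyMeasurable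

theorem aestronglyMeasurable_entry {α : Type*} [MeasurableSpace α] {μ : Measure α}
    {f : α → Matrix (Fin T) (Fin T) ℂ} (hf : AEStronglyMeasurable f μ) (i j : Fin T) :
    AEStronglyMeasurable (fun t => f t i j) μ :=
  (Continuous.matrix_elem continuous_id i j).comp_aestronglyMeasurable hf

open scoped MatrixOrder Matrix.Norms.L2Operator in
theorem exists_aestronglyMeasurable_sqrt {α : Type*} [MeasurableSpace α] {μ : Measure α}
    {f : α → Matrix (Fin T) (Fin T) ℂ} (hf : AEStronglyMeasurable f μ)
    (hpsd : ∀ᵐ t ∂μ, (f t).PosSemidef) :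
    ∃ R : α → Matrix (Fin T) (Fin T) ℂ, AEStronglyMeasurable R μ ∧
      ∀ᵐ t ∂μ, (R t).IsHermitian ∧ R t * R t = f t := by
  obtain ⟨g, hg, hgf⟩ := hf
  have hs : MeasurableSet {t | (g t).PosSemidef} := by
    borelize (Matrix (Fin T) (Fin T) ℂ)
    exact hg.measurable (isClosed_posSemidef T).measurableSet
  refine ⟨fun t => CFC.sqrt (f t), ?_, ?_⟩
  · classical
    let G : α → {M : Matrix (Fin T) (Fin T) ℂ // M.PosSemidef} := fun t =>
      if h : (g t).PosSemidef then ⟨g t, h⟩ else ⟨0, Matrix.PosSemidef.zero⟩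
    have hGval : (fun t => (G t).1) = {t | (g t).PosSemidef}.indicator g := by
      funext t
      by_cases h : (g t).PosSemidef <;> simp [G, h]
    have hG : StronglyMeasurable G := by
      borelize (Matrix (Fin T) (Fin T) ℂ)
      have hm : Measurable fun t => (G t).1 := by
        rw [hGval]
        exact hg.measurable.indicator hs
      exact (Measurable.subtype_mk (h := fun t => (G t).2) hm).stronglyMeasurable
    refine ⟨fun t => CFC.sqrt (G t).1,
      (continuous_sqrt_posSemidef T).comp_stronglyMeasurable hG, ?_⟩
    filter_upwards [hgf, hpsd] with t h1 h2
    rw [h1] at h2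
    simp [G, h2, h1]
  · filter_upwards [hpsd] with t ht
    have h0 := Matrix.nonneg_iff_posSemidef.2 ht
    exact ⟨(Matrix.nonneg_iff_posSemidef.1 (CFC.sqrt_nonneg (f t))).1,
      CFC.sqrt_mul_sqrt_self (f t) h0⟩

/-- Almost everywhere on the frequency interval, `R` is a Hermitian square root of `(2π)⁻¹ f` with
inverse `S`; both have square-integrable entries. The factor `(2π)⁻¹` makes `b ↦ bᵀ R` isometric for
the norm of `L₂(f)`. -/
structure IsSpectralRoot (f R S : ℝ → Matrix (Fin T) (Fin T) ℂ) : Prop where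
  memLp_root : ∀ i j, MemLp (fun t => R t i j) 2 freq
  memLp_inv : ∀ i j, MemLp (fun t => S t i j) 2 freq
  ae_spec : ∀ᵐ t ∂freq, (R t).IsHermitian ∧ (S t).IsHermitian ∧ R t * S t = 1 ∧ S t * R t = 1 ∧
    f t = (2 * Real.pi : ℂ) • (R t * R t) ∧ (f t)⁻¹ = (2 * Real.pi : ℂ)⁻¹ • (S t * S t)

/-- The diagonal entries of `R²` are the squared norms of the rows of `R`. -/
theorem mul_self_diag {R : Matrix (Fin T) (Fin T) ℂ} (hR : R.IsHermitian) (i : Fin T) :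
    (R * R) i i = ((∑ k, ‖R i k‖ ^ 2 : ℝ) : ℂ) := by
  rw [Matrix.mul_apply]
  push_cast
  refine Finset.sum_congr rfl fun k _ => ?_
  rw [← hR.apply k i, ← Complex.mul_conj']
  rfl

theorem memLp_two_entry_of_integrable_diag {α : Type*} [MeasurableSpace α] {μ : Measure α}
    {R : α → Matrix (Fin T) (Fin T) ℂ} (hR : AEStronglyMeasurable R μ)
    (hH : ∀ᵐ t ∂μ, (R t).IsHermitian) (i j : Fin T)
    (hi : Integrable (fun t => (R t * R t) i i) μ) : MemLp (fun t => R t i j) 2 μ := by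
  have hm := aestronglyMeasurable_entry hR i j
  rw [memLp_two_iff_integrable_sq_norm hm]
  refine hi.norm.mono' (by fun_prop) ?_
  filter_upwards [hH] with t ht
  rw [mul_self_diag ht, Complex.norm_real, Real.norm_of_nonneg (by positivity),
    Real.norm_of_nonneg (by positivity)]
  exact Finset.single_le_sum (f := fun k => ‖R t i k‖ ^ 2) (fun k _ => by positivity)
    (Finset.mem_univ j)

theorem exists_isSpectralRoot {f : ℝ → Matrix (Fin T) (Fin T) ℂ}
    (hint : ∀ ν μ, Integrable (fun t => f t ν μ) freq) (hpsd : ∀ᵐ t ∂freq, (f t).PosSemidef)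
    (hmin : MinimalityCondition f) : ∃ R S, IsSpectralRoot f R S := by
  have hpi : (2 * Real.pi : ℂ) ≠ 0 := by simp [Real.pi_ne_zero]
  have hpi' : (0 : ℂ) ≤ (2 * Real.pi : ℂ)⁻¹ := by
    rw [show (2 * Real.pi : ℂ)⁻¹ = (((2 * Real.pi)⁻¹ : ℝ) : ℂ) by push_cast; rfl]
    exact Complex.zero_le_real.2 (by positivity)
  have hfm : AEStronglyMeasurable f freq :=
    aestronglyMeasurable_matrix_of_entries fun i j => (hint i j).aestronglyMeasurable
  obtain ⟨R, hRm, hR⟩ := exists_aestronglyMeasurable_sqrt (f := fun t => (2 * Real.pi : ℂ)⁻¹ • f t)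
    (AEStronglyMeasurable.const_smul hfm (2 * Real.pi : ℂ)⁻¹) (hpsd.mono fun t ht => ht.smul hpi')
  have hSm : AEStronglyMeasurable (fun t => (R t)⁻¹) freq := by
    simp_rw [Matrix.inv_def]
    have hdet : AEStronglyMeasurable (fun t => Ring.inverse (R t).det) freq := by
      simp only [Ring.inverse_eq_inv']
      have : AEStronglyMeasurable (fun t => (R t).det) freq :=
        (Continuous.matrix_det continuous_id).comp_aestronglyMeasurable hRm
      exact this.aemeasurable.inv.aestronglyMeasurable
    exact hdet.smul ((Continuous.matrix_adjugate continuous_id).comp_aestronglyMeasurable hRm)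
  obtain ⟨S, hS⟩ : ∃ S : ℝ → Matrix (Fin T) (Fin T) ℂ, S = fun t => (R t)⁻¹ := ⟨_, rfl⟩
  rw [← hS] at hSm
  have hspec : ∀ᵐ t ∂freq, (R t).IsHermitian ∧ (S t).IsHermitian ∧ R t * S t = 1 ∧
      S t * R t = 1 ∧ f t = (2 * Real.pi : ℂ) • (R t * R t) ∧
      (f t)⁻¹ = (2 * Real.pi : ℂ)⁻¹ • (S t * S t) := by
    rw [hS]
    filter_upwards [hR, hmin.1] with t ⟨h1, h2⟩ h3
    have hf : f t = (2 * Real.pi : ℂ) • (R t * R t) := by rw [h2, smul_smul, mul_inv_cancel₀ hpi,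
      one_smul]
    have hu : IsUnit (R t).det := by
      rw [hf, Matrix.det_smul, Matrix.det_mul] at h3
      exact isUnit_of_mul_isUnit_left (isUnit_of_mul_isUnit_right h3)
    refine ⟨h1, h1.inv, Matrix.mul_nonsing_inv _ hu, Matrix.nonsing_inv_mul _ hu, hf, ?_⟩
    refine Matrix.inv_eq_left_inv ?_
    rw [hf, Matrix.smul_mul, Matrix.mul_smul, smul_smul, inv_mul_cancel₀ hpi, one_smul,
      Matrix.mul_assoc, ← Matrix.mul_assoc _ (R t) (R t), Matrix.nonsing_inv_mul _ hu,
      Matrix.one_mul, Matrix.nonsing_inv_mul _ hu]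
  refine ⟨R, S, fun i j => ?_, fun i j => ?_, hspec⟩
  · refine memLp_two_entry_of_integrable_diag hRm (hR.mono fun t h => h.1) i j ?_
    refine ((hint i i).const_mul (2 * Real.pi : ℂ)⁻¹).congr ?_
    filter_upwards [hR] with t ht
    rw [ht.2]; simp
  · refine memLp_two_entry_of_integrable_diag hSm (hspec.mono fun t h => h.2.1) i j ?_
    refine (hmin.2.const_mul (2 * Real.pi : ℂ)).norm.mono' ?_ ?_
    · have hmul : Continuous fun M : Matrix (Fin T) (Fin T) ℂ => M * M :=
        continuous_id.matrix_mul continuous_id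
      exact aestronglyMeasurable_entry (hmul.comp_aestronglyMeasurable hSm) i i
    · filter_upwards [hspec] with t ⟨_, h2, _, _, _, h6⟩
      rw [h6, Matrix.trace_smul, smul_eq_mul, mul_inv_cancel_left₀ hpi, Matrix.trace]
      simp only [Matrix.diag_apply, mul_self_diag h2]
      rw [← Complex.ofReal_sum, Complex.norm_real, Complex.norm_real,
        Real.norm_of_nonneg (by positivity), Real.norm_of_nonneg (by positivity)]
      exact Finset.single_le_sum (f := fun i => ∑ k, ‖S t i k‖ ^ 2)
        (fun k _ => by positivity) (Finset.mem_univ i)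

end SquareRoot

/-! ### Fourier coefficients and Fejér means of integrable functions -/

section Fourier

@[simp] theorem expo_zero (t : ℝ) : expo 0 t = 1 := by simp [expo]

theorem expo_add (m n : ℤ) (t : ℝ) : expo (m + n) t = expo m t * expo n t := by
  simp only [expo, ← Complex.exp_add]
  congr 1; push_cast; ring

theorem conj_expo (n : ℤ) (t : ℝ) : (starRingEnd ℂ) (expo n t) = expo (-n) t := by
  simp only [expo, ← Complex.exp_conj]
  congr 1; simp

theorem expo_sub (m n : ℤ) (t : ℝ) : expo (m - n) t = expo m t * (starRingEnd ℂ) (expo n t) := by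
  rw [conj_expo, ← expo_add, sub_eq_add_neg]

/-- Separation of the variables of a difference kernel. -/
theorem expo_real_sub (n : ℤ) (t x : ℝ) : expo n (t - x) = expo n t * expo (-n) x := by
  simp only [expo, ← Complex.exp_add]
  congr 1; push_cast; ring

@[simp] theorem norm_expo (n : ℤ) (t : ℝ) : ‖expo n t‖ = 1 := by
  rw [expo, Complex.norm_exp]; simp

@[fun_prop] theorem continuous_expo (n : ℤ) : Continuous (expo n) := by
  unfold expo; fun_prop

instance : IsFiniteMeasure freq := by unfold freq; infer_instance

theorem freq_real_univ : freq.real Set.univ = 2 * Real.pi := by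
  have := Real.pi_pos
  simp [freq, Measure.real, Real.volume_Ioc]
  rw [ENNReal.toReal_ofReal] <;> linarith

theorem two_pi_ne_zero' : (2 * Real.pi : ℂ) ≠ 0 := by simp [Real.pi_ne_zero]

theorem integral_expo (n : ℤ) :
    ∫ t, expo n t ∂freq = if n = 0 then (2 * Real.pi : ℂ) else 0 := by
  split_ifs with h
  · subst h
    simp only [expo_zero, integral_const, freq_real_univ]
    simp
  · have hpi : -Real.pi ≤ Real.pi := by linarith [Real.pi_pos]
    rw [freq, ← intervalIntegral.integral_of_le hpi]
    have hc : (Complex.I * n) ≠ 0 := by simp [h]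
    simp only [expo]
    rw [integral_exp_mul_complex hc]
    have : Complex.exp (Complex.I * n * (Real.pi : ℝ)) =
        Complex.exp (Complex.I * n * ((-Real.pi : ℝ) : ℂ)) := by
      rw [Complex.exp_eq_exp_iff_exists_int]
      exact ⟨n, by push_cast; ring⟩
    rw [this, sub_self, zero_div]

/-- The Fourier coefficient `(2π)⁻¹ ∫ u(t) e^{-int} dt`. -/
noncomputable def fcoef (u : ℝ → ℂ) (n : ℤ) : ℂ :=
  (2 * Real.pi : ℂ)⁻¹ * ∫ t, u t * expo (-n) t ∂freq

theorem integrable_expo (n : ℤ) : Integrable (expo n) freq :=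
  Integrable.of_bound (continuous_expo n).aestronglyMeasurable 1 (by simp)

theorem fcoef_expo (m n : ℤ) : fcoef (expo m) n = if m = n then 1 else 0 := by
  simp only [fcoef, ← expo_add, integral_expo, ← sub_eq_add_neg, sub_eq_zero]
  split_ifs
  · exact inv_mul_cancel₀ two_pi_ne_zero'
  · simp

theorem integrable_mul_expo {u : ℝ → ℂ} (hu : Integrable u freq) (n : ℤ) :
    Integrable (fun t => u t * expo n t) freq :=
  hu.mul_bdd (c := 1) (continuous_expo n).aestronglyMeasurable (by simp)

theorem fcoef_add {u v : ℝ → ℂ} (hu : Integrable u freq) (hv : Integrable v freq) (n : ℤ) :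
    fcoef (u + v) n = fcoef u n + fcoef v n := by
  simp only [fcoef, Pi.add_apply, add_mul]
  rw [integral_add (integrable_mul_expo hu _) (integrable_mul_expo hv _), mul_add]

theorem fcoef_smul (c : ℂ) (u : ℝ → ℂ) (n : ℤ) : fcoef (c • u) n = c * fcoef u n := by
  simp only [fcoef, Pi.smul_apply, smul_eq_mul, mul_assoc, integral_const_mul]
  ring

theorem fcoef_sub {u v : ℝ → ℂ} (hu : Integrable u freq) (hv : Integrable v freq) (n : ℤ) :
    fcoef (u - v) n = fcoef u n - fcoef v n := by
  simp only [fcoef, Pi.sub_apply, sub_mul]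
  rw [integral_sub (integrable_mul_expo hu _) (integrable_mul_expo hv _), mul_sub]

theorem fcoef_conj (u : ℝ → ℂ) (n : ℤ) :
    fcoef (fun t => (starRingEnd ℂ) (u t)) n = (starRingEnd ℂ) (fcoef u (-n)) := by
  simp only [fcoef, map_mul, map_inv₀, ← integral_conj, conj_expo, neg_neg]
  rw [Complex.conj_ofNat, Complex.conj_ofReal]

theorem fcoef_congr {u v : ℝ → ℂ} (h : u =ᵐ[freq] v) (n : ℤ) : fcoef u n = fcoef v n := by
  unfold fcoef
  congr 1
  exact integral_congr_ae (h.mono fun t ht => by simp only [ht])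

theorem fcoef_finset_sum {ι : Type*} (s : Finset ι) (c : ι → ℂ) (m : ι → ℤ) (n : ℤ) :
    fcoef (fun t => ∑ i ∈ s, c i * expo (m i) t) n = ∑ i ∈ s, if m i = n then c i else 0 := by
  have : ∀ i, c i * fcoef (expo (m i)) n = if m i = n then c i else 0 := fun i => by
    rw [fcoef_expo]; split_ifs <;> simp
  simp only [← this, fcoef, Finset.sum_mul, mul_assoc]
  rw [integral_finsetSum _ fun i _ => (integrable_mul_expo (integrable_expo (m i)) _).const_mul _,
    Finset.mul_sum]
  refine Finset.sum_congr rfl fun i _ => ?_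
  rw [integral_const_mul]
  ring

/-- The trigonometric polynomial `(N + 1)⁻¹ ∑_{j, k ≤ N} c(j - k) e^{i(j - k)t}`. -/
noncomputable def fejerSum (N : ℕ) (c : ℤ → ℂ) (t : ℝ) : ℂ :=
  (N + 1 : ℂ)⁻¹ * ∑ j ∈ Finset.range (N + 1), ∑ k ∈ Finset.range (N + 1),
    c ((j : ℤ) - k) * expo ((j : ℤ) - k) t

/-- The `N`-th Fejér mean of `u`, written as a double sum over Fourier coefficients so that the
kernel is visibly the square `|∑_{j ≤ N} e^{ijt}|² / (N + 1)`. -/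
noncomputable def fejer (N : ℕ) (u : ℝ → ℂ) : ℝ → ℂ := fejerSum N (fcoef u)

theorem fejer_eq_integral {u : ℝ → ℂ} (hu : Integrable u freq) (N : ℕ) (t : ℝ) :
    fejer N u t = ((2 * Real.pi)⁻¹ * (N + 1 : ℝ)⁻¹ : ℝ) *
      ∫ x, u x * (‖∑ j ∈ Finset.range (N + 1), expo j (t - x)‖ ^ 2 : ℝ) ∂freq := by
  have h1 : ∀ x, u x * (‖∑ j ∈ Finset.range (N + 1), expo j (t - x)‖ ^ 2 : ℝ) =
      ∑ j ∈ Finset.range (N + 1), ∑ k ∈ Finset.range (N + 1),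
        (u x * expo (-((j : ℤ) - k)) x) * expo ((j : ℤ) - k) t := by
    intro x
    rw [Complex.ofReal_pow, ← Complex.mul_conj', map_sum, Finset.sum_mul_sum, Finset.mul_sum]
    refine Finset.sum_congr rfl fun j _ => ?_
    rw [Finset.mul_sum]
    refine Finset.sum_congr rfl fun k _ => ?_
    rw [← expo_sub, expo_real_sub]; ring
  simp only [h1]
  rw [integral_finsetSum _ fun j _ => integrable_finsetSum _ fun k _ =>
    (integrable_mul_expo hu _).mul_const _]
  simp only [fejer, fejerSum, fcoef, Finset.mul_sum]
  refine Finset.sum_congr rfl fun j _ => ?_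
  rw [integral_finsetSum _ fun k _ => (integrable_mul_expo hu _).mul_const _, Finset.mul_sum]
  refine Finset.sum_congr rfl fun k _ => ?_
  rw [integral_mul_const]
  push_cast
  ring

theorem norm_fejer_le {u : ℝ → ℂ} {v : ℝ → ℝ} (hu : Integrable u freq)
    (hv : Integrable v freq) (huv : ∀ t, ‖u t‖ ≤ v t) (N : ℕ) (t : ℝ) :
    ‖fejer N u t‖ ≤ (fejer N (fun x => (v x : ℂ)) t).re := by
  have hc : 0 ≤ ((2 * Real.pi)⁻¹ * (N + 1 : ℝ)⁻¹ : ℝ) := by have := Real.pi_pos; positivity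
  have hv' : Integrable (fun x => (v x : ℂ)) freq := hv.ofReal
  rw [fejer_eq_integral hu, fejer_eq_integral hv']
  simp only [← Complex.ofReal_mul, integral_complex_ofReal, Complex.ofReal_re]
  rw [norm_mul, Complex.norm_real, Real.norm_of_nonneg hc]
  refine mul_le_mul_of_nonneg_left ?_ hc
  refine norm_integral_le_of_norm_le ?_ (Eventually.of_forall fun x => ?_)
  · refine hv.mul_bdd (c := (∑ j ∈ Finset.range (N + 1), (1 : ℝ)) ^ 2)
      (by fun_prop) (Eventually.of_forall fun x => ?_)
    rw [Real.norm_of_nonneg (by positivity)]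
    gcongr
    exact (norm_sum_le _ _).trans (by simp)
  · rw [norm_mul, Complex.norm_real, Real.norm_of_nonneg (by positivity)]
    exact mul_le_mul_of_nonneg_right (huv x) (by positivity)

theorem continuous_fejerSum (N : ℕ) (c : ℤ → ℂ) : Continuous (fejerSum N c) := by
  unfold fejerSum; fun_prop

theorem continuous_fejer (N : ℕ) (u : ℝ → ℂ) : Continuous (fejer N u) := continuous_fejerSum N _

theorem integrable_of_continuous {E : Type*} [NormedAddCommGroup E] [SecondCountableTopology E]
    {u : ℝ → E} (hu : Continuous u) : Integrable u freq :=
  hu.locallyIntegrable.integrableOn_isCompact isCompact_Icc |>.mono_set Set.Ioc_subset_Icc_self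

theorem integral_fejerSum (N : ℕ) (c : ℤ → ℂ) :
    ∫ t, fejerSum N c t ∂freq = (2 * Real.pi : ℂ) * c 0 := by
  simp only [fejerSum]
  rw [integral_const_mul, integral_finsetSum _ fun j _ => integrable_of_continuous (by fun_prop)]
  have h : ∀ j ∈ Finset.range (N + 1), ∫ t, ∑ k ∈ Finset.range (N + 1),
      c ((j : ℤ) - k) * expo ((j : ℤ) - k) t ∂freq = (2 * Real.pi : ℂ) * c 0 := by
    intro j hj
    rw [integral_finsetSum _ fun k _ => integrable_of_continuous (by fun_prop)]
    simp only [integral_const_mul, integral_expo, sub_eq_zero, Nat.cast_inj]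
    simp only [mul_ite, mul_zero, Finset.sum_ite_eq, hj, if_true]
    rw [sub_self, mul_comm]
  rw [Finset.sum_congr rfl h, Finset.sum_const, Finset.card_range, nsmul_eq_mul]
  push_cast
  rw [inv_mul_cancel_left₀]
  exact_mod_cast Nat.succ_ne_zero N

theorem integral_fejer (N : ℕ) (u : ℝ → ℂ) : ∫ t, fejer N u t ∂freq = ∫ t, u t ∂freq := by
  rw [fejer, integral_fejerSum]
  simp only [fcoef, neg_zero, expo_zero, mul_one]
  rw [mul_inv_cancel_left₀ two_pi_ne_zero']

theorem integral_norm_fejer_le {u : ℝ → ℂ} (hu : Integrable u freq) (N : ℕ) :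
    ∫ t, ‖fejer N u t‖ ∂freq ≤ ∫ t, ‖u t‖ ∂freq := by
  have h1 : ∫ t, ‖fejer N u t‖ ∂freq ≤ ∫ t, (fejer N (fun x => (‖u x‖ : ℂ)) t).re ∂freq :=
    integral_mono (integrable_of_continuous (continuous_fejer N u).norm)
      (integrable_of_continuous (Complex.continuous_re.comp (continuous_fejer N _)))
      fun t => norm_fejer_le hu hu.norm (fun _ => le_rfl) N t
  refine h1.trans (le_of_eq ?_)
  have h2 := integral_fejer N fun x => (‖u x‖ : ℂ)
  have h3 := integral_re (integrable_of_continuous (continuous_fejer N fun x => (‖u x‖ : ℂ)))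
  simp only [RCLike.re_to_complex] at h3
  rw [h3, h2, integral_complex_ofReal, Complex.ofReal_re]

theorem fejer_add {u v : ℝ → ℂ} (hu : Integrable u freq) (hv : Integrable v freq) (N : ℕ) :
    fejer N (u + v) = fejer N u + fejer N v := by
  funext t
  simp only [fejer, fejerSum, fcoef_add hu hv, add_mul, Finset.sum_add_distrib, mul_add,
    Pi.add_apply]

theorem fejer_sub {u v : ℝ → ℂ} (hu : Integrable u freq) (hv : Integrable v freq) (N : ℕ) :
    fejer N (u - v) = fejer N u - fejer N v := by
  funext t
  simp only [fejer, fejerSum, fcoef_sub hu hv, sub_mul, Finset.sum_sub_distrib, mul_sub,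
    Pi.sub_apply]

theorem fejer_smul (c : ℂ) (u : ℝ → ℂ) (N : ℕ) : fejer N (c • u) = c • fejer N u := by
  funext t
  simp only [fejer, fejerSum, fcoef_smul, Pi.smul_apply, smul_eq_mul, Finset.mul_sum]
  refine Finset.sum_congr rfl fun j _ => Finset.sum_congr rfl fun k _ => by ring

/-- The number of pairs in `{0, …, N}²` with difference `m` is at least `N + 1 - |m|`. -/
theorem le_sum_ite_sub_eq (N : ℕ) (m : ℤ) :
    (N + 1 : ℝ) - m.natAbs ≤ ∑ j ∈ Finset.range (N + 1), ∑ k ∈ Finset.range (N + 1),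
      (if m = (j : ℤ) - k then (1 : ℝ) else 0) := by
  have h : ∀ j ∈ Finset.range (N + 1), (if (m ≤ j ∧ j - m ≤ N) then (1 : ℝ) else 0) ≤
      ∑ k ∈ Finset.range (N + 1), (if m = (j : ℤ) - k then (1 : ℝ) else 0) := by
    intro j hj
    split_ifs with hm
    · refine le_trans (le_of_eq ?_) (Finset.single_le_sum (fun k _ => by positivity)
        (Finset.mem_range.2 (show ((j : ℤ) - m).toNat < N + 1 by omega)))
      rw [if_pos (by omega)]
    · positivity
  refine le_trans ?_ (Finset.sum_le_sum h)
  rw [Finset.sum_boole]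
  have hc : N + 1 - m.natAbs ≤ (Finset.filter (fun j : ℕ => m ≤ j ∧ (j : ℤ) - m ≤ N)
      (Finset.range (N + 1))).card := by
    rcases le_total 0 m with hm | hm
    · refine le_trans (le_of_eq (Nat.card_Ico m.natAbs (N + 1)).symm) (Finset.card_le_card ?_)
      intro j hj
      simp only [Finset.mem_Ico, Finset.mem_filter, Finset.mem_range] at hj ⊢
      omega
    · refine le_trans (le_of_eq (Finset.card_range (N + 1 - m.natAbs)).symm)
        (Finset.card_le_card ?_)
      intro j hj
      simp only [Finset.mem_filter, Finset.mem_range] at hj ⊢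
      omega
  rw [sub_le_iff_le_add]
  exact_mod_cast Nat.sub_le_iff_le_add.1 hc

theorem sum_ite_sub_eq_le (N : ℕ) (m : ℤ) :
    ∑ j ∈ Finset.range (N + 1), ∑ k ∈ Finset.range (N + 1),
      (if m = (j : ℤ) - k then (1 : ℝ) else 0) ≤ N + 1 := by
  have h : ∀ j ∈ Finset.range (N + 1), ∑ k ∈ Finset.range (N + 1),
      (if m = (j : ℤ) - k then (1 : ℝ) else 0) ≤ 1 := by
    intro j _
    rw [Finset.sum_boole]
    have : (Finset.filter (fun k : ℕ => m = (j : ℤ) - k) (Finset.range (N + 1))).card ≤ 1 :=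
      Finset.card_le_one.2 fun x hx y hy => by
        simp only [Finset.mem_filter] at hx hy
        omega
    exact_mod_cast this
  exact (Finset.sum_le_sum h).trans (by simp)

theorem tendsto_fejer_expo (m : ℤ) :
    Tendsto (fun N : ℕ => ∫ t, ‖fejer N (expo m) t - expo m t‖ ∂freq) atTop (𝓝 0) := by
  have h1 : ∀ N : ℕ, ∀ t, ‖fejer N (expo m) t - expo m t‖ ≤ m.natAbs / ((N : ℝ) + 1) := by
    intro N t
    have hN : (0 : ℝ) < N + 1 := by positivity
    obtain ⟨S, hS⟩ : ∃ S, S = ∑ j ∈ Finset.range (N + 1), ∑ k ∈ Finset.range (N + 1),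
      (if m = (j : ℤ) - k then (1 : ℝ) else 0) := ⟨_, rfl⟩
    have hle := sum_ite_sub_eq_le N m
    have hge := le_sum_ite_sub_eq N m
    rw [← hS] at hle hge
    have he : fejer N (expo m) t = ((S / (N + 1) : ℝ) : ℂ) * expo m t := by
      rw [hS, fejer, fejerSum]
      push_cast
      rw [div_eq_inv_mul, mul_assoc, Finset.sum_mul]
      congr 1
      refine Finset.sum_congr rfl fun j _ => ?_
      rw [Finset.sum_mul]
      refine Finset.sum_congr rfl fun k _ => ?_
      rw [fcoef_expo]
      split_ifs with h
      · rw [← h]; simp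
      · simp
    rw [he, ← sub_one_mul, norm_mul, norm_expo, mul_one, ← Complex.ofReal_one, ← Complex.ofReal_sub,
      Complex.norm_real, Real.norm_eq_abs, abs_sub_comm, abs_of_nonneg]
    · rw [le_div_iff₀ hN, sub_mul, div_mul_cancel₀ _ hN.ne']
      linarith
    · rw [sub_nonneg, div_le_one hN]; exact hle
  have h2 : Tendsto (fun N : ℕ => (m.natAbs / ((N : ℝ) + 1)) * (2 * Real.pi)) atTop (𝓝 0) := by
    have := (tendsto_one_div_add_atTop_nhds_zero_nat (𝕜 := ℝ)).const_mul
      ((m.natAbs : ℝ) * (2 * Real.pi))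
    rw [mul_zero] at this
    refine this.congr fun N => by ring
  refine squeeze_zero (fun N => integral_nonneg fun t => norm_nonneg _) (fun N => ?_) h2
  refine (integral_mono (g := fun _ => (m.natAbs / ((N : ℝ) + 1)))
    (integrable_of_continuous ?_) (integrable_const _) (h1 N)).trans (le_of_eq ?_)
  · exact ((continuous_fejer N _).sub (continuous_expo m)).norm
  · rw [integral_const, freq_real_univ, smul_eq_mul, mul_comm]

/-- Trigonometric polynomials are dense in `L¹` of the frequency interval. -/
theorem exists_span_expo_integral_norm_sub_lt {u : ℝ → ℂ} (hu : Integrable u freq) {ε : ℝ}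
    (hε : 0 < ε) : ∃ p ∈ Submodule.span ℂ (Set.range expo), ∫ t, ‖u t - p t‖ ∂freq < ε := by
  have : Fact (0 < 2 * Real.pi) := ⟨Real.two_pi_pos⟩
  have : Fact ((1 : ℝ≥0∞) ≤ 1) := ⟨le_rfl⟩
  have hI : Set.Ioc (-Real.pi) Real.pi = Set.Ioc (-Real.pi) (-Real.pi + 2 * Real.pi) := by
    congr 1; ring
  let v : AddCircle (2 * Real.pi) → ℂ := AddCircle.liftIoc (2 * Real.pi) (-Real.pi) u
  have hv : Integrable v volume := by
    have h2 : Integrable (fun x : Set.Ioc (-Real.pi) (-Real.pi + 2 * Real.pi) => u x)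
        (Measure.comap Subtype.val volume) := by
      have h3 : Integrable u (Measure.map Subtype.val (Measure.comap
          (Subtype.val : Set.Ioc (-Real.pi) (-Real.pi + 2 * Real.pi) → ℝ) volume)) := by
        rw [map_comap_subtype_coe measurableSet_Ioc, ← hI]
        exact hu
      exact ((MeasurableEmbedding.subtype_coe measurableSet_Ioc).integrable_map_iff).1 h3
    have h4 : MeasurePreserving (AddCircle.equivIoc (2 * Real.pi) (-Real.pi)) volume
      (Measure.comap Subtype.val volume) := AddCircle.measurePreserving_equivIoc _
    exact h4.integrable_comp_of_integrable h2
  have hvu : ∀ t ∈ Set.Ioc (-Real.pi) Real.pi, v (t : AddCircle (2 * Real.pi)) = u t := by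
    intro t ht
    rw [hI] at ht
    exact AddCircle.liftIoc_coe_apply ht
  have hv' : MemLp v 1 (AddCircle.haarAddCircle (T := 2 * Real.pi)) := by
    rw [memLp_one_iff_integrable]
    rw [AddCircle.volume_eq_smul_haarAddCircle] at hv
    exact (integrable_smul_measure (by simp [Real.pi_pos]) ENNReal.ofReal_ne_top).1 hv
  have hcl : hv'.toLp v ∈ (Submodule.span ℂ (Set.range
      (fourierLp (T := 2 * Real.pi) 1))).topologicalClosure := by
    rw [span_fourierLp_closure_eq_top ENNReal.one_ne_top]; trivial
  have hδ : 0 < ε / (2 * Real.pi) := by have := Real.pi_pos; positivity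
  obtain ⟨q, hq, hqv⟩ := Metric.mem_closure_iff.1 hcl _ hδ
  have hq' : ∃ p ∈ Submodule.span ℂ (Set.range expo), ∃ p' : AddCircle (2 * Real.pi) → ℂ,
      (q =ᵐ[AddCircle.haarAddCircle] p') ∧ ∀ t : ℝ, p' t = p t := by
    clear hqv
    refine Submodule.span_induction (p := fun
      (q : Lp ℂ 1 (AddCircle.haarAddCircle (T := 2 * Real.pi))) _ =>
      ∃ p ∈ Submodule.span ℂ (Set.range expo),
      ∃ p' : AddCircle (2 * Real.pi) → ℂ,
      (q =ᵐ[AddCircle.haarAddCircle] p') ∧ ∀ t : ℝ, p' t = p t) ?_ ?_ ?_ ?_ hq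
    · rintro _ ⟨n, rfl⟩
      refine ⟨expo n, Submodule.subset_span ⟨n, rfl⟩, fourier n, coeFn_fourierLp 1 n, fun t => ?_⟩
      rw [fourier_coe_apply, expo]
      congr 1
      have := two_pi_ne_zero'
      push_cast
      field_simp
    · exact ⟨0, Submodule.zero_mem _, 0, Lp.coeFn_zero _ _ _, fun t => rfl⟩
    · rintro x y _ _ ⟨p, hp, p', h1, h2⟩ ⟨r, hr, r', h3, h4⟩
      refine ⟨p + r, Submodule.add_mem _ hp hr, p' + r', ?_, fun t => by simp [h2, h4]⟩
      exact (Lp.coeFn_add x y).trans (h1.add h3)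
    · rintro c x _ ⟨p, hp, p', h1, h2⟩
      refine ⟨c • p, Submodule.smul_mem _ c hp, c • p', ?_, fun t => by simp [h2]⟩
      exact (Lp.coeFn_smul c x).trans (h1.const_smul c)
  obtain ⟨p, hp, p', hqp, hpp⟩ := hq'
  refine ⟨p, hp, ?_⟩
  have h1 : ∫ t, ‖u t - p t‖ ∂freq =
      ∫ x, ‖v x - p' x‖ ∂(volume : Measure (AddCircle (2 * Real.pi))) := by
    rw [← AddCircle.integral_preimage (2 * Real.pi) (-Real.pi), ← hI]
    refine setIntegral_congr_fun measurableSet_Ioc fun t ht => ?_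
    simp only [hvu t ht, hpp]
  have h2 : dist (hv'.toLp v) q = ∫ x, ‖v x - p' x‖ ∂AddCircle.haarAddCircle := by
    rw [dist_eq_norm, L1.norm_eq_integral_norm]
    refine integral_congr_ae ?_
    filter_upwards [Lp.coeFn_sub (hv'.toLp v) q, hv'.coeFn_toLp, hqp] with x h3 h4 h5
    rw [h3, Pi.sub_apply, h4, h5]
  rw [h1, AddCircle.volume_eq_smul_haarAddCircle, integral_smul_measure, ← h2,
    ENNReal.toReal_ofReal Real.two_pi_pos.le, smul_eq_mul]
  rwa [lt_div_iff₀' Real.two_pi_pos] at hqv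

/-- Fejér means converge in `L¹`. -/
theorem tendsto_integral_norm_fejer_sub {u : ℝ → ℂ} (hu : Integrable u freq) :
    Tendsto (fun N : ℕ => ∫ t, ‖fejer N u t - u t‖ ∂freq) atTop (𝓝 0) := by
  have hspan : ∀ p ∈ Submodule.span ℂ (Set.range expo), Integrable p freq ∧
      Tendsto (fun N : ℕ => ∫ t, ‖fejer N p t - p t‖ ∂freq) atTop (𝓝 0) := by
    intro p hp
    induction hp using Submodule.span_induction with
    | mem x hx =>
      obtain ⟨n, rfl⟩ := hx
      exact ⟨integrable_expo n, tendsto_fejer_expo n⟩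
    | zero =>
      refine ⟨integrable_zero _ _ _, ?_⟩
      simp [fejer, fejerSum, fcoef]
    | add x y _ _ hx hy =>
      refine ⟨hx.1.add hy.1, squeeze_zero (fun N => integral_nonneg fun t => norm_nonneg _)
        (fun N => ?_) (by simpa using hx.2.add hy.2)⟩
      have i1 := (integrable_of_continuous (continuous_fejer N x)).sub hx.1
      have i2 := (integrable_of_continuous (continuous_fejer N y)).sub hy.1
      have n1 : Integrable (fun t => ‖fejer N x t - x t‖) freq := i1.norm
      have n2 : Integrable (fun t => ‖fejer N y t - y t‖) freq := i2.norm
      rw [← integral_add n1 n2, fejer_add hx.1 hy.1]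
      refine integral_mono ?_ (n1.add n2) fun t => ?_
      · refine ((i1.add i2).congr (Eventually.of_forall fun t => ?_)).norm
        simp only [Pi.add_apply, Pi.sub_apply]; ring
      · refine le_trans (le_of_eq ?_) (norm_add_le (fejer N x t - x t) (fejer N y t - y t))
        simp only [Pi.add_apply]; congr 1; ring
    | smul c x _ hx =>
      refine ⟨hx.1.smul c, ?_⟩
      have := hx.2.const_mul ‖c‖
      rw [mul_zero] at this
      refine this.congr fun N => ?_
      rw [fejer_smul, ← integral_const_mul]
      refine integral_congr_ae (Eventually.of_forall fun t => ?_)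
      simp only [Pi.smul_apply, smul_eq_mul, ← mul_sub, norm_mul]
  rw [Metric.tendsto_atTop]
  intro ε hε
  obtain ⟨p, hp, hup⟩ := exists_span_expo_integral_norm_sub_lt hu (show 0 < ε / 3 by positivity)
  obtain ⟨hpi, hpt⟩ := hspan p hp
  obtain ⟨N₀, hN₀⟩ := Metric.tendsto_atTop.1 hpt (ε / 3) (by positivity)
  refine ⟨N₀, fun N hN => ?_⟩
  have h1 := hN₀ N hN
  rw [Real.dist_0_eq_abs, abs_of_nonneg (integral_nonneg fun t => norm_nonneg _)] at h1 ⊢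
  have h2 := integral_norm_fejer_le (hu.sub hpi) N
  have i1 := integrable_of_continuous (continuous_fejer N (u - p))
  have i2 := (integrable_of_continuous (continuous_fejer N p)).sub hpi
  have n1 : Integrable (fun t => ‖fejer N (u - p) t‖) freq := i1.norm
  have n2 : Integrable (fun t => ‖fejer N p t - p t‖) freq := i2.norm
  have n3 : Integrable (fun t => ‖(u - p) t‖) freq := (hu.sub hpi).norm
  have n4 : Integrable (fun t => ‖fejer N (u - p) t‖ + ‖fejer N p t - p t‖) freq := n1.add n2
  have h3 : ∫ t, ‖fejer N u t - u t‖ ∂freq ≤ ∫ t, (‖fejer N (u - p) t‖ + ‖fejer N p t - p t‖ +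
      ‖(u - p) t‖) ∂freq := by
    refine integral_mono ((integrable_of_continuous (continuous_fejer N u)).sub hu).norm
      (n4.add n3) fun t => ?_
    have : fejer N u t - u t = fejer N (u - p) t + (fejer N p t - p t) - (u - p) t := by
      rw [fejer_sub hu hpi]; simp only [Pi.sub_apply]; ring
    simp only [this]
    exact (norm_sub_le _ _).trans (add_le_add_left (norm_add_le _ _) _)
  rw [integral_add n4 n3, integral_add n1 n2] at h3
  simp only [Pi.sub_apply] at h2 h3
  linarith

/-- An integrable function is determined by its Fourier coefficients. -/
theorem ae_eq_zero_of_fcoef_eq_zero {u : ℝ → ℂ} (hu : Integrable u freq)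
    (h : ∀ n, fcoef u n = 0) : u =ᵐ[freq] 0 := by
  have h1 := tendsto_integral_norm_fejer_sub hu
  simp only [fejer, fejerSum, h, zero_mul, Finset.sum_const_zero, mul_zero, zero_sub,
    norm_neg] at h1
  have h2 := tendsto_nhds_unique h1 tendsto_const_nhds
  have h3 := (integral_eq_zero_iff_of_nonneg (fun t => norm_nonneg _) hu.norm).1 h2.symm
  exact h3.mono fun t ht => by simpa using ht

end Fourier

/-! ### The pairing of analytic and anti-analytic integrable functions -/

section Analytic

/-- `F` is integrable and annihilates all `e^{int}`, `n ≥ 0`. -/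
def Annihilates (F : ℝ → ℂ) : Prop :=
  Integrable F freq ∧ ∀ n : ℕ, ∫ t, F t * expo n t ∂freq = 0

/-- Bounded continuous multipliers which preserve the annihilator of the functions `e^{int}`,
`n ≥ 0`: a substitute for the disc algebra which is visibly closed under products. -/
structure IsAnalyticMultiplier (φ : ℝ → ℂ) : Prop where
  continuous : Continuous φ
  bounded : ∃ M, ∀ t, ‖φ t‖ ≤ M
  preserves : ∀ F, Annihilates F → Annihilates fun t => φ t * F t

namespace IsAnalyticMultiplier

theorem of_integral {φ : ℝ → ℂ} (hc : Continuous φ) (hb : ∃ M, ∀ t, ‖φ t‖ ≤ M)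
    (h : ∀ F, Annihilates F → ∀ n : ℕ, ∫ t, φ t * F t * expo n t ∂freq = 0) :
    IsAnalyticMultiplier φ := by
  refine ⟨hc, hb, fun F hF => ⟨?_, h F hF⟩⟩
  obtain ⟨M, hM⟩ := hb
  exact hF.1.bdd_mul (c := M) hc.aestronglyMeasurable (Eventually.of_forall hM)

theorem expo (m : ℕ) : IsAnalyticMultiplier (expo m) := by
  refine of_integral (continuous_expo m) ⟨1, fun t => by simp⟩ fun F hF n => ?_
  have := hF.2 (m + n)
  rw [← this]
  congr 1; funext t
  push_cast
  rw [expo_add]; ring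

theorem const_mul {φ : ℝ → ℂ} (hφ : IsAnalyticMultiplier φ) (c : ℂ) :
    IsAnalyticMultiplier fun t => c * φ t := by
  obtain ⟨M, hM⟩ := hφ.bounded
  refine of_integral (hφ.continuous.const_mul c) ⟨‖c‖ * M, fun t => ?_⟩ fun F hF n => ?_
  · rw [norm_mul]; exact mul_le_mul_of_nonneg_left (hM t) (norm_nonneg c)
  · simp only [mul_assoc]
    rw [integral_const_mul]
    have := (hφ.preserves F hF).2 n
    simp only [mul_assoc] at this
    rw [this, mul_zero]

theorem add {φ ψ : ℝ → ℂ} (hφ : IsAnalyticMultiplier φ) (hψ : IsAnalyticMultiplier ψ) :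
    IsAnalyticMultiplier fun t => φ t + ψ t := by
  obtain ⟨M, hM⟩ := hφ.bounded
  obtain ⟨M', hM'⟩ := hψ.bounded
  refine of_integral (hφ.continuous.add hψ.continuous)
    ⟨M + M', fun t => (norm_add_le _ _).trans (add_le_add (hM t) (hM' t))⟩ fun F hF n => ?_
  have h1 := hφ.preserves F hF
  have h2 := hψ.preserves F hF
  simp only [add_mul]
  rw [integral_add (integrable_mul_expo h1.1 n) (integrable_mul_expo h2.1 n), h1.2, h2.2, add_zero]

theorem const (c : ℂ) : IsAnalyticMultiplier fun _ => c := by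
  have := (expo 0).const_mul c
  simpa using this

theorem sum {ι : Type*} (s : Finset ι) {φ : ι → ℝ → ℂ} (h : ∀ i ∈ s, IsAnalyticMultiplier (φ i)) :
    IsAnalyticMultiplier fun t => ∑ i ∈ s, φ i t := by
  classical
  induction s using Finset.induction_on with
  | empty => simpa using const 0
  | insert a s ha ih =>
    simp only [Finset.sum_insert ha]
    exact (h a (Finset.mem_insert_self a s)).add
      (ih fun i hi => h i (Finset.mem_insert_of_mem hi))

theorem mul {φ ψ : ℝ → ℂ} (hφ : IsAnalyticMultiplier φ) (hψ : IsAnalyticMultiplier ψ) :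
    IsAnalyticMultiplier fun t => φ t * ψ t := by
  obtain ⟨M, hM⟩ := hφ.bounded
  obtain ⟨M', hM'⟩ := hψ.bounded
  refine ⟨hφ.continuous.mul hψ.continuous, ⟨M * M', fun t => ?_⟩, fun F hF => ?_⟩
  · rw [norm_mul]
    exact mul_le_mul (hM t) (hM' t) (norm_nonneg _) ((norm_nonneg _).trans (hM t))
  · simp only [mul_assoc]
    exact hφ.preserves _ (hψ.preserves F hF)

theorem pow {φ : ℝ → ℂ} (hφ : IsAnalyticMultiplier φ) (k : ℕ) :
    IsAnalyticMultiplier fun t => φ t ^ k := by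
  induction k with
  | zero => simpa using const 1
  | succ k ih => simp only [pow_succ]; exact ih.mul hφ

/-- If `Re G ≥ 1`, then `|1 - δ G| < 1` uniformly for a small `δ > 0`, so that `1 / G` is the sum of
the Neumann series `δ ∑ (1 - δ G)ᵏ`. -/
theorem inv {G : ℝ → ℂ} (hG : IsAnalyticMultiplier G) (hre : ∀ t, 1 ≤ (G t).re) :
    IsAnalyticMultiplier fun t => (G t)⁻¹ := by
  obtain ⟨M, hM⟩ := hG.bounded
  have hne : ∀ t, G t ≠ 0 := fun t h => by have := hre t; rw [h] at this; norm_num at this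
  have h1 : ∀ t, 1 ≤ ‖G t‖ := fun t => (hre t).trans (Complex.re_le_norm _)
  have hM1 : 1 ≤ M := (h1 0).trans (hM 0)
  have hb : ∀ t, ‖(G t)⁻¹‖ ≤ 1 := fun t => by rw [norm_inv]; exact inv_le_one_of_one_le₀ (h1 t)
  refine of_integral (hG.continuous.inv₀ hne) ⟨1, hb⟩ fun F hF n => ?_
  -- with `δ = M⁻²` one has `|1 - δ G|² ≤ 1 - 2 δ + δ² M² = 1 - δ`
  obtain ⟨δ, hδ⟩ : ∃ δ : ℝ, δ = (M ^ 2)⁻¹ := ⟨_, rfl⟩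
  have hδ0 : 0 < δ := by rw [hδ]; positivity
  obtain ⟨r, hr⟩ : ∃ r : ℝ, r = Real.sqrt (1 - δ) := ⟨_, rfl⟩
  have hr1 : r < 1 := by rw [hr, Real.sqrt_lt' one_pos]; linarith
  have hr0 : 0 ≤ r := by rw [hr]; exact Real.sqrt_nonneg _
  have hcon : ∀ t, ‖1 - (δ : ℂ) * G t‖ ≤ r := by
    intro t
    rw [hr]
    apply Real.le_sqrt_of_sq_le
    rw [← Complex.normSq_eq_norm_sq, Complex.normSq_apply]
    simp only [Complex.sub_re, Complex.sub_im, Complex.one_re, Complex.one_im,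
      Complex.re_ofReal_mul, Complex.im_ofReal_mul]
    have h3 : (G t).re ^ 2 + (G t).im ^ 2 ≤ M ^ 2 := by
      have := pow_le_pow_left₀ (norm_nonneg _) (hM t) 2
      rw [← Complex.normSq_eq_norm_sq, Complex.normSq_apply] at this
      nlinarith
    have h4 : δ ^ 2 * ((G t).re ^ 2 + (G t).im ^ 2) ≤ δ := by
      calc δ ^ 2 * ((G t).re ^ 2 + (G t).im ^ 2) ≤ δ ^ 2 * M ^ 2 := by gcongr
        _ = δ := by rw [hδ]; field_simp
    nlinarith [hre t, mul_le_mul_of_nonneg_left (hre t) hδ0.le]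
  -- the remainder after `K` terms of the Neumann series
  have hrem : ∀ K : ℕ, ∫ t, (G t)⁻¹ * F t * PCExtrapolation.expo n t ∂freq =
      ∫ t, (1 - (δ : ℂ) * G t) ^ K * ((G t)⁻¹ * F t * PCExtrapolation.expo n t) ∂freq := by
    intro K
    have hφ : IsAnalyticMultiplier fun t => (δ : ℂ) * ∑ k ∈ Finset.range K,
        (1 - (δ : ℂ) * G t) ^ k := by
      refine const_mul (sum _ fun k _ => pow ?_ k) _
      have := (const 1).add (hG.const_mul (-(δ : ℂ)))
      refine (funext fun t => ?_ : (fun t => 1 - (δ : ℂ) * G t) = _) ▸ this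
      ring
    have h5 := (hφ.preserves F hF).2 n
    have hi : Integrable (fun t => (G t)⁻¹ * F t * PCExtrapolation.expo n t) freq :=
      integrable_mul_expo (hF.1.bdd_mul (c := 1) (hG.continuous.inv₀ hne).aestronglyMeasurable
        (Eventually.of_forall hb)) n
    have hi2 : Integrable (fun t => (1 - (δ : ℂ) * G t) ^ K *
        ((G t)⁻¹ * F t * PCExtrapolation.expo n t)) freq := by
      have hGc := hG.continuous
      refine hi.bdd_mul (c := 1) (by fun_prop : Continuous _).aestronglyMeasurable
        (Eventually.of_forall fun t => ?_)
      rw [norm_pow]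
      exact pow_le_one₀ (norm_nonneg _) ((hcon t).trans hr1.le)
    rw [← sub_eq_zero, ← integral_sub hi hi2, ← h5]
    refine integral_congr_ae (Eventually.of_forall fun t => ?_)
    have h6 := mul_neg_geom_sum (1 - (δ : ℂ) * G t) K
    have h7 := hne t
    simp only [sub_sub_cancel] at h6
    calc (G t)⁻¹ * F t * PCExtrapolation.expo n t -
          (1 - (δ : ℂ) * G t) ^ K * ((G t)⁻¹ * F t * PCExtrapolation.expo n t)
        = (G t)⁻¹ * (1 - (1 - (δ : ℂ) * G t) ^ K) * (F t * PCExtrapolation.expo n t) := by ring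
      _ = ((G t)⁻¹ * G t) * ((δ : ℂ) * ∑ i ∈ Finset.range K, (1 - (δ : ℂ) * G t) ^ i) *
          (F t * PCExtrapolation.expo n t) := by rw [← h6]; ring
      _ = _ := by rw [inv_mul_cancel₀ h7]; ring
  have hle : ∀ K : ℕ, ‖∫ t, (G t)⁻¹ * F t * PCExtrapolation.expo n t ∂freq‖ ≤
      r ^ K * ∫ t, ‖F t‖ ∂freq := by
    intro K
    rw [hrem K, ← integral_const_mul]
    refine norm_integral_le_of_norm_le (hF.1.norm.const_mul _) (Eventually.of_forall fun t => ?_)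
    rw [norm_mul, norm_pow, norm_mul, norm_mul, norm_expo, mul_one]
    refine mul_le_mul (pow_le_pow_left₀ (norm_nonneg _) (hcon t) K) ?_ (by positivity)
      (by positivity)
    exact mul_le_of_le_one_left (norm_nonneg _) (hb t)
  have hlim : Tendsto (fun K : ℕ => r ^ K * ∫ t, ‖F t‖ ∂freq) atTop (𝓝 0) := by
    simpa using (tendsto_pow_atTop_nhds_zero_of_lt_one hr0 hr1).mul_const (∫ t, ‖F t‖ ∂freq)
  exact norm_le_zero_iff.1 (ge_of_tendsto' hlim hle)

theorem fejerSum (N : ℕ) {c : ℤ → ℂ} (hc : ∀ n < 0, c n = 0) :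
    IsAnalyticMultiplier (fejerSum N c) := by
  refine const_mul (sum _ fun j _ => sum _ fun k _ => ?_) _
  rcases lt_or_ge ((j : ℤ) - k) 0 with h | h
  · simpa [hc _ h] using const 0
  · obtain ⟨m, hm⟩ := Int.eq_ofNat_of_zero_le h
    rw [hm]
    exact (expo m).const_mul _

theorem annihilates_mul_expo_one {ψ : ℝ → ℂ} (hψ : IsAnalyticMultiplier ψ) :
    Annihilates fun t => ψ t * PCExtrapolation.expo 1 t := by
  refine hψ.preserves _ ⟨integrable_expo 1, fun n => ?_⟩
  simp only [← expo_add, integral_expo]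
  rw [if_neg (by omega)]

/-- The mean value is multiplicative on analytic multipliers. -/
theorem fcoef_zero_mul {φ ψ : ℝ → ℂ} (hφ : IsAnalyticMultiplier φ) (hψ : IsAnalyticMultiplier ψ) :
    fcoef (fun t => φ t * ψ t) 0 = fcoef φ 0 * fcoef ψ 0 := by
  have hi : ∀ {χ : ℝ → ℂ}, IsAnalyticMultiplier χ → Integrable χ freq :=
    fun h => integrable_of_continuous h.continuous
  have hF : Annihilates fun t => ψ t - fcoef ψ 0 := by
    refine ⟨(hi hψ).sub (integrable_const _), fun n => ?_⟩
    simp only [sub_mul]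
    rw [integral_sub (integrable_mul_expo (hi hψ) n) ((integrable_expo n).const_mul _),
      integral_const_mul, integral_expo]
    rcases n with _ | n
    · simp only [fcoef, Nat.cast_zero, neg_zero, expo_zero, mul_one, if_true]
      rw [mul_comm, mul_inv_cancel_left₀ two_pi_ne_zero', sub_self]
    · rw [if_neg (by omega), mul_zero, sub_zero]
      have := hψ.annihilates_mul_expo_one.2 n
      simp only [mul_assoc, ← expo_add] at this
      rw [← this]
      congr 1; funext t; congr 2; push_cast; ring
  have h := (hφ.preserves _ hF).2 0
  simp only [Nat.cast_zero, expo_zero, mul_one, mul_sub] at h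
  rw [integral_sub (hi (hφ.mul hψ)) ((hi hφ).mul_const _), integral_mul_const, sub_eq_zero] at h
  simp only [fcoef, neg_zero, expo_zero, mul_one] at h ⊢
  rw [h]; ring

end IsAnalyticMultiplier

/-- The weights `2, 1, 0` at positive, zero and negative frequencies: they turn the Fourier series
of a real function `u` into that of an analytic function with real part `u`. -/
def analyticWeight (n : ℤ) : ℂ := if 0 < n then 2 else if n = 0 then 1 else 0

/-- The analytic trigonometric polynomial whose real part is the Fejér mean of `v`. -/
noncomputable def analyticFejer (N : ℕ) (v : ℝ → ℝ) : ℝ → ℂ :=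
  fejerSum N fun n => analyticWeight n * fcoef (fun t => (v t : ℂ)) n

theorem analyticFejer_re (N : ℕ) (v : ℝ → ℝ) (t : ℝ) :
    (analyticFejer N v t).re = (fejer N (fun t => (v t : ℂ)) t).re := by
  have hconj : ∀ n, (starRingEnd ℂ) (fcoef (fun t => (v t : ℂ)) n) =
      fcoef (fun t => (v t : ℂ)) (-n) := by
    intro n
    have := fcoef_conj (fun t => (v t : ℂ)) (-n)
    simp only [Complex.conj_ofReal, neg_neg] at this
    exact this.symm
  have hw : ∀ n, (starRingEnd ℂ) (analyticWeight n) = analyticWeight n := by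
    intro n; unfold analyticWeight; split_ifs
    exacts [Complex.conj_ofNat 2, map_one _, map_zero _]
  have hw2 : ∀ n, analyticWeight n + analyticWeight (-n) = 2 := by
    intro n
    unfold analyticWeight
    rcases lt_trichotomy n 0 with h | h | h
    · rw [if_neg (by omega), if_neg (by omega), if_pos (by omega)]; norm_num
    · subst h; norm_num
    · rw [if_pos h, if_neg (by omega), if_neg (by omega)]; norm_num
  have h1 : (starRingEnd ℂ) (analyticFejer N v t) =
      fejerSum N (fun n => analyticWeight (-n) * fcoef (fun t => (v t : ℂ)) n) t := by
    simp only [analyticFejer, fejerSum, map_mul, map_sum, map_inv₀, hconj, hw, conj_expo]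
    rw [Finset.sum_comm]
    congr 1
    · simp
    · refine Finset.sum_congr rfl fun j _ => Finset.sum_congr rfl fun k _ => ?_
      rw [neg_sub, neg_sub]
  have h2 : analyticFejer N v t + (starRingEnd ℂ) (analyticFejer N v t) =
      2 * fejer N (fun t => (v t : ℂ)) t := by
    rw [h1]
    simp only [analyticFejer, fejer, fejerSum, ← mul_add, ← Finset.sum_add_distrib, ← add_mul, hw2]
    rw [mul_left_comm]
    simp only [Finset.mul_sum, mul_assoc]
  have h3 := congrArg Complex.re h2
  simp only [Complex.add_re, Complex.conj_re, Complex.mul_re, Complex.re_ofNat, Complex.im_ofNat,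
    zero_mul, sub_zero] at h3
  linarith

theorem isAnalyticMultiplier_analyticFejer (N : ℕ) (v : ℝ → ℝ) :
    IsAnalyticMultiplier (analyticFejer N v) := by
  refine IsAnalyticMultiplier.fejerSum N fun n hn => ?_
  rw [analyticWeight, if_neg (by omega), if_neg (by omega), zero_mul]

theorem fcoef_zero_analyticFejer (N : ℕ) (v : ℝ → ℝ) :
    fcoef (analyticFejer N v) 0 = fcoef (fun t => (v t : ℂ)) 0 := by
  have := integral_fejerSum N fun n => analyticWeight n * fcoef (fun t => (v t : ℂ)) n
  rw [fcoef]
  simp only [neg_zero, expo_zero, mul_one]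
  rw [analyticFejer, this, inv_mul_cancel_left₀ two_pi_ne_zero']
  simp [analyticWeight]

/-- The multipliers `ψ = 1 / (1 + ε g)`, with `g` analytic and `Re g` the Fejér mean of `v ≥ 0`,
make the Fejér means of functions dominated by `v` bounded, and tend to `1` in `L²` as `ε → 0`,
uniformly in `N`: as `|ψ| ≤ 1`, one has `∫ |1 - ψ|² ≤ 2 Re ∫ (1 - ψ)`, and as means are
multiplicative on analytic functions, `ψ` has the mean `1 / (1 + ε m)`, `m` the mean of `v`. -/
theorem exists_taming_multiplier {v : ℝ → ℝ} (hv : Integrable v freq) (hv0 : ∀ t, 0 ≤ v t)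
    {ε : ℝ} (hε : 0 < ε) (N : ℕ) : ∃ ψ : ℝ → ℂ, IsAnalyticMultiplier ψ ∧ (∀ t, ‖ψ t‖ ≤ 1) ∧
      (∀ t, ‖ψ t‖ * (fejer N (fun t => (v t : ℂ)) t).re ≤ ε⁻¹) ∧
      ∫ t, ‖1 - ψ t‖ ^ 2 ∂freq ≤ 2 * ε * ∫ t, v t ∂freq := by
  have hu0 : ∀ t, 0 ≤ (fejer N (fun t => (v t : ℂ)) t).re := fun t => by
    have := norm_fejer_le (u := fun t => (v t : ℂ)) hv.ofReal hv
      (fun t => by rw [Complex.norm_real, Real.norm_of_nonneg (hv0 t)]) N t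
    exact (norm_nonneg _).trans this
  have hG : IsAnalyticMultiplier fun t => 1 + (ε : ℂ) * analyticFejer N v t :=
    (IsAnalyticMultiplier.const 1).add ((isAnalyticMultiplier_analyticFejer N v).const_mul _)
  have hre : ∀ t, (1 + (ε : ℂ) * analyticFejer N v t).re =
      1 + ε * (fejer N (fun t => (v t : ℂ)) t).re := fun t => by
    rw [Complex.add_re, Complex.re_ofReal_mul, analyticFejer_re, Complex.one_re]
  have hre1 : ∀ t, 1 ≤ (1 + (ε : ℂ) * analyticFejer N v t).re := fun t => by
    rw [hre]; have := mul_nonneg hε.le (hu0 t); linarith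
  have hnorm : ∀ t, 1 + ε * (fejer N (fun t => (v t : ℂ)) t).re ≤
      ‖1 + (ε : ℂ) * analyticFejer N v t‖ := fun t => by
    rw [← hre]; exact Complex.re_le_norm _
  have hne : ∀ t, 1 + (ε : ℂ) * analyticFejer N v t ≠ 0 := fun t h => by
    have := hre1 t; rw [h] at this; norm_num at this
  have hψ := hG.inv hre1
  have hψ1 : ∀ t, ‖(1 + (ε : ℂ) * analyticFejer N v t)⁻¹‖ ≤ 1 := fun t => by
    rw [norm_inv]
    exact inv_le_one_of_one_le₀ ((hre1 t).trans (Complex.re_le_norm _))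
  refine ⟨_, hψ, hψ1, fun t => ?_, ?_⟩
  · rw [norm_inv, ← div_eq_inv_mul, div_le_iff₀ (norm_pos_iff.2 (hne t)), inv_mul_eq_div,
      le_div_iff₀ hε]
    have := hnorm t
    nlinarith [hu0 t]
  · obtain ⟨ψ, hψe⟩ : ∃ ψ : ℝ → ℂ, ψ = fun t => (1 + (ε : ℂ) * analyticFejer N v t)⁻¹ := ⟨_, rfl⟩
    simp only [← hψe] at hψ
    have hψ1' : ∀ t, ‖ψ t‖ ≤ 1 := by rw [hψe]; exact hψ1
    obtain ⟨m, hm⟩ : ∃ m : ℝ, m = (2 * Real.pi)⁻¹ * ∫ t, v t ∂freq := ⟨_, rfl⟩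
    have hm0 : 0 ≤ m := by
      rw [hm]; exact mul_nonneg (by have := Real.pi_pos; positivity) (integral_nonneg hv0)
    have hmean : fcoef ψ 0 = (((1 + ε * m)⁻¹ : ℝ) : ℂ) := by
      have h1 := hG.fcoef_zero_mul hψ
      have h2 : fcoef (fun t => 1 + (ε : ℂ) * analyticFejer N v t) 0 = ((1 + ε * m : ℝ) : ℂ) := by
        have := fcoef_add (integrable_expo 0) ((integrable_of_continuous
          (isAnalyticMultiplier_analyticFejer N v).continuous).smul (ε : ℂ)) 0
        rw [fcoef_smul, fcoef_expo, if_pos rfl, fcoef_zero_analyticFejer] at this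
        have h3 : expo 0 + (ε : ℂ) • analyticFejer N v =
            fun t => 1 + (ε : ℂ) * analyticFejer N v t := by
          funext t; simp
        rw [h3] at this
        rw [this, fcoef]
        simp only [neg_zero, expo_zero, mul_one]
        rw [integral_complex_ofReal, hm]
        push_cast; ring
      have h3 : fcoef (fun t => (1 + (ε : ℂ) * analyticFejer N v t) * ψ t) 0 = 1 := by
        have : (fun t => (1 + (ε : ℂ) * analyticFejer N v t) * ψ t) = expo 0 := by
          funext t
          rw [hψe]
          simp only [expo_zero]
          exact mul_inv_cancel₀ (hne t)
        rw [this, fcoef_expo, if_pos rfl]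
      rw [h3, h2] at h1
      rw [Complex.ofReal_inv]
      exact eq_inv_of_mul_eq_one_right h1.symm
    have hint : ∫ t, (ψ t).re ∂freq = 2 * Real.pi * (1 + ε * m)⁻¹ := by
      have h3 := integral_re (integrable_of_continuous hψ.continuous)
      simp only [RCLike.re_to_complex] at h3
      rw [h3]
      have h4 : ∫ t, ψ t ∂freq = (2 * Real.pi : ℂ) * fcoef ψ 0 := by
        simp only [fcoef, neg_zero, expo_zero, mul_one]
        rw [mul_inv_cancel_left₀ two_pi_ne_zero']
      rw [h4, hmean, show (2 * Real.pi : ℂ) = ((2 * Real.pi : ℝ) : ℂ) by push_cast; rfl,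
        ← Complex.ofReal_mul, Complex.ofReal_re]
    have hre_int : Integrable (fun t => (ψ t).re) freq :=
      integrable_of_continuous (Complex.continuous_re.comp hψ.continuous)
    have hle : ∫ t, ‖1 - ψ t‖ ^ 2 ∂freq ≤ ∫ t, (2 - 2 * (ψ t).re) ∂freq := by
      refine integral_mono (integrable_of_continuous
        ((continuous_const.sub hψ.continuous).norm.pow 2))
        ((integrable_const _).sub (hre_int.const_mul 2)) fun t => ?_
      have h1 : ‖ψ t‖ ^ 2 ≤ 1 := pow_le_one₀ (norm_nonneg _) (hψ1' t)
      rw [← Complex.normSq_eq_norm_sq, Complex.normSq_apply] at h1 ⊢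
      simp only [Complex.sub_re, Complex.sub_im, Complex.one_re, Complex.one_im]
      nlinarith
    simp only [hψe] at hle ⊢
    refine hle.trans ?_
    simp only [hψe] at hre_int hint
    rw [integral_sub (integrable_const _) (hre_int.const_mul 2), integral_const_mul, hint,
      integral_const, freq_real_univ, smul_eq_mul]
    have h5 : ∫ t, v t ∂freq = 2 * Real.pi * m := by
      rw [hm, mul_inv_cancel_left₀ (by have := Real.pi_pos; positivity)]
    rw [h5]
    have h6 : 1 - ε * m ≤ (1 + ε * m)⁻¹ := by
      rw [← one_div, le_div_iff₀ (by positivity)]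
      nlinarith [mul_nonneg hε.le hm0]
    nlinarith [mul_le_mul_of_nonneg_left h6 Real.two_pi_pos.le]

variable {ι : Type*} [Fintype ι]

/-- If `D` has no Fourier coefficients of negative order, `F` annihilates the functions `e^{int}`,
`n ≥ 0`, and `∑ D_ν F_ν` is integrable, then its integral vanishes. No integrability of the single
products is needed: `D` is replaced by its Fejér means, multiplied by taming multipliers. -/
theorem integral_sum_mul_eq_zero {D F : ι → ℝ → ℂ} (hD : ∀ ν, Integrable (D ν) freq)
    (hD0 : ∀ ν, ∀ n < 0, fcoef (D ν) n = 0) (hF : ∀ ν, Annihilates (F ν))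
    (hq : Integrable (fun t => ∑ ν, D ν t * F ν t) freq) :
    ∫ t, ∑ ν, D ν t * F ν t ∂freq = 0 := by
  obtain ⟨q, hqdef⟩ : ∃ q : ℝ → ℂ, q = fun t => ∑ ν, D ν t * F ν t := ⟨_, rfl⟩
  rw [← hqdef] at hq ⊢
  let v : ℝ → ℝ := fun t => ∑ ν, ‖D ν t‖
  have hv : Integrable v freq := integrable_finsetSum _ fun ν _ => (hD ν).norm
  have hv0 : ∀ t, 0 ≤ v t := fun t => Finset.sum_nonneg fun ν _ => norm_nonneg _
  have hm0 : 0 ≤ ∫ t, v t ∂freq := integral_nonneg hv0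
  have hDv : ∀ ν N t, ‖fejer N (D ν) t‖ ≤ (fejer N (fun t => (v t : ℂ)) t).re := fun ν N t =>
    norm_fejer_le (hD ν) hv (fun t => Finset.single_le_sum (f := fun ν => ‖D ν t‖)
      (fun ν _ => norm_nonneg _) (Finset.mem_univ ν)) N t
  -- almost everywhere convergence of the Fejér means along a subsequence
  obtain ⟨ns, hns, hae⟩ : ∃ ns : ℕ → ℕ, StrictMono ns ∧ ∀ᵐ t ∂freq,
      Tendsto (fun i => ∑ ν, ‖fejer (ns i) (D ν) t - D ν t‖) atTop (𝓝 0) := by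
    have hi : ∀ N ν, Integrable (fun t => ‖fejer N (D ν) t - D ν t‖) freq := fun N ν =>
      ((integrable_of_continuous (continuous_fejer N (D ν))).sub (hD ν)).norm
    have hl1 : Tendsto (fun N => ∫ t, ∑ ν, ‖fejer N (D ν) t - D ν t‖ ∂freq) atTop (𝓝 0) := by
      have : Tendsto (fun N => ∑ ν, ∫ t, ‖fejer N (D ν) t - D ν t‖ ∂freq) atTop (𝓝 0) := by
        simpa using tendsto_finsetSum Finset.univ fun ν _ => tendsto_integral_norm_fejer_sub (hD ν)
      refine this.congr fun N => ?_
      rw [integral_finsetSum _ fun ν _ => hi N ν]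
    have htm : TendstoInMeasure freq (fun N t => ∑ ν, ‖fejer N (D ν) t - D ν t‖) atTop
        (fun _ => (0 : ℝ)) := by
      refine tendstoInMeasure_of_tendsto_eLpNorm one_ne_zero
        (fun N => (integrable_finsetSum _ fun ν _ => hi N ν).aestronglyMeasurable)
        aestronglyMeasurable_const ?_
      have h0 : Tendsto (fun N => ENNReal.ofReal (∫ t, ∑ ν, ‖fejer N (D ν) t - D ν t‖ ∂freq))
          atTop (𝓝 0) := by
        simpa using ENNReal.tendsto_ofReal hl1
      refine h0.congr fun N => ?_
      rw [eLpNorm_one_eq_lintegral_enorm, ofReal_integral_eq_lintegral_ofReal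
        (integrable_finsetSum _ fun ν _ => hi N ν)
        (Eventually.of_forall fun t => Finset.sum_nonneg fun ν _ => norm_nonneg _)]
      refine lintegral_congr fun t => ?_
      simp only [Pi.sub_apply, sub_zero]
      rw [Real.enorm_of_nonneg (Finset.sum_nonneg fun ν _ => norm_nonneg _)]
    exact htm.exists_seq_tendsto_ae
  -- the tamed integrals vanish in the limit
  have hstep : ∀ ε > 0, ∀ κ > 0, ∃ ψ : ℝ → ℂ, Continuous ψ ∧ (∀ t, ‖ψ t‖ ≤ 1) ∧
      ∫ t, ‖1 - ψ t‖ ^ 2 ∂freq ≤ 2 * ε * ∫ t, v t ∂freq ∧ ‖∫ t, ψ t * q t ∂freq‖ < κ := by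
    intro ε hε κ hκ
    choose ψ hψ hψ1 hψD hψ2 using fun N => exists_taming_multiplier hv hv0 hε N
    have hpoly : ∀ N, ∫ t, ψ N t * ∑ ν, fejer N (D ν) t * F ν t ∂freq = 0 := by
      intro N
      have h1 : ∀ ν, Annihilates fun t => ψ N t * fejer N (D ν) t * F ν t := fun ν =>
        ((hψ N).mul (IsAnalyticMultiplier.fejerSum N (hD0 ν))).preserves _ (hF ν)
      have h2 : ∀ ν, ∫ t, ψ N t * fejer N (D ν) t * F ν t ∂freq = 0 := fun ν => by
        simpa using (h1 ν).2 0
      simp only [Finset.mul_sum, ← mul_assoc]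
      rw [integral_finsetSum _ fun ν _ => (h1 ν).1]
      exact Finset.sum_eq_zero fun ν _ => h2 ν
    have hlim : Tendsto (fun i => ∫ t, ψ (ns i) t *
        (∑ ν, fejer (ns i) (D ν) t * F ν t - q t) ∂freq) atTop (𝓝 0) := by
      rw [← integral_zero ℝ ℂ (μ := freq)]
      refine tendsto_integral_of_dominated_convergence
        (fun t => ε⁻¹ * ∑ ν, ‖F ν t‖ + ‖q t‖) (fun i => ?_)
        (((integrable_finsetSum _ fun ν _ => (hF ν).1.norm).const_mul _).add hq.norm)
        (fun i => Eventually.of_forall fun t => ?_) ?_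
      · refine (hψ _).continuous.aestronglyMeasurable.mul (AEStronglyMeasurable.sub ?_ hq.1)
        exact Finset.aestronglyMeasurable_fun_sum _ fun ν _ =>
          (continuous_fejer _ _).aestronglyMeasurable.mul (hF ν).1.1
      · rw [mul_sub]
        refine (norm_sub_le _ _).trans (add_le_add ?_ ?_)
        · rw [Finset.mul_sum, Finset.mul_sum]
          refine (norm_sum_le _ _).trans (Finset.sum_le_sum fun ν _ => ?_)
          rw [norm_mul, norm_mul, ← mul_assoc]
          refine mul_le_mul_of_nonneg_right ?_ (norm_nonneg _)
          exact (mul_le_mul_of_nonneg_left (hDv ν _ t) (norm_nonneg _)).trans (hψD _ t)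
        · rw [norm_mul]
          exact mul_le_of_le_one_left (norm_nonneg _) (hψ1 _ t)
      · filter_upwards [hae] with t ht
        have h1 : ∀ ν, Tendsto (fun i => fejer (ns i) (D ν) t) atTop (𝓝 (D ν t)) := fun ν => by
          rw [tendsto_iff_norm_sub_tendsto_zero]
          exact squeeze_zero (fun i => norm_nonneg _) (fun i => Finset.single_le_sum
            (f := fun ν => ‖fejer (ns i) (D ν) t - D ν t‖) (fun ν _ => norm_nonneg _)
            (Finset.mem_univ ν)) ht
        have h2 : Tendsto (fun i => ∑ ν, fejer (ns i) (D ν) t * F ν t - q t) atTop (𝓝 0) := by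
          have := (tendsto_finsetSum Finset.univ fun ν _ =>
            (h1 ν).mul_const (F ν t)).sub_const (q t)
          rw [hqdef] at this ⊢
          simpa using this
        refine squeeze_zero_norm (fun i => ?_) (tendsto_norm_zero.comp h2)
        rw [norm_mul]
        exact mul_le_of_le_one_left (norm_nonneg _) (hψ1 _ t)
    have hval : ∀ N, ∫ t, ψ N t * (∑ ν, fejer N (D ν) t * F ν t - q t) ∂freq =
        -∫ t, ψ N t * q t ∂freq := by
      intro N
      have hi1 : Integrable (fun t => ψ N t * q t) freq :=
        hq.bdd_mul (c := 1) (hψ N).continuous.aestronglyMeasurable (Eventually.of_forall (hψ1 N))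
      have hi2 : Integrable (fun t => ψ N t * ∑ ν, fejer N (D ν) t * F ν t) freq := by
        simp only [Finset.mul_sum, ← mul_assoc]
        exact integrable_finsetSum _ fun ν _ =>
          (((hψ N).mul (IsAnalyticMultiplier.fejerSum N (hD0 ν))).preserves _ (hF ν)).1
      simp only [mul_sub]
      rw [integral_sub hi2 hi1, hpoly, zero_sub]
    simp only [hval] at hlim
    obtain ⟨i, hi⟩ := (Metric.tendsto_atTop.1 hlim κ hκ)
    have := hi i le_rfl
    rw [dist_zero_right, norm_neg] at this
    exact ⟨ψ (ns i), (hψ _).continuous, hψ1 _, hψ2 _, this⟩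
  -- comparison of `∫ q` with the tamed integrals through a bounded approximation of `q`
  have hbd : ∀ p ∈ Submodule.span ℂ (Set.range expo), Continuous p ∧ ∃ B, ∀ t, ‖p t‖ ≤ B := by
    intro p hp
    induction hp using Submodule.span_induction with
    | mem x hx => obtain ⟨n, rfl⟩ := hx; exact ⟨continuous_expo n, 1, fun t => by simp⟩
    | zero => exact ⟨continuous_zero, 0, fun t => by simp⟩
    | add x y _ _ hx hy =>
      obtain ⟨hx, B, hB⟩ := hx
      obtain ⟨hy, B', hB'⟩ := hy
      exact ⟨hx.add hy, B + B', fun t => (norm_add_le _ _).trans (add_le_add (hB t) (hB' t))⟩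
    | smul c x _ hx =>
      obtain ⟨hx, B, hB⟩ := hx
      refine ⟨hx.const_smul c, ‖c‖ * B, fun t => ?_⟩
      rw [Pi.smul_apply, norm_smul]
      exact mul_le_mul_of_nonneg_left (hB t) (norm_nonneg c)
  have hfin : ∀ κ > 0, ‖∫ t, q t ∂freq‖ ≤ κ := by
    intro κ hκ
    obtain ⟨p, hp, hqp⟩ := exists_span_expo_integral_norm_sub_lt hq (show 0 < κ / 8 by positivity)
    obtain ⟨hpc, B, hB⟩ := hbd p hp
    have hB0 : 0 ≤ B := (norm_nonneg _).trans (hB 0)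
    -- `x ≤ η + x² / η` turns the `L²` bound for `1 - ψ` into an `L¹` bound; `η = κ / (4 M)` and the
    -- parameter `ε = η²` of the multiplier make the contribution of `p` at most `κ / 4`
    obtain ⟨M, hM⟩ : ∃ M : ℝ, M = B * (2 * Real.pi + 2 * ∫ t, v t ∂freq) + 1 := ⟨_, rfl⟩
    have hM0 : 0 < M := by have := Real.pi_pos; rw [hM]; positivity
    obtain ⟨η, hη⟩ : ∃ η : ℝ, η = κ / 4 / M := ⟨_, rfl⟩
    have hη0 : 0 < η := by rw [hη]; positivity
    obtain ⟨ψ, hψc, hψ1, hψ2, hψq⟩ := hstep (η ^ 2) (by positivity) (κ / 4) (by positivity)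
    have hi1 : Integrable (fun t => ψ t * q t) freq :=
      hq.bdd_mul (c := 1) hψc.aestronglyMeasurable (Eventually.of_forall hψ1)
    have hi2 : Integrable (fun t => ‖1 - ψ t‖ ^ 2) freq :=
      integrable_of_continuous ((continuous_const.sub hψc).norm.pow 2)
    have hi3 : Integrable (fun t => ‖q t - p t‖) freq :=
      (hq.sub (integrable_of_continuous hpc)).norm
    have hi4 : Integrable (fun t => B * (η + ‖1 - ψ t‖ ^ 2 / η)) freq :=
      ((integrable_const _).add (hi2.div_const _)).const_mul _
    have h1 : ‖∫ t, (q t - ψ t * q t) ∂freq‖ ≤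
        ∫ t, (2 * ‖q t - p t‖ + B * (η + ‖1 - ψ t‖ ^ 2 / η)) ∂freq := by
      refine norm_integral_le_of_norm_le ((hi3.const_mul 2).add hi4)
        (Eventually.of_forall fun t => ?_)
      have e1 : q t - ψ t * q t = (1 - ψ t) * (q t - p t) + (1 - ψ t) * p t := by ring
      have e2 : ‖1 - ψ t‖ ≤ 2 := (norm_sub_le _ _).trans (by
        rw [norm_one]; linarith [hψ1 t])
      have e3 : ‖1 - ψ t‖ ≤ η + ‖1 - ψ t‖ ^ 2 / η := by
        rw [← sub_le_iff_le_add', le_div_iff₀ hη0]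
        nlinarith [sq_nonneg (‖1 - ψ t‖ - η), norm_nonneg (1 - ψ t)]
      rw [e1]
      refine (norm_add_le _ _).trans (add_le_add ?_ ?_)
      · rw [norm_mul]; exact mul_le_mul_of_nonneg_right e2 (norm_nonneg _)
      · rw [norm_mul, mul_comm]
        exact mul_le_mul (hB t) e3 (norm_nonneg _) hB0
    rw [integral_add (hi3.const_mul 2) hi4, integral_const_mul, integral_const_mul,
      integral_add (integrable_const _) (hi2.div_const _), integral_div, integral_const,
      freq_real_univ, smul_eq_mul, integral_sub hq hi1] at h1
    have h2 : (∫ t, ‖1 - ψ t‖ ^ 2 ∂freq) / η ≤ 2 * η * ∫ t, v t ∂freq := by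
      rw [div_le_iff₀ hη0]; nlinarith
    have h3 : B * (2 * Real.pi * η + (∫ t, ‖1 - ψ t‖ ^ 2 ∂freq) / η) ≤ κ / 4 := by
      calc B * (2 * Real.pi * η + (∫ t, ‖1 - ψ t‖ ^ 2 ∂freq) / η)
          ≤ B * (2 * Real.pi * η + 2 * η * ∫ t, v t ∂freq) := by gcongr
        _ ≤ η * M := by rw [hM]; nlinarith
        _ = κ / 4 := by rw [hη]; field_simp
    have h4 : ‖∫ t, q t ∂freq‖ ≤ ‖∫ t, q t ∂freq - ∫ t, ψ t * q t ∂freq‖ +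
        ‖∫ t, ψ t * q t ∂freq‖ := by
      simpa using norm_add_le (∫ t, q t ∂freq - ∫ t, ψ t * q t ∂freq) (∫ t, ψ t * q t ∂freq)
    linarith
  exact norm_le_zero_iff.1 (le_of_forall_pos_le_add fun κ hκ => by simpa using hfin κ hκ)

end Analytic

/-! ### `L₂(f)` as a space of square-integrable vector functions -/

section Model

variable {T : ℕ}

/-- The Hilbert space `L²((-π, π]; ℂ^T)`. -/
abbrev FreqSpace (T : ℕ) : Type := Lp (EuclideanSpace ℂ (Fin T)) 2 freq

/-- The function `bᵀ A`, with values in the Euclidean space. -/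
noncomputable def twist (A : ℝ → Matrix (Fin T) (Fin T) ℂ) (b : ℝ → Fin T → ℂ) (t : ℝ) :
    EuclideanSpace ℂ (Fin T) := WithLp.toLp 2 (b t ᵥ* A t)

/-- The class of `bᵀ A` in `L²((-π, π]; ℂ^T)`; zero if `bᵀ A` is not square-integrable. For a
spectral root `A` of `f` this realizes `L₂(f)` isometrically. -/
noncomputable def embed (A : ℝ → Matrix (Fin T) (Fin T) ℂ) (b : ℝ → Fin T → ℂ) : FreqSpace T :=
  open Classical in if h : MemLp (twist A b) 2 freq then h.toLp _ else 0

/-- The function `g δ_ν`. -/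
def unitFn (g : ℝ → ℂ) (ν : Fin T) (t : ℝ) : Fin T → ℂ := g t • Pi.single ν 1

theorem coeFn_embed {A : ℝ → Matrix (Fin T) (Fin T) ℂ} {b : ℝ → Fin T → ℂ}
    (h : MemLp (twist A b) 2 freq) : embed A b =ᵐ[freq] twist A b := by
  rw [embed, dif_pos h]; exact h.coeFn_toLp

theorem embed_congr {A A' : ℝ → Matrix (Fin T) (Fin T) ℂ} {b b' : ℝ → Fin T → ℂ}
    (h : MemLp (twist A b) 2 freq) (hb : twist A b =ᵐ[freq] twist A' b') :
    embed A b = embed A' b' := by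
  refine Lp.ext ((coeFn_embed h).trans (hb.trans (coeFn_embed ((memLp_congr_ae hb).1 h)).symm))

theorem twist_add (A : ℝ → Matrix (Fin T) (Fin T) ℂ) (b b' : ℝ → Fin T → ℂ) :
    twist A (b + b') = twist A b + twist A b' := by
  funext t; simp [twist, Matrix.add_vecMul]

theorem twist_sub (A : ℝ → Matrix (Fin T) (Fin T) ℂ) (b b' : ℝ → Fin T → ℂ) :
    twist A (b - b') = twist A b - twist A b' := by
  funext t; simp [twist, Matrix.sub_vecMul]

theorem twist_smul (A : ℝ → Matrix (Fin T) (Fin T) ℂ) (c : ℂ) (b : ℝ → Fin T → ℂ) :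
    twist A (c • b) = c • twist A b := by
  funext t; simp [twist, Matrix.smul_vecMul]

theorem embed_add {A : ℝ → Matrix (Fin T) (Fin T) ℂ} {b b' : ℝ → Fin T → ℂ}
    (h : MemLp (twist A b) 2 freq) (h' : MemLp (twist A b') 2 freq) :
    embed A (b + b') = embed A b + embed A b' := by
  have hs : MemLp (twist A (b + b')) 2 freq := by rw [twist_add]; exact h.add h'
  refine Lp.ext ((coeFn_embed hs).trans ?_)
  rw [twist_add]
  exact ((coeFn_embed h).add (coeFn_embed h')).symm.trans (Lp.coeFn_add _ _).symm

theorem embed_sub {A : ℝ → Matrix (Fin T) (Fin T) ℂ} {b b' : ℝ → Fin T → ℂ}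
    (h : MemLp (twist A b) 2 freq) (h' : MemLp (twist A b') 2 freq) :
    embed A (b - b') = embed A b - embed A b' := by
  have hs : MemLp (twist A (b - b')) 2 freq := by rw [twist_sub]; exact h.sub h'
  refine Lp.ext ((coeFn_embed hs).trans ?_)
  rw [twist_sub]
  exact ((coeFn_embed h).sub (coeFn_embed h')).symm.trans (Lp.coeFn_sub _ _).symm

theorem embed_smul {A : ℝ → Matrix (Fin T) (Fin T) ℂ} {b : ℝ → Fin T → ℂ} (c : ℂ)
    (h : MemLp (twist A b) 2 freq) : embed A (c • b) = c • embed A b := by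
  have hs : MemLp (twist A (c • b)) 2 freq := by rw [twist_smul]; exact h.const_smul c
  refine Lp.ext ((coeFn_embed hs).trans ?_)
  rw [twist_smul]
  exact ((coeFn_embed h).const_smul c).symm.trans (Lp.coeFn_smul _ _).symm

theorem embed_sum {ι : Type*} {A : ℝ → Matrix (Fin T) (Fin T) ℂ} (s : Finset ι)
    {b : ι → ℝ → Fin T → ℂ} (h : ∀ i ∈ s, MemLp (twist A (b i)) 2 freq) :
    MemLp (twist A (∑ i ∈ s, b i)) 2 freq ∧
      embed A (∑ i ∈ s, b i) = ∑ i ∈ s, embed A (b i) := by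
  classical
  induction s using Finset.induction_on with
  | empty =>
    have h0 : twist A (∑ i ∈ (∅ : Finset ι), b i) = 0 := by funext t; simp [twist]
    have hm : MemLp (twist A (∑ i ∈ (∅ : Finset ι), b i)) 2 freq := by
      rw [h0]; exact MemLp.zero
    refine ⟨hm, Lp.ext ((coeFn_embed hm).trans ?_)⟩
    rw [h0, Finset.sum_empty]
    exact (Lp.coeFn_zero _ _ _).symm
  | insert i s hi ih =>
    obtain ⟨h1, h2⟩ := ih fun j hj => h j (Finset.mem_insert_of_mem hj)
    have h3 := h i (Finset.mem_insert_self i s)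
    rw [Finset.sum_insert hi, Finset.sum_insert hi, embed_add h3 h1, h2]
    refine ⟨?_, rfl⟩
    rw [twist_add]
    exact h3.add h1

theorem memLp_twist_of_bounded {A : ℝ → Matrix (Fin T) (Fin T) ℂ}
    (hA : ∀ i j, MemLp (fun t => A t i j) 2 freq) {b : ℝ → Fin T → ℂ}
    (hb : ∀ ν, AEStronglyMeasurable (fun t => b t ν) freq) {M : ℝ} (hM : ∀ t ν, ‖b t ν‖ ≤ M) :
    MemLp (twist A b) 2 freq := by
  rw [memLp_piLp_iff]
  intro μ
  have : (fun t => (twist A b t).ofLp μ) = fun t => ∑ ν, b t ν * A t ν μ := by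
    funext t; simp [twist, Matrix.vecMul, dotProduct]
  rw [this]
  refine memLp_finsetSum _ fun ν _ => ?_
  refine (hA ν μ).of_le_mul (c := M) ((hb ν).mul (hA ν μ).1) (Eventually.of_forall fun t => ?_)
  rw [norm_mul]
  exact mul_le_mul_of_nonneg_right (hM t ν) (norm_nonneg _)

theorem unitFn_apply (g : ℝ → ℂ) (ν μ : Fin T) (t : ℝ) :
    unitFn g ν t μ = if μ = ν then g t else 0 := by
  simp [unitFn, Pi.single_apply]

theorem memLp_twist_unitFn {A : ℝ → Matrix (Fin T) (Fin T) ℂ}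
    (hA : ∀ i j, MemLp (fun t => A t i j) 2 freq) {g : ℝ → ℂ} (hg : AEStronglyMeasurable g freq)
    {M : ℝ} (hM : ∀ t, ‖g t‖ ≤ M) (ν : Fin T) : MemLp (twist A (unitFn g ν)) 2 freq := by
  refine memLp_twist_of_bounded hA (M := M) (fun μ => ?_) fun t μ => ?_
  · simp only [unitFn_apply]
    split_ifs
    · exact hg
    · exact aestronglyMeasurable_const
  · rw [unitFn_apply]
    split_ifs
    · exact hM t
    · rw [norm_zero]; exact (norm_nonneg _).trans (hM t)

/-- Products of square-integrable vector functions with `A` have integrable components. -/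
theorem integrable_vecMul {A : ℝ → Matrix (Fin T) (Fin T) ℂ}
    (hA : ∀ i j, MemLp (fun t => A t i j) 2 freq) (Q : FreqSpace T) (ν : Fin T) :
    Integrable (fun t => ((Q t).ofLp ᵥ* A t) ν) freq := by
  have hQ : ∀ μ, MemLp (fun t => (Q t).ofLp μ) 2 freq := by
    have := Lp.memLp Q
    rw [memLp_piLp_iff] at this
    exact this
  simp only [Matrix.vecMul, dotProduct]
  exact integrable_finsetSum _ fun μ _ => (hQ μ).integrable_mul (hA μ ν)

theorem inner_embed_unitFn {A : ℝ → Matrix (Fin T) (Fin T) ℂ}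
    (hA : ∀ i j, MemLp (fun t => A t i j) 2 freq) (hH : ∀ᵐ t ∂freq, (A t).IsHermitian)
    {g : ℝ → ℂ} (hg : AEStronglyMeasurable g freq) {M : ℝ} (hM : ∀ t, ‖g t‖ ≤ M) (ν : Fin T)
    (Q : FreqSpace T) : inner ℂ (embed A (unitFn g ν)) Q =
      ∫ t, (starRingEnd ℂ) (g t) * ((Q t).ofLp ᵥ* A t) ν ∂freq := by
  rw [L2.inner_def]
  refine integral_congr_ae ?_
  filter_upwards [coeFn_embed (memLp_twist_unitFn hA hg hM ν), hH] with t h1 h2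
  rw [h1, EuclideanSpace.inner_eq_star_dotProduct]
  simp only [twist, unitFn, Matrix.smul_vecMul, Matrix.single_one_vecMul, dotProduct, Matrix.vecMul,
    Finset.mul_sum]
  refine Finset.sum_congr rfl fun μ _ => ?_
  simp only [Pi.star_apply, Pi.smul_apply, smul_eq_mul, star_mul', Matrix.row]
  rw [h2.apply μ ν, starRingEnd_apply]
  ring

/-- The vector `e^{int} δ_νᵀ A`. -/
noncomputable def expoVec (A : ℝ → Matrix (Fin T) (Fin T) ℂ) (x : ℤ × Fin T) : FreqSpace T :=
  embed A (unitFn (expo x.1) x.2)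

theorem inner_expoVec {A : ℝ → Matrix (Fin T) (Fin T) ℂ}
    (hA : ∀ i j, MemLp (fun t => A t i j) 2 freq) (hH : ∀ᵐ t ∂freq, (A t).IsHermitian)
    (x : ℤ × Fin T) (Q : FreqSpace T) : inner ℂ (expoVec A x) Q =
      (2 * Real.pi : ℂ) * fcoef (fun t => ((Q t).ofLp ᵥ* A t) x.2) x.1 := by
  rw [expoVec, inner_embed_unitFn hA hH (continuous_expo _).aestronglyMeasurable (M := 1)
    (by simp), fcoef, mul_inv_cancel_left₀ two_pi_ne_zero']
  simp only [conj_expo, mul_comm]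

/-- Inner products in the model space. The two matrix functions may differ: the cases `(R, R)`,
`(R, S)` and `(S, S)` give the correlations, the biorthogonality and the matrix of `B`. -/
theorem inner_embed_unitFn_unitFn {A A' : ℝ → Matrix (Fin T) (Fin T) ℂ}
    (hA : ∀ i j, MemLp (fun t => A t i j) 2 freq) (hH : ∀ᵐ t ∂freq, (A t).IsHermitian)
    (hA' : ∀ i j, MemLp (fun t => A' t i j) 2 freq)
    {g g' : ℝ → ℂ} (hg : AEStronglyMeasurable g freq) {M : ℝ} (hM : ∀ t, ‖g t‖ ≤ M)
    (hg' : AEStronglyMeasurable g' freq) {M' : ℝ} (hM' : ∀ t, ‖g' t‖ ≤ M') (ν μ : Fin T) :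
    inner ℂ (embed A (unitFn g ν)) (embed A' (unitFn g' μ)) =
      ∫ t, (starRingEnd ℂ) (g t) * g' t * (A' t * A t) μ ν ∂freq := by
  rw [inner_embed_unitFn hA hH hg hM]
  refine integral_congr_ae ?_
  filter_upwards [coeFn_embed (memLp_twist_unitFn hA' hg' hM' μ)] with t h1
  rw [h1]
  simp only [twist, unitFn, Matrix.smul_vecMul, Matrix.single_one_vecMul, Pi.smul_apply,
    smul_eq_mul, mul_assoc]
  rfl

namespace IsSpectralRoot

variable {f R S : ℝ → Matrix (Fin T) (Fin T) ℂ}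

theorem herm_root (h : IsSpectralRoot f R S) : ∀ᵐ t ∂freq, (R t).IsHermitian :=
  h.ae_spec.mono fun _ ht => ht.1

theorem herm_inv (h : IsSpectralRoot f R S) : ∀ᵐ t ∂freq, (S t).IsHermitian :=
  h.ae_spec.mono fun _ ht => ht.2.1

/-- The integrand of the norm of `L₂(f)` is `2π |bᵀ R|²`. -/
theorem quad_eq (h : IsSpectralRoot f R S) (b : ℝ → Fin T → ℂ) :
    ∀ᵐ t ∂freq, quad f b t = ((2 * Real.pi * ‖twist R b t‖ ^ 2 : ℝ) : ℂ) := by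
  filter_upwards [h.ae_spec] with t ⟨h1, _, _, _, h5, _⟩
  have h2 : ((‖twist R b t‖ ^ 2 : ℝ) : ℂ) = (b t ᵥ* R t) ⬝ᵥ star (b t ᵥ* R t) := by
    rw [← EuclideanSpace.inner_toLp_toLp, inner_self_eq_norm_sq_to_K]
    push_cast; rfl
  rw [Complex.ofReal_mul, h2, Matrix.star_vecMul, h1.eq, quad, h5, Matrix.smul_mulVec,
    dotProduct_smul, ← Matrix.mulVec_mulVec, Matrix.dotProduct_mulVec, smul_eq_mul]
  push_cast; rfl

/-- `b` is recovered from `bᵀ R` by multiplication with the inverse root. -/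
theorem twist_vecMul_inv (h : IsSpectralRoot f R S) (b : ℝ → Fin T → ℂ) :
    ∀ᵐ t ∂freq, (twist R b t).ofLp ᵥ* S t = b t := by
  filter_upwards [h.ae_spec] with t ⟨_, _, h3, _⟩
  simp only [twist]
  rw [Matrix.vecMul_vecMul, h3, Matrix.vecMul_one]

theorem aestronglyMeasurable_twist (h : IsSpectralRoot f R S) {b : ℝ → Fin T → ℂ}
    (hb : AEStronglyMeasurable b freq) : AEStronglyMeasurable (twist R b) freq := by
  have h1 : AEMeasurable (fun t => b t ᵥ* R t) freq := by
    refine aemeasurable_pi_iff.2 fun μ => ?_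
    simp only [Matrix.vecMul, dotProduct]
    refine Finset.aemeasurable_fun_sum _ fun ν _ => ?_
    exact (aemeasurable_pi_iff.1 hb.aemeasurable ν).mul
      (h.memLp_root ν μ).aestronglyMeasurable.aemeasurable
  exact (PiLp.continuous_toLp 2 _).comp_aestronglyMeasurable h1.aestronglyMeasurable

theorem aestronglyMeasurable_of_twist (h : IsSpectralRoot f R S) {b : ℝ → Fin T → ℂ}
    (hb : AEStronglyMeasurable (twist R b) freq) : AEStronglyMeasurable b freq := by
  have h0 : AEMeasurable (fun t => (twist R b t).ofLp) freq :=
    ((PiLp.continuous_ofLp 2 _).comp_aestronglyMeasurable hb).aemeasurable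
  have h1 : AEMeasurable (fun t => (twist R b t).ofLp ᵥ* S t) freq := by
    refine aemeasurable_pi_iff.2 fun μ => ?_
    simp only [Matrix.vecMul, dotProduct]
    refine Finset.aemeasurable_fun_sum _ fun ν _ => ?_
    exact (aemeasurable_pi_iff.1 h0 ν).mul (h.memLp_inv ν μ).aestronglyMeasurable.aemeasurable
  exact (h1.congr (h.twist_vecMul_inv b)).aestronglyMeasurable

theorem memL2_iff (h : IsSpectralRoot f R S) {b : ℝ → Fin T → ℂ} :
    MemL2 f b ↔ MemLp (twist R b) 2 freq := by
  have hpi := Real.two_pi_pos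
  constructor
  · rintro ⟨hb, hq⟩
    rw [memLp_two_iff_integrable_sq_norm (h.aestronglyMeasurable_twist hb)]
    refine (hq.re.const_mul (2 * Real.pi)⁻¹).congr ?_
    filter_upwards [h.quad_eq b] with t ht
    rw [ht, RCLike.re_to_complex, Complex.ofReal_re, inv_mul_cancel_left₀ hpi.ne']
  · intro hb
    refine ⟨h.aestronglyMeasurable_of_twist hb.1, ?_⟩
    have h1 := (memLp_two_iff_integrable_sq_norm hb.1).1 hb
    have h2 : Integrable (fun t => ((2 * Real.pi * ‖twist R b t‖ ^ 2 : ℝ) : ℂ)) freq :=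
      (h1.const_mul _).ofReal
    exact h2.congr ((h.quad_eq b).mono fun t ht => ht.symm)

theorem normSq_eq (h : IsSpectralRoot f R S) {b : ℝ → Fin T → ℂ}
    (hb : MemLp (twist R b) 2 freq) : normSq f b = ‖embed R b‖ ^ 2 := by
  have h1 : ((‖embed R b‖ ^ 2 : ℝ) : ℂ) = ((∫ t, ‖twist R b t‖ ^ 2 ∂freq : ℝ) : ℂ) := by
    have h2 := inner_self_eq_norm_sq_to_K (𝕜 := ℂ) (embed R b)
    rw [L2.inner_def] at h2
    rw [Complex.ofReal_pow]
    refine h2.symm.trans ?_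
    rw [← integral_complex_ofReal]
    refine integral_congr_ae ?_
    filter_upwards [coeFn_embed hb] with t ht
    rw [ht, inner_self_eq_norm_sq_to_K]
    push_cast; rfl
  rw [Complex.ofReal_injective h1, normSq]
  have h3 : ∫ t, (quad f b t).re ∂freq = ∫ t, 2 * Real.pi * ‖twist R b t‖ ^ 2 ∂freq := by
    refine integral_congr_ae ?_
    filter_upwards [h.quad_eq b] with t ht
    rw [ht, Complex.ofReal_re]
  rw [h3, integral_const_mul, inv_mul_cancel_left₀ Real.two_pi_pos.ne']

/-- Every element of the model space comes from a function in `L₂(f)`. -/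
theorem embed_vecMul_inv (h : IsSpectralRoot f R S) (Q : FreqSpace T) :
    MemLp (twist R fun t => (Q t).ofLp ᵥ* S t) 2 freq ∧
      embed R (fun t => (Q t).ofLp ᵥ* S t) = Q := by
  have h1 : twist R (fun t => (Q t).ofLp ᵥ* S t) =ᵐ[freq] Q := by
    filter_upwards [h.ae_spec] with t ⟨_, _, _, h4, _⟩
    simp only [twist]
    rw [Matrix.vecMul_vecMul, h4, Matrix.vecMul_one]
  have h2 := (memLp_congr_ae h1).2 (Lp.memLp Q)
  exact ⟨h2, Lp.ext ((coeFn_embed h2).trans h1)⟩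

theorem ae_eq_of_embed_eq (h : IsSpectralRoot f R S) {b b' : ℝ → Fin T → ℂ}
    (hb : MemLp (twist R b) 2 freq) (hb' : MemLp (twist R b') 2 freq)
    (he : embed R b = embed R b') : b =ᵐ[freq] b' := by
  have h1 := coeFn_embed hb
  rw [he] at h1
  filter_upwards [h1, coeFn_embed hb', h.twist_vecMul_inv b, h.twist_vecMul_inv b'] with
    t h2 h3 h4 h5
  rw [← h4, ← h5, ← h2, ← h3]

/-- An element of the model space vanishes if all components of `Qᵀ R` do. -/
theorem eq_zero_of_vecMul_root (h : IsSpectralRoot f R S) {Q : FreqSpace T}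
    (hQ : ∀ ν, (fun t => ((Q t).ofLp ᵥ* R t) ν) =ᵐ[freq] 0) : Q = 0 := by
  refine Lp.ext (EventuallyEq.trans ?_ (Lp.coeFn_zero _ _ _).symm)
  filter_upwards [h.ae_spec, eventually_all.2 hQ] with t ⟨_, _, h3, _⟩ h5
  have h6 : (Q t).ofLp ᵥ* R t = 0 := funext h5
  have h7 : (Q t).ofLp = 0 := by
    rw [← Matrix.vecMul_one (Q t).ofLp, ← h3, ← Matrix.vecMul_vecMul, h6, Matrix.zero_vecMul]
  rw [Pi.zero_apply]
  exact (WithLp.ofLp_eq_zero 2).1 h7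

theorem memLp_twist_unitFn_expo (h : IsSpectralRoot f R S) (n : ℤ) (ν : Fin T) :
    MemLp (twist R (unitFn (expo n) ν)) 2 freq :=
  memLp_twist_unitFn h.memLp_root (continuous_expo n).aestronglyMeasurable (M := 1) (by simp) ν

/-- The vectors `e^{int} δ_νᵀ R` span a dense subspace. -/
theorem span_expoVec_dense (h : IsSpectralRoot f R S) :
    (Submodule.span ℂ (Set.range (expoVec R))).topologicalClosure = ⊤ := by
  rw [Submodule.topologicalClosure_eq_top_iff, Submodule.eq_bot_iff]
  intro Q hQ
  refine h.eq_zero_of_vecMul_root fun ν => ?_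
  refine ae_eq_zero_of_fcoef_eq_zero (integrable_vecMul h.memLp_root Q ν) fun n => ?_
  have h1 := Submodule.inner_right_of_mem_orthogonal
    (Submodule.subset_span (Set.mem_range_self (n, ν))) hQ
  rw [inner_expoVec h.memLp_root h.herm_root] at h1
  exact (mul_eq_zero.1 h1).resolve_left two_pi_ne_zero'

/-- Indicator functions of measurable sets span a dense subspace of `L₂(f)`. -/
theorem span_indicator_dense (h : IsSpectralRoot f R S) :
    (Submodule.span ℂ (Set.range fun x : Fin T × {D : Set ℝ // MeasurableSet D} =>
      embed R (unitFn (x.2.1.indicator 1) x.1))).topologicalClosure = ⊤ := by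
  rw [Submodule.topologicalClosure_eq_top_iff, Submodule.eq_bot_iff]
  intro Q hQ
  refine h.eq_zero_of_vecMul_root fun ν => ?_
  refine (integrable_vecMul h.memLp_root Q ν).ae_eq_zero_of_forall_setIntegral_eq_zero
    fun D hD _ => ?_
  have h1 := Submodule.inner_right_of_mem_orthogonal
    (Submodule.subset_span (Set.mem_range_self (ν, ⟨D, hD⟩))) hQ
  have hg : AEStronglyMeasurable (D.indicator (1 : ℝ → ℂ)) freq :=
    (stronglyMeasurable_one.indicator hD).aestronglyMeasurable
  rw [inner_embed_unitFn h.memLp_root h.herm_root hg (M := 1) (fun t => by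
      by_cases ht : t ∈ D <;> simp [ht])] at h1
  rw [← h1, ← integral_indicator hD]
  refine integral_congr_ae (Eventually.of_forall fun t => ?_)
  by_cases ht : t ∈ D <;> simp [ht]

/-- Biorthogonality of the families with `R` and with its inverse `S`. -/
theorem inner_expoVec_expoVec_inv (h : IsSpectralRoot f R S) (x y : ℤ × Fin T) :
    inner ℂ (expoVec R x) ((2 * Real.pi : ℂ)⁻¹ • expoVec S y) = if x = y then 1 else 0 := by
  rw [inner_smul_right, expoVec, expoVec, inner_embed_unitFn_unitFn h.memLp_root h.herm_root
    h.memLp_inv (continuous_expo _).aestronglyMeasurable (M := 1) (by simp)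
    (continuous_expo _).aestronglyMeasurable (M' := 1) (by simp)]
  have h1 : ∫ t, (starRingEnd ℂ) (expo x.1 t) * expo y.1 t * (S t * R t) y.2 x.2 ∂freq =
      ∫ t, expo (y.1 - x.1) t * (1 : Matrix (Fin T) (Fin T) ℂ) y.2 x.2 ∂freq := by
    refine integral_congr_ae ?_
    filter_upwards [h.ae_spec] with t ⟨_, _, _, h4, _⟩
    rw [h4, expo_sub, mul_comm (expo _ _)]
  rw [h1, integral_mul_const, integral_expo, Matrix.one_apply]
  by_cases h2 : x = y
  · subst h2
    rw [if_pos (sub_self _), if_pos rfl, if_pos rfl, mul_one, inv_mul_cancel₀ two_pi_ne_zero']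
  · rw [if_neg h2]
    by_cases h3 : x.2 = y.2
    · have h4 : y.1 - x.1 ≠ 0 := fun h5 => h2 (Prod.ext (sub_eq_zero.1 h5).symm h3)
      rw [if_neg h4]; simp
    · rw [if_neg fun h5 : y.2 = x.2 => h3 h5.symm]; simp

/-- The key duality: a vector `u` orthogonal to the dual vectors with indices outside `J` is a limit
of combinations of the vectors with indices in `J`, if `J` differs from the negative integers by a
finite set only. Indeed, let `G` be orthogonal to the latter. Up to a trigonometric polynomial,
`Gᵀ R` has no negative frequencies, while the conjugate of `uᵀ S` annihilates `e^{int}`, `n ≥ 0`;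
and `⟨u, G⟩` is the integral of their product. -/
theorem mem_closure_of_inner_eq_zero (h : IsSpectralRoot f R S) {J E : Set ℤ}
    (hE : E.Finite) (hJE : ∀ n, n ∈ J ↔ n < 0 ∧ n ∉ E) {u : FreqSpace T}
    (hu : ∀ n ∉ J, ∀ ν, inner ℂ (expoVec S (n, ν)) u = 0) :
    u ∈ (Submodule.span ℂ {X | ∃ ν, ∃ n ∈ J, X = expoVec R (n, ν)}).topologicalClosure := by
  rw [← Submodule.orthogonal_orthogonal_eq_closure, Submodule.mem_orthogonal']
  intro G hG
  let F : Fin T → ℝ → ℂ := fun ν t => ((u t).ofLp ᵥ* S t) ν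
  let D : Fin T → ℝ → ℂ := fun ν t => ((G t).ofLp ᵥ* R t) ν
  have hFi : ∀ ν, Integrable (F ν) freq := integrable_vecMul h.memLp_inv u
  have hDi : ∀ ν, Integrable (D ν) freq := integrable_vecMul h.memLp_root G
  have hF : ∀ ν, ∀ n ∉ J, fcoef (F ν) n = 0 := fun ν n hn => by
    have h1 := hu n hn ν
    rw [inner_expoVec h.memLp_inv h.herm_inv] at h1
    exact (mul_eq_zero.1 h1).resolve_left two_pi_ne_zero'
  have hD : ∀ ν, ∀ n ∈ J, fcoef (D ν) n = 0 := fun ν n hn => by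
    have hmem : expoVec R (n, ν) ∈ {X | ∃ ν, ∃ n ∈ J, X = expoVec R (n, ν)} := ⟨ν, n, hn, rfl⟩
    have h1 := Submodule.inner_right_of_mem_orthogonal (Submodule.subset_span hmem) hG
    rw [inner_expoVec h.memLp_root h.herm_root] at h1
    exact (mul_eq_zero.1 h1).resolve_left two_pi_ne_zero'
  have hinner : (fun t => inner ℂ (u t) (G t)) =ᵐ[freq]
      fun t => ∑ ν, D ν t * (starRingEnd ℂ) (F ν t) := by
    filter_upwards [h.ae_spec] with t ⟨_, h2, h3, _⟩
    have h4 : ∑ ν, D ν t * (starRingEnd ℂ) (F ν t) =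
        ((G t).ofLp ᵥ* R t) ⬝ᵥ star ((u t).ofLp ᵥ* S t) := rfl
    rw [h4, Matrix.star_vecMul, h2.eq, Matrix.dotProduct_mulVec, Matrix.vecMul_vecMul, h3,
      Matrix.vecMul_one, EuclideanSpace.inner_eq_star_dotProduct]
  have hconjF : ∀ ν n, n ∉ J → ∫ t, expo n t * (starRingEnd ℂ) (F ν t) ∂freq = 0 := by
    intro ν n hn
    have h1 := hF ν n hn
    rw [fcoef, mul_eq_zero, or_iff_right (inv_ne_zero two_pi_ne_zero')] at h1
    rw [← map_zero (starRingEnd ℂ), ← h1, ← integral_conj]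
    simp only [map_mul, conj_expo, neg_neg, mul_comm]
  have hFci : ∀ ν, Integrable (fun t => (starRingEnd ℂ) (F ν t)) freq := fun ν => by
    have h1 : Continuous (starRingEnd ℂ) := Complex.continuous_conj
    refine (hFi ν).norm.mono' (h1.comp_aestronglyMeasurable (hFi ν).1) (by simp)
  -- the part of `D` with frequencies in `E` is a trigonometric polynomial
  let p : Fin T → ℝ → ℂ := fun ν t => ∑ n ∈ hE.toFinset.filter (· < 0), fcoef (D ν) n * expo n t
  have hpc : ∀ ν, Continuous (p ν) := fun ν => by fun_prop
  have hpF1 : ∀ ν n, Integrable (fun t => fcoef (D ν) n * expo n t * (starRingEnd ℂ) (F ν t))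
      freq := fun ν n => by
    simp only [mul_assoc, mul_comm (expo _ _)]
    exact (integrable_mul_expo (hFci ν) n).const_mul _
  have hpF : Integrable (fun t => ∑ ν, p ν t * (starRingEnd ℂ) (F ν t)) freq := by
    simp only [p, Finset.sum_mul]
    exact integrable_finsetSum _ fun ν _ => integrable_finsetSum _ fun n _ => hpF1 ν n
  have hpF0 : ∫ t, ∑ ν, p ν t * (starRingEnd ℂ) (F ν t) ∂freq = 0 := by
    simp only [p, Finset.sum_mul]
    rw [integral_finsetSum _ fun ν _ => integrable_finsetSum _ fun n _ => hpF1 ν n]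
    refine Finset.sum_eq_zero fun ν _ => ?_
    rw [integral_finsetSum _ fun n _ => hpF1 ν n]
    refine Finset.sum_eq_zero fun n hn => ?_
    simp only [mul_assoc]
    rw [integral_const_mul, hconjF ν n, mul_zero]
    rw [hJE]
    simp only [Finset.mem_filter, Set.Finite.mem_toFinset] at hn
    exact fun h1 => h1.2 hn.1
  have hDF : Integrable (fun t => ∑ ν, D ν t * (starRingEnd ℂ) (F ν t)) freq :=
    (L2.integrable_inner u G).congr hinner
  have hsub : ∀ t, ∑ ν, (D ν - p ν) t * (starRingEnd ℂ) (F ν t) =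
      ∑ ν, D ν t * (starRingEnd ℂ) (F ν t) - ∑ ν, p ν t * (starRingEnd ℂ) (F ν t) := fun t => by
    simp only [Pi.sub_apply, sub_mul, Finset.sum_sub_distrib]
  have hmain := integral_sum_mul_eq_zero (D := fun ν => D ν - p ν)
    (F := fun ν t => (starRingEnd ℂ) (F ν t))
    (fun ν => (hDi ν).sub (integrable_of_continuous (hpc ν))) (fun ν n hn => ?_)
    (fun ν => ⟨hFci ν, fun n => ?_⟩) ?_
  · simp only [hsub] at hmain
    rw [integral_sub hDF hpF, hpF0, sub_zero] at hmain
    rw [L2.inner_def, integral_congr_ae hinner, hmain]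
  · rw [fcoef_sub (hDi ν) (integrable_of_continuous (hpc ν)), fcoef_finset_sum]
    by_cases hnE : n ∈ E
    · rw [Finset.sum_ite_eq', if_pos (by simp [hnE, hn]), sub_self]
    · rw [Finset.sum_ite_eq', if_neg (by simp [hnE]), hD ν n ((hJE n).2 ⟨hn, hnE⟩), sub_zero]
  · have h1 := hconjF ν n (by rw [hJE]; omega)
    simpa only [mul_comm] using h1
  · simp only [hsub]
    exact hDF.sub hpF

end IsSpectralRoot

end Model

/-! ### The spectral isometry and random spectral measures -/

section Isometry

/-- A family with dense span and a second family with the same Gram matrix are related by an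
isometry. -/
theorem exists_linearIsometry_of_gram {ι E H : Type*} [NormedAddCommGroup E]
    [InnerProductSpace ℂ E] [NormedAddCommGroup H] [InnerProductSpace ℂ H] [CompleteSpace H]
    {e : ι → E} {ξ : ι → H} (hd : (Submodule.span ℂ (Set.range e)).topologicalClosure = ⊤)
    (hg : ∀ i j, inner ℂ (ξ i) (ξ j) = inner ℂ (e i) (e j)) :
    ∃ U : E →ₗᵢ[ℂ] H, ∀ i, U (e i) = ξ i := by
  have hnorm : ∀ q : ι →₀ ℂ, ‖Finsupp.linearCombination ℂ ξ q‖ =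
      ‖Finsupp.linearCombination ℂ e q‖ := by
    intro q
    have : inner ℂ (Finsupp.linearCombination ℂ ξ q) (Finsupp.linearCombination ℂ ξ q) =
        inner ℂ (Finsupp.linearCombination ℂ e q) (Finsupp.linearCombination ℂ e q) := by
      simp only [Finsupp.linearCombination_apply, Finsupp.sum, sum_inner, inner_sum,
        inner_smul_left, inner_smul_right, hg]
    rw [inner_self_eq_norm_sq_to_K, inner_self_eq_norm_sq_to_K] at this
    have h2 : ‖Finsupp.linearCombination ℂ ξ q‖ ^ 2 = ‖Finsupp.linearCombination ℂ e q‖ ^ 2 := by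
      exact_mod_cast this
    exact (pow_left_inj₀ (norm_nonneg _) (norm_nonneg _) two_ne_zero).1 h2
  have hdense : DenseRange (Finsupp.linearCombination ℂ e) := by
    have h1 : (LinearMap.range (Finsupp.linearCombination ℂ e) : Set E) =
        Set.range (Finsupp.linearCombination ℂ e) := rfl
    rw [DenseRange, ← h1, Finsupp.range_linearCombination,
      Submodule.dense_iff_topologicalClosure_eq_top]
    exact hd
  let V := (Finsupp.linearCombination ℂ ξ).extendOfNorm (Finsupp.linearCombination ℂ e)
  have hV : ∀ q, V (Finsupp.linearCombination ℂ e q) = Finsupp.linearCombination ℂ ξ q :=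
    LinearMap.extendOfNorm_eq hdense ⟨1, fun q => by rw [one_mul, hnorm]⟩
  refine ⟨⟨V.toLinearMap, fun x => ?_⟩, fun i => ?_⟩
  · refine hdense.induction (P := fun x => ‖V x‖ = ‖x‖) ?_
      (isClosed_eq (by fun_prop) continuous_norm) x
    rintro _ ⟨q, rfl⟩
    rw [hV, hnorm]
  · have := hV (Finsupp.single i 1)
    simpa using this

theorem linearIsometry_eq_of_dense {ι E H : Type*} [NormedAddCommGroup E]
    [InnerProductSpace ℂ E] [NormedAddCommGroup H] [InnerProductSpace ℂ H]
    {e : ι → E} (hd : (Submodule.span ℂ (Set.range e)).topologicalClosure = ⊤)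
    {U V : E →ₗᵢ[ℂ] H} (h : ∀ i, U (e i) = V (e i)) : U = V := by
  have h1 : U.toContinuousLinearMap = V.toContinuousLinearMap :=
    ContinuousLinearMap.ext_on (s := Set.range e)
      ((Submodule.dense_iff_topologicalClosure_eq_top).2 hd) (by rintro _ ⟨i, rfl⟩; exact h i)
  ext x
  exact congrArg (fun L : E →L[ℂ] H => L x) h1

variable {T : ℕ} {Ω : Type*} [MeasurableSpace Ω] {P : Measure Ω}

theorem cov_eq_inner (X Y : Lp ℂ 2 P) : cov P X Y = inner ℂ Y X := by
  rw [L2.inner_def]; rfl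

variable {f R S : ℝ → Matrix (Fin T) (Fin T) ℂ}

/-- The vector `1_D δ_νᵀ R`. -/
noncomputable def indVec (R : ℝ → Matrix (Fin T) (Fin T) ℂ) (ν : Fin T) (D : Set ℝ) :
    FreqSpace T := embed R (unitFn (D.indicator 1) ν)

theorem aestronglyMeasurable_indicator_one {D : Set ℝ} (hD : MeasurableSet D) :
    AEStronglyMeasurable (D.indicator (1 : ℝ → ℂ)) freq :=
  (stronglyMeasurable_one.indicator hD).aestronglyMeasurable

theorem norm_indicator_one_le (D : Set ℝ) (t : ℝ) : ‖D.indicator (1 : ℝ → ℂ) t‖ ≤ 1 := by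
  by_cases ht : t ∈ D <;> simp [ht]

namespace IsSpectralRoot

theorem memLp_twist_indicator (h : IsSpectralRoot f R S) (ν : Fin T) {D : Set ℝ}
    (hD : MeasurableSet D) : MemLp (twist R (unitFn (D.indicator 1) ν)) 2 freq :=
  memLp_twist_unitFn h.memLp_root (aestronglyMeasurable_indicator_one hD)
    (norm_indicator_one_le D) ν

theorem inner_expoVec_expoVec (h : IsSpectralRoot f R S) (x y : ℤ × Fin T) :
    inner ℂ (expoVec R x) (expoVec R y) =
      (2 * Real.pi : ℂ)⁻¹ * ∫ t, expo (y.1 - x.1) t * f t y.2 x.2 ∂freq := by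
  rw [expoVec, expoVec, inner_embed_unitFn_unitFn h.memLp_root h.herm_root
    h.memLp_root (continuous_expo _).aestronglyMeasurable (M := 1) (by simp)
    (continuous_expo _).aestronglyMeasurable (M' := 1) (by simp), ← integral_const_mul]
  refine integral_congr_ae ?_
  filter_upwards [h.ae_spec] with t ⟨_, _, _, _, h5, _⟩
  rw [h5, expo_sub, Matrix.smul_apply, smul_eq_mul, mul_left_comm,
    inv_mul_cancel_left₀ two_pi_ne_zero', mul_comm (expo _ _)]

theorem inner_indVec_indVec (h : IsSpectralRoot f R S) (ν μ : Fin T) {D D' : Set ℝ}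
    (hD : MeasurableSet D) (hD' : MeasurableSet D') :
    inner ℂ (indVec R ν D) (indVec R μ D') =
      (2 * Real.pi : ℂ)⁻¹ * ∫ t in D' ∩ D, f t μ ν ∂freq := by
  rw [indVec, indVec, inner_embed_unitFn_unitFn h.memLp_root h.herm_root
    h.memLp_root (aestronglyMeasurable_indicator_one hD) (norm_indicator_one_le D)
    (aestronglyMeasurable_indicator_one hD') (norm_indicator_one_le D'), ← integral_const_mul,
    ← integral_indicator (hD'.inter hD)]
  refine integral_congr_ae ?_
  filter_upwards [h.ae_spec] with t ⟨_, _, _, _, h5, _⟩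
  by_cases h1 : t ∈ D <;> by_cases h2 : t ∈ D' <;> simp only [Set.indicator, Set.mem_inter_iff,
    h1, h2, if_true, if_false, and_self, and_true, true_and, Pi.one_apply, map_one, map_zero,
    one_mul, zero_mul, mul_zero]
  rw [h5, Matrix.smul_apply, smul_eq_mul, inv_mul_cancel_left₀ two_pi_ne_zero']

/-- Vector valued simple functions in the model space. -/
theorem embed_simple (h : IsSpectralRoot f R S) (F : Finset (Set ℝ)) (w : Set ℝ → Fin T → ℂ)
    (hF : ∀ D ∈ F, MeasurableSet D) :
    MemLp (twist R fun t => ∑ D ∈ F, D.indicator (fun _ => w D) t) 2 freq ∧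
      embed R (fun t => ∑ D ∈ F, D.indicator (fun _ => w D) t) =
        ∑ D ∈ F, ∑ ν, w D ν • indVec R ν D := by
  have h1 : (fun t => ∑ D ∈ F, D.indicator (fun _ => w D) t) =
      ∑ D ∈ F, ∑ ν, w D ν • unitFn (D.indicator 1) ν := by
    funext t μ
    simp only [Finset.sum_apply, Pi.smul_apply, smul_eq_mul, unitFn_apply, mul_ite, mul_zero,
      Finset.sum_ite_eq, Finset.mem_univ, if_true]
    refine Finset.sum_congr rfl fun D _ => ?_
    by_cases ht : t ∈ D <;> simp [ht]
  have h2 : ∀ D ∈ F, ∀ ν ∈ Finset.univ,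
      MemLp (twist R (w D ν • unitFn (D.indicator 1) ν)) 2 freq := fun D hD ν _ => by
    rw [twist_smul]; exact (h.memLp_twist_indicator ν (hF D hD)).const_smul _
  have h3 : ∀ D ∈ F, _ := fun D hD => embed_sum Finset.univ (h2 D hD)
  have h4 := embed_sum F fun D hD => (h3 D hD).1
  rw [h1]
  refine ⟨h4.1, h4.2.trans (Finset.sum_congr rfl fun D hD => ?_)⟩
  rw [(h3 D hD).2]
  exact Finset.sum_congr rfl fun ν _ => embed_smul _ (h.memLp_twist_indicator ν (hF D hD))

/-- The span of the indicator vectors consists of simple functions. -/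
theorem exists_simple_of_mem_span {k : FreqSpace T}
    (hk : k ∈ Submodule.span ℂ (Set.range fun x : Fin T × {D : Set ℝ // MeasurableSet D} =>
      indVec R x.1 x.2.1)) :
    ∃ (F : Finset (Set ℝ)) (w : Set ℝ → Fin T → ℂ), (∀ D ∈ F, MeasurableSet D) ∧
      k = ∑ D ∈ F, ∑ ν, w D ν • indVec R ν D := by
  classical
  suffices h : ∃ (F : Finset (Set ℝ)) (w : Set ℝ → Fin T → ℂ), (∀ D ∈ F, MeasurableSet D) ∧
      (∀ D ∉ F, w D = 0) ∧ k = ∑ D ∈ F, ∑ ν, w D ν • indVec R ν D by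
    obtain ⟨F, w, h1, _, h2⟩ := h
    exact ⟨F, w, h1, h2⟩
  induction hk using Submodule.span_induction with
  | mem x hx =>
    obtain ⟨⟨ν, D, hD⟩, rfl⟩ := hx
    refine ⟨{D}, fun D' => if D' = D then Pi.single ν 1 else 0, by simpa using hD,
      fun D' hD' => if_neg (by simpa using hD'), ?_⟩
    simp [Pi.single_apply]
  | zero => exact ⟨∅, 0, by simp, by simp, by simp⟩
  | add x y _ _ hx hy =>
    obtain ⟨F, w, h1, h2, rfl⟩ := hx
    obtain ⟨F', w', h1', h2', rfl⟩ := hy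
    refine ⟨F ∪ F', w + w', fun D hD => (Finset.mem_union.1 hD).elim (h1 D) (h1' D),
      fun D hD => ?_, ?_⟩
    · rw [Finset.mem_union, not_or] at hD
      simp [h2 D hD.1, h2' D hD.2]
    · simp only [Pi.add_apply, add_smul, Finset.sum_add_distrib]
      congr 1
      · exact Finset.sum_subset Finset.subset_union_left fun D _ hD => by simp [h2 D hD]
      · exact Finset.sum_subset Finset.subset_union_right fun D _ hD => by simp [h2' D hD]
  | smul c x _ hx =>
    obtain ⟨F, w, h1, h2, rfl⟩ := hx
    refine ⟨F, c • w, h1, fun D hD => by simp [h2 D hD], ?_⟩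
    simp only [Finset.smul_sum, Pi.smul_apply, smul_eq_mul, mul_smul]

/-- If an isometry maps indicator functions to the values of `Z`, it is the stochastic integral
with respect to `Z`. -/
theorem hasStochIntegral_iff (h : IsSpectralRoot f R S) {Z : Fin T → Set ℝ → Lp ℂ 2 P}
    {U : FreqSpace T →ₗᵢ[ℂ] Lp ℂ 2 P}
    (hU : ∀ ν D, MeasurableSet D → U (indVec R ν D) = Z ν D) {b : ℝ → Fin T → ℂ}
    (hb : MemLp (twist R b) 2 freq) {Y : Lp ℂ 2 P} :
    HasStochIntegral Z f b Y ↔ Y = U (embed R b) := by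
  have hUsum : ∀ (F : Finset (Set ℝ)) (w : Set ℝ → Fin T → ℂ), (∀ D ∈ F, MeasurableSet D) →
      U (∑ D ∈ F, ∑ ν, w D ν • indVec R ν D) = ∑ D ∈ F, ∑ ν, w D ν • Z ν D := by
    intro F w hF
    rw [map_sum]
    refine Finset.sum_congr rfl fun D hD => ?_
    rw [map_sum]
    exact Finset.sum_congr rfl fun ν _ => by rw [map_smul, hU ν D (hF D hD)]
  have hns : ∀ (F : Finset (Set ℝ)) (w : Set ℝ → Fin T → ℂ), (∀ D ∈ F, MeasurableSet D) →
      normSq f (fun t => b t - ∑ D ∈ F, D.indicator (fun _ => w D) t) =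
        ‖embed R b - ∑ D ∈ F, ∑ ν, w D ν • indVec R ν D‖ ^ 2 := by
    intro F w hF
    obtain ⟨h1, h2⟩ := h.embed_simple F w hF
    have h3 : MemLp (twist R (b - fun t => ∑ D ∈ F, D.indicator (fun _ => w D) t)) 2 freq := by
      rw [twist_sub]; exact hb.sub h1
    rw [← h2, ← embed_sub hb h1, ← h.normSq_eq h3]
    rfl
  constructor
  · rintro ⟨_, hY⟩
    rw [← sub_eq_zero, ← norm_le_zero_iff]
    refine le_of_forall_pos_le_add fun κ hκ => ?_
    obtain ⟨F, w, hF, h1, h2⟩ := hY (min (κ / 2) ((κ / 2) ^ 2)) (by positivity)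
    rw [hns F w hF] at h1
    rw [← hUsum F w hF] at h2
    have h3 := lt_of_pow_lt_pow_left₀ 2 (by positivity) (h1.trans_le (min_le_right _ _))
    have h4 := h2.trans_le (min_le_left _ _)
    rw [← U.norm_map, map_sub, norm_sub_rev] at h3
    have h5 := norm_sub_le_norm_sub_add_norm_sub Y (U (∑ D ∈ F, ∑ ν, w D ν • indVec R ν D))
      (U (embed R b))
    linarith
  · rintro rfl
    refine ⟨h.memL2_iff.2 hb, fun ε hε => ?_⟩
    have hcl : embed R b ∈ (Submodule.span ℂ (Set.range fun x : Fin T × {D : Set ℝ //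
        MeasurableSet D} => indVec R x.1 x.2.1)).topologicalClosure := by
      unfold indVec
      rw [h.span_indicator_dense]; trivial
    obtain ⟨k, hk, hkb⟩ := Metric.mem_closure_iff.1 hcl (min ε 1 / 2) (by positivity)
    obtain ⟨F, w, hF, rfl⟩ := exists_simple_of_mem_span hk
    rw [dist_eq_norm] at hkb
    have h1 : min ε 1 ≤ ε := min_le_left _ _
    have h2 : min ε 1 ≤ 1 := min_le_right _ _
    have h3 : 0 < min ε 1 := by positivity
    refine ⟨F, w, hF, ?_, ?_⟩
    · rw [hns F w hF]
      nlinarith [norm_nonneg (embed R b - ∑ D ∈ F, ∑ ν, w D ν • indVec R ν D)]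
    · rw [← hUsum F w hF, ← map_sub, U.norm_map]
      linarith

/-- Any random spectral measure of `ξ` integrates as the spectral isometry does. -/
theorem linearIsometry_indVec (h : IsSpectralRoot f R S) {ξ : Fin T → ℤ → Lp ℂ 2 P}
    {Z : Fin T → Set ℝ → Lp ℂ 2 P} (hZ : IsRandomSpectralMeasure P ξ f Z)
    {U : FreqSpace T →ₗᵢ[ℂ] Lp ℂ 2 P} (hU : ∀ x, U (expoVec R x) = ξ x.2 x.1) (ν : Fin T)
    {D : Set ℝ} (hD : MeasurableSet D) : U (indVec R ν D) = Z ν D := by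
  -- the covariances of `Z` define an isometry `V` with values `Z`, and `V = U` on exponentials
  -- because `ξ` is represented by stochastic integrals with respect to `Z`
  obtain ⟨V, hV⟩ := exists_linearIsometry_of_gram (ξ := fun x : Fin T × {D : Set ℝ //
    MeasurableSet D} => Z x.1 x.2.1) h.span_indicator_dense fun x y => by
      rw [← cov_eq_inner, hZ.cov_eq _ _ _ _ y.2.2 x.2.2]
      exact (h.inner_indVec_indVec x.1 y.1 x.2.2 y.2.2).symm
  have hV' : ∀ ν D, MeasurableSet D → V (indVec R ν D) = Z ν D := fun ν D hD => hV (ν, ⟨D, hD⟩)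
  have hUV : U = V := linearIsometry_eq_of_dense h.span_expoVec_dense fun x => by
    rw [hU]
    exact (h.hasStochIntegral_iff hV' (h.memLp_twist_unitFn_expo x.1 x.2)).1 (hZ.repr x.2 x.1)
  rw [hUV, hV' ν D hD]

/-- The spectral isometry sends `e^{int} δ_ν` to `ξ_ν(n)`. -/
theorem exists_spectral_isometry (h : IsSpectralRoot f R S) {ξ : Fin T → ℤ → Lp ℂ 2 P}
    (hf : IsSpectralDensity P ξ f) :
    ∃ U : FreqSpace T →ₗᵢ[ℂ] Lp ℂ 2 P, ∀ x, U (expoVec R x) = ξ x.2 x.1 :=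
  exists_linearIsometry_of_gram (ξ := fun x : ℤ × Fin T => ξ x.2 x.1) h.span_expoVec_dense
    fun x y => by rw [← cov_eq_inner, hf.cov_eq, h.inner_expoVec_expoVec]

theorem exists_isRandomSpectralMeasure [IsProbabilityMeasure P] (h : IsSpectralRoot f R S)
    {ξ : Fin T → ℤ → Lp ℂ 2 P} (hξ : ∀ ν n, ∫ ω, ξ ν n ω ∂P = 0)
    (hf : IsSpectralDensity P ξ f) : ∃ Z, IsRandomSpectralMeasure P ξ f Z := by
  classical
  obtain ⟨U, hU⟩ := h.exists_spectral_isometry hf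
  have hmean : ∀ k, ∫ ω, U k ω ∂P = 0 := by
    have h1 : ∀ X : Lp ℂ 2 P, inner ℂ (indicatorConstLp 2 MeasurableSet.univ
        (measure_ne_top P _) (1 : ℂ)) X = ∫ ω, X ω ∂P := fun X => by
      rw [L2.inner_indicatorConstLp_one, setIntegral_univ]
    intro k
    rw [← h1]
    have hd : Dense (Submodule.span ℂ (Set.range (expoVec R)) : Set (FreqSpace T)) :=
      (Submodule.dense_iff_topologicalClosure_eq_top).2 h.span_expoVec_dense
    refine hd.induction (P := fun k => inner ℂ (indicatorConstLp 2 MeasurableSet.univ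
        (measure_ne_top P _) (1 : ℂ)) (U k) = 0) (fun x hx => ?_)
      (isClosed_eq (by fun_prop) continuous_const) k
    induction hx using Submodule.span_induction with
    | mem x hx =>
      obtain ⟨x, rfl⟩ := hx
      rw [hU, h1, hξ]
    | zero => simp
    | add x y _ _ hx hy => rw [map_add, inner_add_right, hx, hy, add_zero]
    | smul c x _ hx => rw [map_smul, inner_smul_right, hx, mul_zero]
  have hZ : ∀ ν D, MeasurableSet D → U (indVec R ν D) =
      (fun ν D => if MeasurableSet D then U (indVec R ν D) else 0 : Fin T → Set ℝ → Lp ℂ 2 P) ν D :=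
    fun ν D hD => (if_pos hD).symm
  refine ⟨fun ν D => if MeasurableSet D then U (indVec R ν D) else 0, fun ν D hD => ?_,
    fun ν μ D D' hD hD' => ?_, fun ν n => ?_⟩
  · simp only [if_pos hD, hmean]
  · rw [if_pos hD, if_pos hD', cov_eq_inner, U.inner_map_map, h.inner_indVec_indVec μ ν hD' hD]
  · exact (h.hasStochIntegral_iff hZ (h.memLp_twist_unitFn_expo n ν)).2 (hU (n, ν)).symm

end IsSpectralRoot

end Isometry

/-! ### Blocking and observation times -/

section Blocking

variable {Ω : Type*} [MeasurableSpace Ω] {P : Measure Ω} {T : ℕ} {ζ : ℤ → Lp ℂ 2 P}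

theorem IsPC.norm_add_period (hζ : IsPC P ζ T) (n : ℤ) : ‖ζ (n + T)‖ = ‖ζ n‖ := by
  have h := hζ.period n n
  rw [cov_eq_inner, cov_eq_inner, inner_self_eq_norm_sq_to_K, inner_self_eq_norm_sq_to_K] at h
  have h2 : ‖ζ (n + T)‖ ^ 2 = ‖ζ n‖ ^ 2 := by exact_mod_cast h
  exact (pow_left_inj₀ (norm_nonneg _) (norm_nonneg _) two_ne_zero).1 h2

theorem IsPC.exists_norm_le (hζ : IsPC P ζ T) : ∃ M, ∀ n, ‖ζ n‖ ≤ M := by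
  have hT : (0 : ℤ) < T := by exact_mod_cast hζ.pos
  have hper : Function.Periodic (fun n => ‖ζ n‖) (T : ℤ) := hζ.norm_add_period
  refine ⟨∑ r ∈ Finset.range T, ‖ζ r‖, fun n => ?_⟩
  have h1 : ‖ζ n‖ = ‖ζ ((n % T).toNat : ℤ)‖ := by
    have h2 := hper.int_mul (n / T) (n % T)
    rw [Int.toNat_of_nonneg (Int.emod_nonneg n hT.ne'), ← h2]
    congr 2
    rw [Int.cast_id, mul_comm]
    exact (Int.emod_add_mul_ediv n T).symm
  rw [h1]
  refine Finset.single_le_sum (f := fun r : ℕ => ‖ζ r‖) (fun r _ => norm_nonneg _) ?_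
  rw [Finset.mem_range]
  have h3 := Int.emod_lt_of_pos n hT
  have h4 := Int.emod_nonneg n hT.ne'
  omega

theorem IsPC.summable_functional (hζ : IsPC P ζ T) {a : ℕ → ℂ}
    (ha : Summable fun j : ℕ => ‖a (j + 1)‖) :
    Summable fun j : ℕ => a (j + 1) • ζ ((j : ℤ) + 1) := by
  obtain ⟨M, hM⟩ := hζ.exists_norm_le
  refine Summable.of_norm_bounded (ha.mul_right M) fun j => ?_
  rw [norm_smul]
  exact mul_le_mul_of_nonneg_left (hM _) (norm_nonneg _)

/-- The enumeration of the pairs `(j, ν)` by `ν + jT`. -/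
theorem divModEquiv_symm_eq [NeZero T] (j : ℕ) (ν : Fin T) :
    (Nat.divModEquiv T).symm (j, ν) = ν + j * T := by
  simp [Nat.divModEquiv, add_comm, mul_comm]

theorem IsPC.hasSum_block (hζ : IsPC P ζ T) {a : ℕ → ℂ}
    (ha : Summable fun j : ℕ => ‖a (j + 1)‖) :
    HasSum (fun j : ℕ => ∑ ν, vecCoef T a j ν • block ζ T ν j) (functional a ζ) := by
  have : NeZero T := ⟨hζ.pos.ne'⟩
  have h1 := (hζ.summable_functional ha).hasSum
  rw [← (Nat.divModEquiv T).symm.hasSum_iff] at h1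
  have h2 : (fun x : ℕ × Fin T => vecCoef T a x.1 x.2 • block ζ T x.2 x.1) =
      (fun j : ℕ => a (j + 1) • ζ ((j : ℤ) + 1)) ∘ (Nat.divModEquiv T).symm := by
    funext ⟨j, ν⟩
    simp only [Function.comp, divModEquiv_symm_eq, vecCoef, block]
    congr 2
    · ring
    · push_cast; ring
  rw [← h2] at h1
  exact h1.prod_fiberwise fun j => hasSum_fintype _

theorem summable_norm_vecCoef (hT : 0 < T) {a : ℕ → ℂ} (ha : Summable fun j : ℕ => ‖a (j + 1)‖) :
    Summable fun x : ℕ × Fin T => ‖vecCoef T a x.1 x.2‖ := by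
  have : NeZero T := ⟨hT.ne'⟩
  rw [← (Nat.divModEquiv T).symm.summable_iff] at ha
  refine ha.congr fun ⟨j, ν⟩ => ?_
  simp only [Function.comp, divModEquiv_symm_eq, vecCoef]
  congr 2; ring

theorem mul_le_mul_add_fin (x n : ℤ) (ν : Fin T) : x * T ≤ n * T + ν ↔ x ≤ n := by
  have h1 : ((ν : ℕ) : ℤ) < T := by exact_mod_cast ν.2
  have h2 : (0 : ℤ) ≤ ((ν : ℕ) : ℤ) := by positivity
  constructor
  · intro h
    by_contra hx
    push Not at hx
    have : (n + 1) * (T : ℤ) ≤ x * T := mul_le_mul_of_nonneg_right hx (by positivity)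
    linarith
  · intro h
    have : x * (T : ℤ) ≤ n * T := mul_le_mul_of_nonneg_right h (by positivity)
    linarith

theorem mem_missingTimes_iff (s : ℕ) (N K : ℕ → ℕ) (n : ℤ) (ν : Fin T) :
    n * T + ν + 1 ∈ missingTimes T s N K ↔ n ∈ missingBlocks s N K := by
  simp only [missingTimes, missingBlocks, Set.mem_ofPred_eq]
  refine exists_congr fun l => and_congr_right fun _ => and_congr ?_ ?_
  · rw [add_le_add_iff_right, mul_le_mul_add_fin]
  · have h1 := mul_le_mul_add_fin (-(bigM N K l : ℤ) - N (l + 1)) n ν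
    rw [sub_mul] at h1
    rw [← not_iff_not, not_le, not_le, Int.lt_add_one_iff, h1]
    omega

/-- The scalar and the blocked observations are the same random variables. -/
theorem image_observed_eq (hT : 0 < T) (s : ℕ) (N K : ℕ → ℕ) :
    ζ '' ({j | j ≤ 0} \ missingTimes T s N K) =
      {X | ∃ ν, ∃ n ∈ observedBlocks s N K, X = block ζ T ν n} := by
  have hT' : (0 : ℤ) < T := by exact_mod_cast hT
  have hobs : ∀ (n : ℤ) (ν : Fin T), n * T + ν + 1 ∈ {j : ℤ | j ≤ 0} \ missingTimes T s N K ↔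
      n ∈ observedBlocks s N K := by
    intro n ν
    rw [Set.mem_sdiff, mem_missingTimes_iff, observedBlocks, Set.mem_sdiff]
    refine and_congr_left fun _ => ?_
    have h1 := mul_le_mul_add_fin 0 n ν
    simp only [Set.mem_ofPred_eq]
    omega
  ext X
  constructor
  · rintro ⟨j, hj, rfl⟩
    have hlt : ((j - 1) % T).toNat < T := by
      have h1 := Int.emod_lt_of_pos (j - 1) hT'
      have h2 := Int.emod_nonneg (j - 1) hT'.ne'
      omega
    have he : (j - 1) / T * T + ((⟨((j - 1) % T).toNat, hlt⟩ : Fin T) : ℕ) + 1 = j := by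
      have h2 := Int.emod_nonneg (j - 1) hT'.ne'
      have h3 := Int.emod_add_mul_ediv (j - 1) T
      simp only
      rw [Int.toNat_of_nonneg h2]
      linarith
    refine ⟨⟨((j - 1) % T).toNat, hlt⟩, (j - 1) / T, ?_, ?_⟩
    · rw [← hobs _ ⟨((j - 1) % T).toNat, hlt⟩, he]
      exact hj
    · rw [block, he]
  · rintro ⟨ν, n, hn, rfl⟩
    exact ⟨n * T + ν + 1, (hobs n ν).2 hn, rfl⟩

theorem missingBlocks_finite (s : ℕ) (N K : ℕ → ℕ) : (missingBlocks s N K).Finite := by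
  have : missingBlocks s N K ⊆ ⋃ l ∈ Finset.range s, Set.Icc (-(bigM N K (l + 1) : ℤ)) (-1) := by
    rintro n ⟨l, hl, h1, h2⟩
    simp only [Finset.mem_range, Set.mem_iUnion]
    exact ⟨l, hl, h1, by omega⟩
  exact Set.Finite.subset (Set.Finite.biUnion (Finset.finite_toSet _) fun _ _ => Set.finite_Icc _ _)
    this

theorem mem_observedBlocks_iff (s : ℕ) (N K : ℕ → ℕ) (n : ℤ) :
    n ∈ observedBlocks s N K ↔ n < 0 ∧ n ∉ missingBlocks s N K := by
  simp only [observedBlocks, Set.mem_sdiff, Set.mem_ofPred_eq]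
  exact and_congr_left fun _ => by omega

theorem mem_gammaSet_iff (s : ℕ) (N K : ℕ → ℕ) (n : ℤ) :
    n ∈ gammaSet s N K ↔ n ∉ observedBlocks s N K := by
  rw [mem_observedBlocks_iff, gammaSet, Set.mem_union, Set.mem_ofPred_eq]
  constructor
  · rintro (h | h) ⟨h1, h2⟩
    · exact h2 h
    · omega
  · intro h
    by_cases h1 : n ∈ missingBlocks s N K
    · exact Or.inl h1
    · right
      by_contra h2
      exact h ⟨by omega, h1⟩

/-- The mean square error is the squared distance in `L²(P)`. -/
theorem mse_eq (X Y : Lp ℂ 2 P) : mse P X Y = ‖X - Y‖ ^ 2 := by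
  have h1 : ((‖X - Y‖ ^ 2 : ℝ) : ℂ) = ((mse P X Y : ℝ) : ℂ) := by
    have h2 := inner_self_eq_norm_sq_to_K (𝕜 := ℂ) (X - Y)
    rw [L2.inner_def] at h2
    rw [Complex.ofReal_pow]
    refine h2.symm.trans ?_
    rw [mse, ← integral_complex_ofReal]
    refine integral_congr_ae ?_
    filter_upwards [Lp.coeFn_sub X Y] with ω hω
    rw [hω, inner_self_eq_norm_sq_to_K]
    simp
  exact (Complex.ofReal_injective h1).symm

end Blocking

/-! ### Symbols of coefficient sequences -/

section Symbols

variable {T : ℕ} {f R S : ℝ → Matrix (Fin T) (Fin T) ℂ}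

/-- `L²` Fourier synthesis: an integrable function whose Fourier coefficients are square summable is
the `L²` sum of its Fourier series. -/
theorem memLp_two_and_tendsto_of_fcoef {Γ : Set ℤ} {d : Γ → ℂ} (hd : Summable fun n => ‖d n‖ ^ 2)
    {g : ℝ → ℂ} (hg : Integrable g freq) (hgd : ∀ n : Γ, fcoef g n = d n)
    (hg0 : ∀ n ∉ Γ, fcoef g n = 0) : MemLp g 2 freq ∧ Tendsto (fun F : Finset Γ =>
      eLpNorm (fun t => g t - ∑ n ∈ F, d n * expo n t) 2 freq) atTop (𝓝 0) := by
  have hm : ∀ n, MemLp (expo n) 2 freq := fun n =>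
    MemLp.of_bound (continuous_expo n).aestronglyMeasurable 1 (by simp)
  let v : ℤ → Lp ℂ 2 freq := fun n => (hm n).toLp _
  have hinner : ∀ n (G : Lp ℂ 2 freq), inner ℂ (v n) G = (2 * Real.pi : ℂ) * fcoef G n := by
    intro n G
    rw [L2.inner_def, fcoef, mul_inv_cancel_left₀ two_pi_ne_zero']
    refine integral_congr_ae ?_
    filter_upwards [(hm n).coeFn_toLp] with t ht
    rw [ht, ← conj_expo]
    rfl
  have hvv : ∀ n m, inner ℂ (v n) (v m) = if n = m then (2 * Real.pi : ℂ) else 0 := by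
    intro n m
    rw [hinner, fcoef_congr (hm m).coeFn_toLp, fcoef_expo]
    by_cases h : n = m
    · simp [h]
    · simp [h, Ne.symm h]
  have hpi := Real.two_pi_pos
  let w : Γ → Lp ℂ 2 freq := fun n => ((Real.sqrt (2 * Real.pi))⁻¹ : ℂ) • v n
  have hw : Orthonormal ℂ w := by
    rw [orthonormal_iff_ite]
    intro n m
    simp only [w, inner_smul_left, inner_smul_right, hvv, Subtype.ext_iff]
    split_ifs
    · rw [map_inv₀, Complex.conj_ofReal, ← mul_assoc, ← mul_inv, ← Complex.ofReal_mul,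
        Real.mul_self_sqrt hpi.le]
      push_cast
      exact inv_mul_cancel₀ two_pi_ne_zero'
    · simp
  have hsum : Summable fun n : Γ => d n • v n := by
    have h1 := (hw.orthogonalFamily.summable_iff_norm_sq_summable
      (fun n => (Real.sqrt (2 * Real.pi) : ℂ) * d n)).2 (by
        simp only [norm_mul, mul_pow]
        exact hd.mul_left _)
    refine h1.congr fun n => ?_
    simp only [LinearIsometry.toSpanSingleton_apply, w]
    rw [smul_smul, mul_right_comm, mul_inv_cancel₀, one_mul]
    exact_mod_cast (Real.sqrt_pos.2 hpi).ne'
  obtain ⟨G, hG⟩ := hsum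
  have hGc : ∀ m, (2 * Real.pi : ℂ) * fcoef G m = (2 * Real.pi : ℂ) * fcoef g m := by
    intro m
    rw [← hinner]
    have h1 := (hG.mapL (innerSL ℂ (v m)))
    simp only [innerSL_apply_apply, inner_smul_right, hvv] at h1
    by_cases hmΓ : m ∈ Γ
    · have h2 := hasSum_single (f := fun n : Γ => d n * if m = n then (2 * Real.pi : ℂ) else 0)
        ⟨m, hmΓ⟩ fun n hn => by
          rw [if_neg fun h => hn (Subtype.ext h.symm), mul_zero]
      rw [h1.unique h2, hgd ⟨m, hmΓ⟩, if_pos rfl, mul_comm]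
    · have h2 : ∀ n : Γ, d n * (if m = n then (2 * Real.pi : ℂ) else 0) = 0 := fun n => by
        rw [if_neg fun h : m = n => hmΓ (h ▸ n.2), mul_zero]
      simp only [h2] at h1
      rw [h1.unique hasSum_zero, hg0 m hmΓ, mul_zero]
  have hGi : Integrable G freq := (Lp.memLp G).integrable one_le_two
  have hGg : G =ᵐ[freq] g := by
    have h1 := ae_eq_zero_of_fcoef_eq_zero (hGi.sub hg) fun n => by
      rw [fcoef_sub hGi hg, sub_eq_zero]
      exact mul_left_cancel₀ two_pi_ne_zero' (hGc n)
    filter_upwards [h1] with t ht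
    exact sub_eq_zero.1 ht
  refine ⟨(memLp_congr_ae hGg).1 (Lp.memLp G), ?_⟩
  have h1 := tendsto_iff_norm_sub_tendsto_zero.1 hG
  have h2 : ∀ F : Finset Γ, eLpNorm (fun t => g t - ∑ n ∈ F, d n * expo n t) 2 freq =
      ENNReal.ofReal ‖∑ n ∈ F, d n • v n - G‖ := by
    intro F
    rw [norm_sub_rev, Lp.norm_def, ENNReal.ofReal_toReal (Lp.eLpNorm_ne_top _)]
    refine eLpNorm_congr_ae ?_
    have h3 : ∀ F : Finset Γ, (∑ n ∈ F, d n • v n : Lp ℂ 2 freq) =ᵐ[freq]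
        fun t => ∑ n ∈ F, d n * expo n t := by
      classical
      intro F
      induction F using Finset.induction_on with
      | empty =>
        simp only [Finset.sum_empty]
        exact Lp.coeFn_zero _ _ _
      | insert n F hn ih =>
        rw [Finset.sum_insert hn]
        filter_upwards [Lp.coeFn_add (d n • v n) (∑ n ∈ F, d n • v n), ih,
          Lp.coeFn_smul (d n) (v n), (hm n).coeFn_toLp] with t e1 e2 e3 e4
        rw [e1, Pi.add_apply, e2, e3, Pi.smul_apply, e4, smul_eq_mul, Finset.sum_insert hn]
    filter_upwards [Lp.coeFn_sub G (∑ n ∈ F, d n • v n), hGg, h3 F] with t e1 e2 e3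
    rw [e1, Pi.sub_apply, e2, e3]
  simp only [h2]
  simpa using ENNReal.tendsto_ofReal h1

end Symbols

/-! ### The operator `B` and the dual family -/

section OperatorB

variable {T : ℕ} {f R S : ℝ → Matrix (Fin T) (Fin T) ℂ}

/-- The vectors `(2π)⁻¹ e^{int} δ_νᵀ S`, the images of `e^{int} δ_νᵀ f⁻¹`. They are biorthogonal to
`expoVec R`, and their Gram matrix is the matrix of `B`. -/
noncomputable def dualVec (S : ℝ → Matrix (Fin T) (Fin T) ℂ) (x : ℤ × Fin T) : FreqSpace T :=
  (2 * Real.pi : ℂ)⁻¹ • expoVec S x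

/-- The combination `∑ p(x) dualVec x` of the dual vectors, for finitely supported `p`. -/
noncomputable def dualSum (S : ℝ → Matrix (Fin T) (Fin T) ℂ) {Γ : Set ℤ} (p : Γ × Fin T → ℂ) :
    FreqSpace T := ∑' x, p x • dualVec S ((x.1 : ℤ), x.2)

theorem dualSum_eq_sum {Γ : Set ℤ} {p : Γ × Fin T → ℂ} (hp : {x | p x ≠ 0}.Finite) :
    dualSum S p = ∑ x ∈ hp.toFinset, p x • dualVec S ((x.1 : ℤ), x.2) := by
  refine tsum_eq_sum fun x hx => ?_
  have : p x = 0 := by simpa using hx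
  rw [this, zero_smul]

theorem dualSum_sub {Γ : Set ℤ} {p q : Γ × Fin T → ℂ} (hp : {x | p x ≠ 0}.Finite)
    (hq : {x | q x ≠ 0}.Finite) : dualSum S (fun x => p x - q x) = dualSum S p - dualSum S q := by
  have hs : ∀ p : Γ × Fin T → ℂ, {x | p x ≠ 0}.Finite →
      Summable fun x => p x • dualVec S ((x.1 : ℤ), x.2) := fun p hp =>
    summable_of_ne_finset_zero (s := hp.toFinset) fun x hx => by
      have : p x = 0 := by simpa using hx
      rw [this, zero_smul]
  simp only [dualSum, sub_smul]
  exact (hs p hp).tsum_sub (hs q hq)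

namespace IsSpectralRoot

theorem conj_two_pi_inv : (starRingEnd ℂ) ((2 * Real.pi : ℂ)⁻¹) = (2 * Real.pi : ℂ)⁻¹ := by
  rw [map_inv₀, map_mul, Complex.conj_ofReal, Complex.conj_ofNat]

theorem inner_expoVec_dualVec (h : IsSpectralRoot f R S) (x y : ℤ × Fin T) :
    inner ℂ (expoVec R x) (dualVec S y) = if x = y then 1 else 0 :=
  h.inner_expoVec_expoVec_inv x y

theorem inner_dualVec_dualVec (h : IsSpectralRoot f R S) {Γ : Set ℤ} (x y : Γ × Fin T) :
    inner ℂ (dualVec S ((x.1 : ℤ), x.2)) (dualVec S ((y.1 : ℤ), y.2)) = matB f Γ x y := by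
  rw [dualVec, dualVec, inner_smul_left, inner_smul_right, conj_two_pi_inv, expoVec, expoVec,
    inner_embed_unitFn_unitFn h.memLp_inv h.herm_inv
    h.memLp_inv (continuous_expo _).aestronglyMeasurable (M := 1) (by simp)
    (continuous_expo _).aestronglyMeasurable (M' := 1) (by simp), matB, fourierB,
    Matrix.of_apply, ← integral_const_mul]
  congr 1
  refine integral_congr_ae ?_
  filter_upwards [h.ae_spec] with t ⟨_, _, _, _, _, h6⟩
  rw [h6, Matrix.transpose_apply, Matrix.smul_apply, smul_eq_mul, neg_sub, expo_sub]
  ring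

theorem applyB_eq_inner (h : IsSpectralRoot f R S) {Γ : Set ℤ} {p : Γ × Fin T → ℂ}
    (hp : {x | p x ≠ 0}.Finite) (x : Γ × Fin T) :
    applyB f Γ p x = inner ℂ (dualVec S ((x.1 : ℤ), x.2)) (dualSum S p) := by
  rw [dualSum_eq_sum hp, inner_sum, applyB, tsum_eq_sum (s := hp.toFinset)]
  · refine Finset.sum_congr rfl fun y _ => ?_
    rw [inner_smul_right, h.inner_dualVec_dualVec, mul_comm]
  · intro y hy
    have : p y = 0 := by simpa using hy
    rw [this, mul_zero]

theorem energyB_eq (h : IsSpectralRoot f R S) {Γ : Set ℤ} {p : Γ × Fin T → ℂ}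
    (hp : {x | p x ≠ 0}.Finite) : energyB f Γ p = ‖dualSum S p‖ ^ 2 := by
  have h1 : ∑' x, applyB f Γ p x * (starRingEnd ℂ) (p x) =
      inner ℂ (dualSum S p) (dualSum S p) := by
    conv_rhs => rw [dualSum_eq_sum hp, sum_inner, ← dualSum_eq_sum hp]
    rw [tsum_eq_sum (s := hp.toFinset)]
    · refine Finset.sum_congr rfl fun x _ => ?_
      rw [inner_smul_left, ← h.applyB_eq_inner hp, mul_comm]
    · intro x hx
      have : p x = 0 := by simpa using hx
      rw [this, map_zero, mul_zero]
  rw [energyB, h1, inner_self_eq_norm_sq_to_K, ← RCLike.ofReal_pow]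
  exact Complex.ofReal_re _

open Classical in
theorem inner_expoVec_dualSum (h : IsSpectralRoot f R S) {Γ : Set ℤ} {p : Γ × Fin T → ℂ}
    (hp : {x | p x ≠ 0}.Finite) (x : ℤ × Fin T) :
    inner ℂ (expoVec R x) (dualSum S p) = if hx : x.1 ∈ Γ then p (⟨x.1, hx⟩, x.2) else 0 := by
  rw [dualSum_eq_sum hp, inner_sum]
  simp only [inner_smul_right, h.inner_expoVec_dualVec]
  split_ifs with hx
  · rw [Finset.sum_eq_single (⟨x.1, hx⟩, x.2)]
    · simp
    · intro y _ hy
      rw [if_neg, mul_zero]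
      rintro rfl
      exact hy rfl
    · intro hy
      have : p (⟨x.1, hx⟩, x.2) = 0 := by simpa using hy
      rw [this, zero_mul]
  · refine Finset.sum_eq_zero fun y _ => ?_
    rw [if_neg, mul_zero]
    rintro rfl
    exact hx y.1.2

/-- A solution of `B c = b` is represented by a vector `Q` of the model space, the image of
`Cᵀ f⁻¹`: it has the coefficients `c` against `e^{int} δ_ν` and `b` against the dual vectors. -/
theorem exists_vec_of_isImageB (h : IsSpectralRoot f R S) {Γ : Set ℤ} {c : Seq2 T Γ}
    {b : Γ × Fin T → ℂ} (hc : IsImageB f Γ c b) :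
    ∃ Q : FreqSpace T, (∀ x : Γ × Fin T, inner ℂ (dualVec S ((x.1 : ℤ), x.2)) Q = b x) ∧
      (∀ x : Γ × Fin T, inner ℂ (expoVec R ((x.1 : ℤ), x.2)) Q = c x) ∧
      ∀ n ∉ Γ, ∀ ν, inner ℂ (expoVec R (n, ν)) Q = 0 := by
  obtain ⟨p, hp, hpc, hE, hb⟩ := hc
  have hcauchy : CauchySeq fun n => dualSum S (p n) := by
    rw [Metric.cauchySeq_iff]
    intro ε hε
    obtain ⟨n₀, hn₀⟩ := hE (ε ^ 2) (by positivity)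
    refine ⟨n₀, fun m hm n hn => ?_⟩
    have h1 := hn₀ m hm n hn
    have h2 : {x | p m x - p n x ≠ 0}.Finite := ((hp m).union (hp n)).subset fun x hx => by
      by_contra h3
      simp only [Set.mem_union, Set.mem_ofPred_eq, not_or, not_not] at h3 hx
      exact hx (by rw [h3.1, h3.2, sub_zero])
    rw [h.energyB_eq h2, dualSum_sub (hp m) (hp n), ← dist_eq_norm] at h1
    exact lt_of_pow_lt_pow_left₀ 2 hε.le h1
  obtain ⟨Q, hQ⟩ := cauchySeq_tendsto_of_complete hcauchy
  have hlim : ∀ v : FreqSpace T, Tendsto (fun n => inner ℂ v (dualSum S (p n))) atTop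
      (𝓝 (inner ℂ v Q)) := fun v => tendsto_const_nhds.inner hQ
  refine ⟨Q, fun x => ?_, fun x => ?_, fun n hn ν => ?_⟩
  · refine tendsto_nhds_unique (hlim _) ((hb x).congr fun n => ?_)
    exact h.applyB_eq_inner (hp n) x
  · have h1 : Tendsto (fun n => p n x) atTop (𝓝 (c x)) := by
      rw [tendsto_iff_norm_sub_tendsto_zero] at hpc ⊢
      refine squeeze_zero (fun n => norm_nonneg _) (fun n => ?_) hpc
      exact lp.norm_apply_le_norm two_ne_zero (p n - c) x
    refine tendsto_nhds_unique (hlim _) (h1.congr fun n => ?_)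
    rw [h.inner_expoVec_dualSum (hp n), dif_pos x.1.2]
  · refine tendsto_nhds_unique (hlim _) (tendsto_const_nhds.congr fun m => ?_)
    rw [h.inner_expoVec_dualSum (hp m), dif_neg hn]

/-- If `Q` has the coefficients `c` against `e^{int} δ_ν`, `n ∈ Γ`, and no others, then the symbol
of `c` is `Cᵀ = 2π Qᵀ R`, and `Q` is the image of `Cᵀ f⁻¹`, since `f⁻¹ = (2π)⁻¹ S²`. -/
theorem isSymbol_and_embed_eq (h : IsSpectralRoot f R S) {Γ : Set ℤ} {c : Seq2 T Γ}
    {Q : FreqSpace T}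
    (hc : ∀ x : Γ × Fin T, inner ℂ (expoVec R ((x.1 : ℤ), x.2)) Q = c x)
    (hc0 : ∀ n ∉ Γ, ∀ ν, inner ℂ (expoVec R (n, ν)) Q = 0) :
    IsSymbol Γ c (fun t => (2 * Real.pi : ℂ) • ((Q t).ofLp ᵥ* R t)) ∧
      MemLp (twist R fun t => ((2 * Real.pi : ℂ) • ((Q t).ofLp ᵥ* R t)) ᵥ* (f t)⁻¹) 2 freq ∧
      embed R (fun t => ((2 * Real.pi : ℂ) • ((Q t).ofLp ᵥ* R t)) ᵥ* (f t)⁻¹) = Q := by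
  constructor
  · intro ν
    have hs : Summable fun n : Γ => ‖c (n, ν)‖ ^ 2 := by
      have h1 := (lp.memℓp c).summable (by norm_num)
      simp only [ENNReal.toReal_ofNat, Real.rpow_ofNat] at h1
      exact h1.comp_injective (i := fun n : Γ => (n, ν)) fun a b hab => congrArg Prod.fst hab
    have hco : ∀ n, fcoef (fun t => ((2 * Real.pi : ℂ) • ((Q t).ofLp ᵥ* R t)) ν) n =
        inner ℂ (expoVec R (n, ν)) Q := fun n => by
      rw [inner_expoVec h.memLp_root h.herm_root, ← fcoef_smul]
      rfl
    exact memLp_two_and_tendsto_of_fcoef hs ((integrable_vecMul h.memLp_root Q ν).const_mul _)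
      (fun n => (hco n).trans (hc (n, ν))) fun n hn => (hco n).trans (hc0 n hn ν)
  · have h1 : (fun t => ((2 * Real.pi : ℂ) • ((Q t).ofLp ᵥ* R t)) ᵥ* (f t)⁻¹) =ᵐ[freq]
        fun t => (Q t).ofLp ᵥ* S t := by
      filter_upwards [h.ae_spec] with t ⟨_, _, h3, _, _, h6⟩
      rw [h6, Matrix.smul_vecMul, Matrix.vecMul_smul, smul_smul, mul_inv_cancel₀ two_pi_ne_zero',
        one_smul, Matrix.vecMul_vecMul, ← Matrix.mul_assoc, h3, Matrix.one_mul]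
    obtain ⟨h2, h3⟩ := h.embed_vecMul_inv Q
    have h4 : twist R (fun t => ((2 * Real.pi : ℂ) • ((Q t).ofLp ᵥ* R t)) ᵥ* (f t)⁻¹) =ᵐ[freq]
        twist R fun t => (Q t).ofLp ᵥ* S t := by
      filter_upwards [h1] with t ht
      simp only [twist, ht]
    have h5 := (memLp_congr_ae h4).2 h2
    exact ⟨h5, (embed_congr h5 h4).trans h3⟩

end IsSpectralRoot

end OperatorB

/-! ### The symbol `A` -/

section SymbolA

variable {T : ℕ} {f R S : ℝ → Matrix (Fin T) (Fin T) ℂ}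

namespace IsSpectralRoot

theorem exists_norm_embed_unitFn_le (h : IsSpectralRoot f R S) (ν : Fin T) :
    ∃ κ, 0 ≤ κ ∧ ∀ (g : ℝ → ℂ) (M : ℝ), AEStronglyMeasurable g freq → (∀ t, ‖g t‖ ≤ M) →
      ‖embed R (unitFn g ν)‖ ≤ M * κ := by
  obtain ⟨κ, hκ⟩ : ∃ κ : ℝ, κ = ∫ t, ‖(R t * R t) ν ν‖ ∂freq := ⟨_, rfl⟩
  have hκ0 : 0 ≤ κ := by rw [hκ]; exact integral_nonneg fun t => norm_nonneg _
  have hint : Integrable (fun t => (R t * R t) ν ν) freq := by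
    simp only [Matrix.mul_apply]
    exact integrable_finsetSum _ fun μ _ => (h.memLp_root ν μ).integrable_mul (h.memLp_root μ ν)
  refine ⟨Real.sqrt κ, Real.sqrt_nonneg κ, fun g M hg hM => ?_⟩
  have hM0 : 0 ≤ M := (norm_nonneg _).trans (hM 0)
  rw [← pow_le_pow_iff_left₀ (norm_nonneg _) (by positivity) two_ne_zero]
  rw [mul_pow, Real.sq_sqrt hκ0]
  have h1 : ‖embed R (unitFn g ν)‖ ^ 2 =
      ‖inner ℂ (embed R (unitFn g ν)) (embed R (unitFn g ν))‖ := by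
    rw [inner_self_eq_norm_sq_to_K]; simp
  rw [h1, inner_embed_unitFn_unitFn h.memLp_root h.herm_root h.memLp_root hg hM hg hM, hκ,
    ← integral_const_mul]
  refine norm_integral_le_of_norm_le (hint.norm.const_mul _) (Eventually.of_forall fun t => ?_)
  rw [norm_mul, norm_mul, RCLike.norm_conj, ← sq]
  exact mul_le_mul_of_nonneg_right (pow_le_pow_left₀ (norm_nonneg _) (hM t) 2) (norm_nonneg _)

theorem hasSum_expoVec (h : IsSpectralRoot f R S) {d : ℕ → ℂ} (hd : Summable fun j => ‖d j‖)
    (ν : Fin T) : HasSum (fun j : ℕ => d j • expoVec R ((j : ℤ), ν))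
      (embed R (unitFn (fun t => ∑' j : ℕ, d j * expo j t) ν)) := by
  obtain ⟨κ, hκ0, hκ⟩ := h.exists_norm_embed_unitFn_le ν
  have hnorm : ∀ t, Summable fun j : ℕ => ‖d j * expo j t‖ := fun t => by simpa using hd
  have hcont : Continuous fun t => ∑' j : ℕ, d j * expo j t :=
    continuous_tsum (fun j => by fun_prop) hd fun j t => by simp
  have htail : ∀ (s : Finset ℕ) t, ‖∑' j : ℕ, d j * expo j t - ∑ j ∈ s, d j * expo j t‖ ≤
      ∑' j : {j // j ∉ s}, ‖d j‖ := by
    intro s t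
    rw [← (hnorm t).of_norm.sum_add_tsum_subtype_compl s, add_sub_cancel_left]
    refine (norm_tsum_le_tsum_norm ((hnorm t).subtype _)).trans (le_of_eq ?_)
    simp
  have hpart : ∀ s : Finset ℕ,
      MemLp (twist R (unitFn (fun t => ∑ j ∈ s, d j * expo j t) ν)) 2 freq ∧
      embed R (unitFn (fun t => ∑ j ∈ s, d j * expo j t) ν) =
        ∑ j ∈ s, d j • expoVec R ((j : ℤ), ν) := by
    intro s
    have h1 : unitFn (fun t => ∑ j ∈ s, d j * expo j t) ν = ∑ j ∈ s, d j • unitFn (expo j) ν := by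
      funext t μ
      simp only [unitFn_apply, Finset.sum_apply, Pi.smul_apply, smul_eq_mul, mul_ite, mul_zero]
      split_ifs <;> simp
    have h2 : ∀ j ∈ s, MemLp (twist R (d j • unitFn (expo (j : ℤ)) ν)) 2 freq := fun j _ => by
      rw [twist_smul]; exact (h.memLp_twist_unitFn_expo j ν).const_smul _
    rw [h1]
    refine ⟨(embed_sum s h2).1, (embed_sum s h2).2.trans (Finset.sum_congr rfl fun j _ => ?_)⟩
    exact embed_smul _ (h.memLp_twist_unitFn_expo j ν)
  have hm : MemLp (twist R (unitFn (fun t => ∑' j : ℕ, d j * expo j t) ν)) 2 freq :=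
    memLp_twist_unitFn h.memLp_root hcont.aestronglyMeasurable (M := ∑' j, ‖d j‖) (fun t =>
      (norm_tsum_le_tsum_norm (hnorm t)).trans (le_of_eq (by simp))) ν
  have hlim : Tendsto (fun s : Finset ℕ => (∑' j : {j // j ∉ s}, ‖d j‖) * κ) atTop (𝓝 0) := by
    simpa using (tendsto_tsum_compl_atTop_zero fun j => ‖d j‖).mul_const κ
  rw [HasSum, tendsto_iff_norm_sub_tendsto_zero]
  refine squeeze_zero (fun s => norm_nonneg _) (fun s => ?_) hlim
  rw [norm_sub_rev, ← (hpart s).2, ← embed_sub hm (hpart s).1]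
  have h1 : unitFn (fun t => ∑' j : ℕ, d j * expo j t) ν -
        unitFn (fun t => ∑ j ∈ s, d j * expo j t) ν =
      unitFn (fun t => ∑' j : ℕ, d j * expo j t - ∑ j ∈ s, d j * expo j t) ν := by
    funext t μ
    simp only [unitFn_apply, Pi.sub_apply]
    split_ifs <;> simp
  rw [h1]
  refine hκ _ _ (Continuous.aestronglyMeasurable ?_) (htail s)
  exact hcont.sub (by fun_prop)

/-- The image of `A(e^{it})` in the model space is the sum of its Fourier series. -/
theorem hasSum_symbolA (h : IsSpectralRoot f R S) (hT : 0 < T) {a : ℕ → ℂ}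
    (ha : Summable fun j : ℕ => ‖a (j + 1)‖) : MemLp (twist R (symbolA T a)) 2 freq ∧
      HasSum (fun x : ℕ × Fin T => vecCoef T a x.1 x.2 • expoVec R ((x.1 : ℤ), x.2))
        (embed R (symbolA T a)) := by
  have hs := summable_norm_vecCoef hT ha
  have hsν : ∀ ν : Fin T, Summable fun j : ℕ => ‖vecCoef T a j ν‖ := fun ν =>
    hs.comp_injective (i := fun j : ℕ => (j, ν)) fun a b hab => congrArg Prod.fst hab
  have hA : symbolA T a = ∑ ν, unitFn (fun t => ∑' j : ℕ, vecCoef T a j ν * expo j t) ν := by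
    funext t μ
    simp [symbolA, unitFn_apply]
  have hm : ∀ ν ∈ Finset.univ, MemLp (twist R (unitFn (fun t => ∑' j : ℕ, vecCoef T a j ν *
      expo j t) ν)) 2 freq := fun ν _ => by
    have hnorm : ∀ t, Summable fun j : ℕ => ‖vecCoef T a j ν * expo j t‖ := fun t => by
      simpa using hsν ν
    refine memLp_twist_unitFn h.memLp_root (Continuous.aestronglyMeasurable ?_)
      (M := ∑' j, ‖vecCoef T a j ν‖) (fun t => ?_) ν
    · exact continuous_tsum (fun j => by fun_prop) (hsν ν) fun j t => by simp
    · exact (norm_tsum_le_tsum_norm (hnorm t)).trans (le_of_eq (by simp))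
  have h1 := embed_sum Finset.univ hm
  rw [← hA] at h1
  refine ⟨h1.1, ?_⟩
  have hsum : Summable fun x : ℕ × Fin T =>
      vecCoef T a x.1 x.2 • expoVec R ((x.1 : ℤ), x.2) := by
    choose κ hκ0 hκ using fun ν => h.exists_norm_embed_unitFn_le ν
    refine Summable.of_norm_bounded (hs.mul_right (∑ ν, κ ν)) fun x => ?_
    rw [norm_smul]
    refine mul_le_mul_of_nonneg_left ?_ (norm_nonneg _)
    have h2 := hκ x.2 (expo x.1) 1 (continuous_expo _).aestronglyMeasurable (by simp)
    rw [one_mul] at h2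
    exact h2.trans (Finset.single_le_sum (fun ν _ => hκ0 ν) (Finset.mem_univ x.2))
  obtain ⟨X, hX⟩ := hsum
  have h3 := hX.prod_fiberwise fun j => hasSum_fintype _
  have h4 := hasSum_sum fun ν (_ : ν ∈ Finset.univ) => h.hasSum_expoVec (hsν ν) ν
  rw [← h1.2] at h4
  rwa [← h3.unique h4]

end IsSpectralRoot

/-- The passage from `ℕ × {1, …, T}` to `Γ × {1, …, T}`: the coefficients on `Γ` extend those of `A`
by zero. -/
theorem hasSum_gammaCoef_iff {Γ : Set ℤ} (hΓ : ∀ n : ℤ, 0 ≤ n → n ∈ Γ) {a : ℕ → ℂ} {E : Type*}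
    [AddCommMonoid E] [TopologicalSpace E] {φ : ℂ → ℤ × Fin T → E} (hφ : ∀ x, φ 0 x = 0) {X : E} :
    HasSum (fun x : Γ × Fin T => φ (gammaCoef T a Γ x) ((x.1 : ℤ), x.2)) X ↔
      HasSum (fun x : ℕ × Fin T => φ (vecCoef T a x.1 x.2) ((x.1 : ℤ), x.2)) X := by
  let i : ℕ × Fin T → Γ × Fin T := fun x => (⟨x.1, hΓ _ (Int.natCast_nonneg _)⟩, x.2)
  have hi : Function.Injective i := by
    rintro ⟨j, ν⟩ ⟨k, μ⟩ hjk
    simp only [i, Prod.mk.injEq, Subtype.mk.injEq, Nat.cast_inj] at hjk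
    exact Prod.ext hjk.1 hjk.2
  rw [← hi.hasSum_iff]
  · have : (fun x : Γ × Fin T => φ (gammaCoef T a Γ x) ((x.1 : ℤ), x.2)) ∘ i =
        fun x : ℕ × Fin T => φ (vecCoef T a x.1 x.2) ((x.1 : ℤ), x.2) := by
      funext x
      simp [i, gammaCoef]
    rw [this]
  · intro x hx
    have hneg : ¬ 0 ≤ (x.1 : ℤ) := fun h0 => hx ⟨((x.1 : ℤ).toNat, x.2), by
      refine Prod.ext (Subtype.ext ?_) rfl
      exact Int.toNat_of_nonneg h0⟩
    rw [gammaCoef, if_neg hneg, hφ]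

end SymbolA

/-! ### The optimal estimate -/

section Estimate

variable {T : ℕ} {f R S : ℝ → Matrix (Fin T) (Fin T) ℂ}

/-- The image of `L₂ˢ(f)` in the model space. -/
noncomputable def modelSpace (R : ℝ → Matrix (Fin T) (Fin T) ℂ) (J : Set ℤ) :
    Submodule ℂ (FreqSpace T) :=
  (Submodule.span ℂ {X | ∃ ν, ∃ n ∈ J, X = expoVec R (n, ν)}).topologicalClosure

namespace IsSpectralRoot

theorem embed_trigPoly (h : IsSpectralRoot f R S) (p : ℤ →₀ (Fin T → ℂ)) :
    MemLp (twist R (trigPoly p)) 2 freq ∧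
      embed R (trigPoly p) = ∑ n ∈ p.support, ∑ ν, p n ν • expoVec R (n, ν) := by
  have h1 : trigPoly p = ∑ n ∈ p.support, ∑ ν, p n ν • unitFn (expo n) ν := by
    funext t μ
    simp [trigPoly, Finsupp.sum, unitFn_apply, mul_comm]
  have h2 : ∀ n ∈ p.support, ∀ ν ∈ Finset.univ,
      MemLp (twist R (p n ν • unitFn (expo n) ν)) 2 freq := fun n _ ν _ => by
    rw [twist_smul]; exact (h.memLp_twist_unitFn_expo n ν).const_smul _
  have h3 : ∀ n ∈ p.support, _ := fun n hn => embed_sum Finset.univ (h2 n hn)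
  have h4 := embed_sum p.support fun n hn => (h3 n hn).1
  rw [h1]
  refine ⟨h4.1, h4.2.trans (Finset.sum_congr rfl fun n hn => ?_)⟩
  rw [(h3 n hn).2]
  exact Finset.sum_congr rfl fun ν _ => embed_smul _ (h.memLp_twist_unitFn_expo n ν)

theorem exists_trigPoly_of_mem_span (h : IsSpectralRoot f R S) {J : Set ℤ} {k : FreqSpace T}
    (hk : k ∈ Submodule.span ℂ {X | ∃ ν, ∃ n ∈ J, X = expoVec R (n, ν)}) :
    ∃ p : ℤ →₀ (Fin T → ℂ), (p.support : Set ℤ) ⊆ J ∧ embed R (trigPoly p) = k := by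
  classical
  induction hk using Submodule.span_induction with
  | mem x hx =>
    obtain ⟨ν, n, hn, rfl⟩ := hx
    refine ⟨Finsupp.single n (Pi.single ν 1), fun m hm => ?_, ?_⟩
    · have := Finsupp.support_single_subset hm
      rw [Finset.mem_singleton] at this
      exact this ▸ hn
    · rw [expoVec]
      congr 1
      funext t
      simp [trigPoly, unitFn]
  | zero => exact ⟨0, by simp, by rw [(h.embed_trigPoly 0).2]; simp⟩
  | add x y _ _ hx hy =>
    obtain ⟨p, hp, rfl⟩ := hx
    obtain ⟨q, hq, rfl⟩ := hy
    refine ⟨p + q, fun n hn => (Finset.mem_union.1 (Finsupp.support_add hn)).elim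
      (fun h1 => hp h1) fun h1 => hq h1, ?_⟩
    rw [← embed_add (h.embed_trigPoly p).1 (h.embed_trigPoly q).1]
    congr 1
    funext t
    simp only [trigPoly, Pi.add_apply]
    exact Finsupp.sum_add_index' (fun n => smul_zero _) fun n v w => smul_add _ _ _
  | smul c x _ hx =>
    obtain ⟨p, hp, rfl⟩ := hx
    refine ⟨c • p, fun n hn => hp (Finsupp.support_smul hn), ?_⟩
    rw [← embed_smul c (h.embed_trigPoly p).1]
    congr 1
    funext t
    simp only [trigPoly, Pi.smul_apply]
    rw [Finsupp.sum_smul_index' (fun n => smul_zero _), Finsupp.smul_sum]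
    exact Finsupp.sum_congr fun n _ => smul_comm _ _ _

theorem memL2s_iff (h : IsSpectralRoot f R S) {J : Set ℤ} {g : ℝ → Fin T → ℂ} :
    MemL2s f J g ↔ MemLp (twist R g) 2 freq ∧ embed R g ∈ modelSpace R J := by
  rw [MemL2s, h.memL2_iff]
  refine and_congr_right fun hg => ?_
  have hns : ∀ p, normSq f (fun t => g t - trigPoly p t) =
      ‖embed R g - embed R (trigPoly p)‖ ^ 2 := fun p => by
    have h1 := (h.embed_trigPoly p).1
    have h2 : MemLp (twist R (g - trigPoly p)) 2 freq := by rw [twist_sub]; exact hg.sub h1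
    rw [← embed_sub hg h1, ← h.normSq_eq h2]
    rfl
  have hmem : embed R g ∈ modelSpace R J ↔
      embed R g ∈ closure (Submodule.span ℂ {X | ∃ ν, ∃ n ∈ J, X = expoVec R (n, ν)} :
        Set (FreqSpace T)) := Iff.rfl
  rw [hmem, Metric.mem_closure_iff]
  constructor
  · intro hp ε hε
    obtain ⟨p, hpJ, hpe⟩ := hp (ε ^ 2) (by positivity)
    refine ⟨embed R (trigPoly p), ?_, ?_⟩
    · rw [(h.embed_trigPoly p).2]
      exact Submodule.sum_mem _ fun n hn => Submodule.sum_mem _ fun ν _ =>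
        Submodule.smul_mem _ _ (Submodule.subset_span ⟨ν, n, hpJ hn, rfl⟩)
    · rw [hns] at hpe
      rw [dist_eq_norm]
      exact lt_of_pow_lt_pow_left₀ 2 hε.le hpe
  · intro hk ε hε
    obtain ⟨k, hk, hke⟩ := hk (Real.sqrt ε) (Real.sqrt_pos.2 hε)
    obtain ⟨p, hpJ, rfl⟩ := h.exists_trigPoly_of_mem_span hk
    refine ⟨p, hpJ, ?_⟩
    rw [hns, ← dist_eq_norm]
    exact (Real.lt_sqrt dist_nonneg).1 hke

theorem spectralError_eq (h : IsSpectralRoot f R S) (hT : 0 < T) {a : ℕ → ℂ}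
    (ha : Summable fun j : ℕ => ‖a (j + 1)‖) {g : ℝ → Fin T → ℂ} (hg : MemLp (twist R g) 2 freq) :
    spectralError a f g = ‖embed R (symbolA T a) - embed R g‖ ^ 2 := by
  have h1 := (h.hasSum_symbolA hT ha).1
  have h2 : MemLp (twist R (symbolA T a - g)) 2 freq := by rw [twist_sub]; exact h1.sub hg
  rw [← embed_sub h1 hg, ← h.normSq_eq h2]
  rfl

end IsSpectralRoot

/-- The spectral isometry identifies `L₂ˢ(f)` with the space of the observations. -/
theorem mem_observedBlockSpace_iff {Ω : Type*} [MeasurableSpace Ω] {P : Measure Ω}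
    {ξ : Fin T → ℤ → Lp ℂ 2 P} {U : FreqSpace T →ₗᵢ[ℂ] Lp ℂ 2 P}
    (hU : ∀ x, U (expoVec R x) = ξ x.2 x.1) (J : Set ℤ) (Y : Lp ℂ 2 P) :
    Y ∈ observedBlockSpace ξ J ↔ ∃ k ∈ modelSpace R J, U k = Y := by
  have h1 : (Submodule.span ℂ {X | ∃ ν, ∃ n ∈ J, X = ξ ν n} : Set (Lp ℂ 2 P)) =
      U '' (Submodule.span ℂ {X | ∃ ν, ∃ n ∈ J, X = expoVec R (n, ν)} : Set (FreqSpace T)) := by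
    have h2 : {X | ∃ ν, ∃ n ∈ J, X = ξ ν n} =
        U.toLinearMap '' {X | ∃ ν, ∃ n ∈ J, X = expoVec R (n, ν)} := by
      ext X
      constructor
      · rintro ⟨ν, n, hn, rfl⟩
        exact ⟨_, ⟨ν, n, hn, rfl⟩, hU (n, ν)⟩
      · rintro ⟨_, ⟨ν, n, hn, rfl⟩, rfl⟩
        exact ⟨ν, n, hn, hU (n, ν)⟩
    rw [h2, Submodule.span_image]
    rfl
  have h3 : (observedBlockSpace ξ J : Set (Lp ℂ 2 P)) =
      U '' (modelSpace R J : Set (FreqSpace T)) := by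
    rw [observedBlockSpace, modelSpace, Submodule.topologicalClosure_coe,
      Submodule.topologicalClosure_coe, h1]
    exact U.isometry.isClosedEmbedding.closure_image_eq _
  rw [← SetLike.mem_coe, h3]
  rfl

namespace IsSpectralRoot

/-- The projection theorem for `A`: if `B c = a`, then `A = h + Q` with `h ∈ L₂ˢ(f)` and
`Q = Cᵀ f⁻¹` orthogonal to `L₂ˢ(f)`, and `‖Q‖² = ⟨c, a⟩`. -/
theorem exists_decomposition (h : IsSpectralRoot f R S) (hT : 0 < T) {a : ℕ → ℂ}
    (ha : Summable fun j : ℕ => ‖a (j + 1)‖) (s : ℕ) (N K : ℕ → ℕ)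
    {c : Seq2 T (gammaSet s N K)}
    (hc : IsImageB f (gammaSet s N K) c (gammaCoef T a (gammaSet s N K))) :
    ∃ Q : FreqSpace T, (∀ x : gammaSet s N K × Fin T,
        inner ℂ (expoVec R ((x.1 : ℤ), x.2)) Q = c x) ∧
      (∀ n ∉ gammaSet s N K, ∀ ν, inner ℂ (expoVec R (n, ν)) Q = 0) ∧
      embed R (symbolA T a) - Q ∈ modelSpace R (observedBlocks s N K) ∧
      (∀ k ∈ modelSpace R (observedBlocks s N K), inner ℂ k Q = 0) ∧
      HasSum (fun x => c x * (starRingEnd ℂ) (gammaCoef T a (gammaSet s N K) x))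
        ((‖Q‖ ^ 2 : ℝ) : ℂ) := by
  obtain ⟨Q, hQa, hQc, hQ0⟩ := h.exists_vec_of_isImageB hc
  have hΓ : ∀ n : ℤ, 0 ≤ n → n ∈ gammaSet s N K := fun n hn => Or.inr hn
  have hA := (hasSum_gammaCoef_iff hΓ (φ := fun z x => z • expoVec R x) (fun x => zero_smul _ _)).2
    (h.hasSum_symbolA hT ha).2
  have horth : ∀ k ∈ modelSpace R (observedBlocks s N K), inner ℂ k Q = 0 := by
    have h1 : modelSpace R (observedBlocks s N K) ≤ (Submodule.span ℂ {Q})ᗮ := by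
      refine Submodule.topologicalClosure_minimal _ (Submodule.span_le.2 ?_)
        (Submodule.isClosed_orthogonal _)
      rintro _ ⟨ν, n, hn, rfl⟩
      rw [SetLike.mem_coe, Submodule.mem_orthogonal_singleton_iff_inner_left]
      exact hQ0 n (fun h2 => (mem_gammaSet_iff s N K n).1 h2 hn) ν
    exact fun k hk => Submodule.mem_orthogonal_singleton_iff_inner_left.1 (h1 hk)
  -- against the dual vectors with indices in `Γ`, both `A` and `Q` have the coefficients `a`
  have hmem : embed R (symbolA T a) - Q ∈ modelSpace R (observedBlocks s N K) := by
    refine h.mem_closure_of_inner_eq_zero (missingBlocks_finite s N K)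
      (mem_observedBlocks_iff s N K) fun n hn ν => ?_
    have hn' := (mem_gammaSet_iff s N K n).2 hn
    have h1 : inner ℂ (dualVec S (n, ν)) (embed R (symbolA T a) - Q) = 0 := by
      have h2 := hA.mapL (innerSL ℂ (dualVec S (n, ν)))
      simp only [innerSL_apply_apply, inner_smul_right] at h2
      have h3 : ∀ y, inner ℂ (dualVec S (n, ν)) (expoVec R y) =
          if y = (n, ν) then (1 : ℂ) else 0 := fun y => by
        rw [← inner_conj_symm, h.inner_expoVec_dualVec]
        split_ifs <;> simp
      simp only [h3] at h2
      have h4 := hasSum_single (f := fun x : gammaSet s N K × Fin T =>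
        gammaCoef T a (gammaSet s N K) x * if ((x.1 : ℤ), x.2) = (n, ν) then (1 : ℂ) else 0)
        (⟨n, hn'⟩, ν) fun y hy => by
          rw [if_neg, mul_zero]
          rintro h5
          rw [Prod.mk.injEq] at h5
          exact hy (Prod.ext (Subtype.ext h5.1) h5.2)
      rw [if_pos rfl, mul_one] at h4
      rw [inner_sub_right, h2.unique h4, hQa (⟨n, hn'⟩, ν), sub_self]
    rw [dualVec, inner_smul_left, conj_two_pi_inv, mul_eq_zero] at h1
    exact h1.resolve_left (inv_ne_zero two_pi_ne_zero')
  refine ⟨Q, hQc, hQ0, hmem, horth, ?_⟩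
  -- `⟨c, a⟩` is the inner product of `Q` with the series of `A`, that is, with `(A - Q) + Q`
  have h1 := (hA.mapL (innerSL ℂ Q)).star
  simp only [innerSL_apply_apply, inner_smul_right] at h1
  have h2 : star (inner ℂ Q (embed R (symbolA T a))) = ((‖Q‖ ^ 2 : ℝ) : ℂ) := by
    have h3 : inner ℂ (embed R (symbolA T a)) Q =
        inner ℂ (embed R (symbolA T a) - Q) Q + inner ℂ Q Q := by
      rw [← inner_add_left, sub_add_cancel]
    rw [← starRingEnd_apply, inner_conj_symm, h3, horth _ hmem, zero_add,
      inner_self_eq_norm_sq_to_K]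
    push_cast; rfl
  rw [h2] at h1
  have h4 : (fun x => star (gammaCoef T a (gammaSet s N K) x *
      inner ℂ Q (expoVec R ((x.1 : ℤ), x.2)))) =
      fun x => c x * (starRingEnd ℂ) (gammaCoef T a (gammaSet s N K) x) := by
    funext x
    rw [star_mul', ← starRingEnd_apply (inner ℂ Q _), inner_conj_symm, hQc x, mul_comm]
    rfl
  rw [h4] at h1
  exact h1

end IsSpectralRoot

/-- A summable `a` lies in `ℓ²`, hence is an admissible right-hand side of `B c = a`. -/
theorem exists_seq2_gammaCoef {T : ℕ} (hT : 0 < T) {Γ : Set ℤ} (hΓ : ∀ n : ℤ, 0 ≤ n → n ∈ Γ)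
    {a : ℕ → ℂ} (ha : Summable fun j : ℕ => ‖a (j + 1)‖) :
    ∃ b : Seq2 T Γ, ∀ x, b x = gammaCoef T a Γ x := by
  have hs := summable_norm_vecCoef hT ha
  have h2 : Summable fun x : ℕ × Fin T => ‖vecCoef T a x.1 x.2‖ ^ 2 := by
    refine Summable.of_norm_bounded_eventually hs ?_
    have h3 := hs.tendsto_cofinite_zero.eventually (gt_mem_nhds one_pos)
    filter_upwards [h3] with x hx
    rw [Real.norm_of_nonneg (by positivity)]
    nlinarith [norm_nonneg (vecCoef T a x.1 x.2)]
  obtain ⟨X, hX⟩ := h2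
  have h3 := (hasSum_gammaCoef_iff hΓ (φ := fun z (_ : ℤ × Fin T) => ‖z‖ ^ 2) (by simp)).2 hX
  have hm : Memℓp (gammaCoef T a Γ) 2 := memℓp_gen (by simpa using h3.summable)
  exact ⟨⟨gammaCoef T a Γ, hm⟩, fun x => rfl⟩

/-- Pythagoras for the decomposition of `A` into its projection `A - Q` and the orthogonal
part `Q`. -/
theorem norm_sub_sq_of_orthogonal {E : Type*} [NormedAddCommGroup E] [InnerProductSpace ℂ E]
    {H : Submodule ℂ E} {A Q k : E} (hA : A - Q ∈ H) (hQ : ∀ k ∈ H, inner ℂ k Q = 0)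
    (hk : k ∈ H) : ‖A - k‖ ^ 2 = ‖Q‖ ^ 2 + ‖A - Q - k‖ ^ 2 := by
  have h1 := norm_add_sq_eq_norm_sq_add_norm_sq_of_inner_eq_zero (A - Q - k) Q
    (hQ _ (H.sub_mem hA hk))
  rw [show A - Q - k + Q = A - k by abel] at h1
  nlinarith

/-- A functional of the sequence is the image of its symbol under the spectral isometry. -/
theorem IsSpectralRoot.map_embed_symbolA (h : IsSpectralRoot f R S) {Ω : Type*}
    [MeasurableSpace Ω] {P : Measure Ω} {ζ : ℤ → Lp ℂ 2 P} (hζ : IsPC P ζ T)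
    {U : FreqSpace T →ₗᵢ[ℂ] Lp ℂ 2 P} (hU : ∀ x, U (expoVec R x) = block ζ T x.2 x.1)
    {a : ℕ → ℂ} (ha : Summable fun j : ℕ => ‖a (j + 1)‖) :
    U (embed R (symbolA T a)) = functional a ζ := by
  have h1 := (h.hasSum_symbolA hζ.pos ha).2.mapL U.toContinuousLinearMap
  have h2 := h1.prod_fiberwise fun j => hasSum_fintype _
  refine h2.unique ?_
  convert hζ.hasSum_block ha using 2 with j
  refine Finset.sum_congr rfl fun ν _ => ?_
  simp [hU]

end Estimate
end PCExtrapolation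

theorem mainTheorem7 {Ω : Type*} [MeasurableSpace Ω] (P : Measure Ω) [IsProbabilityMeasure P]
    (T : ℕ) (ζ : ℤ → Lp ℂ 2 P) (hζ : PCExtrapolation.IsPC P ζ T)
    (f : ℝ → Matrix (Fin T) (Fin T) ℂ)
    (hf : PCExtrapolation.IsSpectralDensity P (PCExtrapolation.block ζ T) f)
    (hmin : PCExtrapolation.MinimalityCondition f)
    (s : ℕ) (N K : ℕ → ℕ)
    (a : ℕ → ℂ) (ha : Summable fun j : ℕ => ‖a (j + 1)‖) :
    -- the functional and the observations, in scalar and in blocked form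
    (Summable fun j : ℕ => a (j + 1) • ζ ((j : ℤ) + 1)) ∧
    HasSum (fun j : ℕ => ∑ ν, PCExtrapolation.vecCoef T a j ν • PCExtrapolation.block ζ T ν j)
      (PCExtrapolation.functional a ζ) ∧
    PCExtrapolation.observedSpace ζ (PCExtrapolation.missingTimes T s N K) =
      PCExtrapolation.observedBlockSpace (PCExtrapolation.block ζ T)
        (PCExtrapolation.observedBlocks s N K) ∧
    -- the random spectral measure exists
    (∃ Z, PCExtrapolation.IsRandomSpectralMeasure P (PCExtrapolation.block ζ T) f Z) ∧
    -- if `B` is invertible, then `c = B⁻¹ a` is defined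
    (PCExtrapolation.InvertibleB f (PCExtrapolation.gammaSet s N K) →
      ∃ c, PCExtrapolation.IsImageB f (PCExtrapolation.gammaSet s N K) c
        (PCExtrapolation.gammaCoef T a (PCExtrapolation.gammaSet s N K))) ∧
    -- whenever `c = B⁻¹ a` is defined, it gives the optimal estimate
    ∀ c : PCExtrapolation.Seq2 T (PCExtrapolation.gammaSet s N K),
      PCExtrapolation.IsImageB f (PCExtrapolation.gammaSet s N K) c
        (PCExtrapolation.gammaCoef T a (PCExtrapolation.gammaSet s N K)) →
      (∀ c', PCExtrapolation.IsImageB f (PCExtrapolation.gammaSet s N K) c'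
        (PCExtrapolation.gammaCoef T a (PCExtrapolation.gammaSet s N K)) → c' = c) ∧
      ∃ (C : ℝ → Fin T → ℂ) (Y : Lp ℂ 2 P),
        PCExtrapolation.IsSymbol (PCExtrapolation.gammaSet s N K) c C ∧
        -- `Y` is the optimal linear estimate, and it is the only one
        PCExtrapolation.IsOptimalEstimate P
          (PCExtrapolation.observedSpace ζ (PCExtrapolation.missingTimes T s N K))
          (PCExtrapolation.functional a ζ) Y ∧
        (∀ Y', PCExtrapolation.IsOptimalEstimate P
          (PCExtrapolation.observedSpace ζ (PCExtrapolation.missingTimes T s N K))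
          (PCExtrapolation.functional a ζ) Y' → Y' = Y) ∧
        -- `Y = ∫ hᵀ dZ` with `hᵀ = Aᵀ - Cᵀ f⁻¹`
        (∀ Z, PCExtrapolation.IsRandomSpectralMeasure P (PCExtrapolation.block ζ T) f Z →
          PCExtrapolation.HasStochIntegral Z f (PCExtrapolation.spectralChar a C f) Y) ∧
        -- `h` is the minimizer of the mean square error in `L₂ˢ(f)`, unique up to null sets
        PCExtrapolation.MemL2s f (PCExtrapolation.observedBlocks s N K)
          (PCExtrapolation.spectralChar a C f) ∧
        (∀ g, PCExtrapolation.MemL2s f (PCExtrapolation.observedBlocks s N K) g →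
          PCExtrapolation.spectralError a f (PCExtrapolation.spectralChar a C f) ≤
            PCExtrapolation.spectralError a f g ∧
          (PCExtrapolation.spectralError a f g =
              PCExtrapolation.spectralError a f (PCExtrapolation.spectralChar a C f) →
            g =ᵐ[PCExtrapolation.freq] PCExtrapolation.spectralChar a C f)) ∧
        -- the mean square error is `⟨c, a⟩`
        PCExtrapolation.spectralError a f (PCExtrapolation.spectralChar a C f) =
          PCExtrapolation.mse P (PCExtrapolation.functional a ζ) Y ∧
        HasSum (fun x => c x * (starRingEnd ℂ)
            (PCExtrapolation.gammaCoef T a (PCExtrapolation.gammaSet s N K) x))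
          ((PCExtrapolation.mse P (PCExtrapolation.functional a ζ) Y : ℝ) : ℂ) := by
  open PCExtrapolation in
  obtain ⟨R, S, h⟩ := exists_isSpectralRoot hf.integrable hf.posSemidef hmin
  obtain ⟨U, hU⟩ := h.exists_spectral_isometry hf
  have hT := hζ.pos
  have hobs : observedSpace ζ (missingTimes T s N K) =
      observedBlockSpace (block ζ T) (observedBlocks s N K) := by
    rw [observedSpace, observedBlockSpace, image_observed_eq hT]
  have hΓ : ∀ n : ℤ, 0 ≤ n → n ∈ gammaSet s N K := fun n hn => Or.inr hn
  refine ⟨hζ.summable_functional ha, hζ.hasSum_block ha, hobs,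
    h.exists_isRandomSpectralMeasure (fun ν n => hζ.mean_zero _) hf, fun hInv => ?_,
    fun c hc => ?_⟩
  · obtain ⟨b, hb⟩ := exists_seq2_gammaCoef hT hΓ ha
    obtain ⟨c, hc⟩ := (hInv b).exists
    exact ⟨c, by rwa [show ⇑b = gammaCoef T a (gammaSet s N K) from funext hb] at hc⟩
  obtain ⟨Q, hQc, hQ0, hmem, horth, hsum⟩ := h.exists_decomposition hT ha s N K hc
  refine ⟨fun c' hc' => ?_, ?_⟩
  -- both `Q` and `Q'` split `A` orthogonally, so they agree, and `Q` determines its coefficients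
  · obtain ⟨Q', hQc', -, hmem', horth', -⟩ := h.exists_decomposition hT ha s N K hc'
    have h1 : Q - Q' ∈ modelSpace R (observedBlocks s N K) := by
      simpa using Submodule.sub_mem _ hmem' hmem
    have h2 : inner ℂ (Q - Q') (Q - Q') = 0 := by
      rw [inner_sub_right, horth _ h1, horth' _ h1, sub_zero]
    have h3 : Q = Q' := sub_eq_zero.1 (inner_self_eq_zero.1 h2)
    refine lp.ext (funext fun x => ?_)
    rw [← hQc x, ← hQc' x, h3]
  -- `C` is defined from `Q`, which makes `Q` the image of `Cᵀ f⁻¹`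
  obtain ⟨hC, hCm, hCe⟩ := h.isSymbol_and_embed_eq hQc hQ0
  set C : ℝ → Fin T → ℂ := fun t => (2 * Real.pi : ℂ) • ((Q t).ofLp ᵥ* R t)
  have hAm := (h.hasSum_symbolA hT ha).1
  have hUA := h.map_embed_symbolA hζ hU ha
  have hhm : MemLp (twist R (spectralChar a C f)) 2 freq := by
    have h1 := hAm.sub hCm
    rwa [← twist_sub] at h1
  have hhe : embed R (spectralChar a C f) = embed R (symbolA T a) - Q := by
    have h1 := embed_sub hAm hCm
    rwa [hCe] at h1
  have herr : spectralError a f (spectralChar a C f) = ‖Q‖ ^ 2 := by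
    rw [h.spectralError_eq hT ha hhm, hhe, sub_sub_cancel]
  have hmse : ∀ k, mse P (functional a ζ) (U k) = ‖embed R (symbolA T a) - k‖ ^ 2 := fun k => by
    rw [mse_eq, ← hUA, ← map_sub, U.norm_map]
  have hmseY : mse P (functional a ζ) (U (embed R (symbolA T a) - Q)) = ‖Q‖ ^ 2 := by
    rw [hmse, sub_sub_cancel]
  have hpyth : ∀ k ∈ modelSpace R (observedBlocks s N K), ‖embed R (symbolA T a) - k‖ ^ 2 =
      ‖Q‖ ^ 2 + ‖embed R (symbolA T a) - Q - k‖ ^ 2 := fun k hk =>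
    norm_sub_sq_of_orthogonal hmem horth hk
  have hunique : ∀ k ∈ modelSpace R (observedBlocks s N K),
      ‖embed R (symbolA T a) - k‖ ^ 2 ≤ ‖Q‖ ^ 2 → k = embed R (symbolA T a) - Q := by
    intro k hk hle
    rw [hpyth k hk] at hle
    have h1 : ‖embed R (symbolA T a) - Q - k‖ = 0 := by
      nlinarith [norm_nonneg (embed R (symbolA T a) - Q - k)]
    exact (sub_eq_zero.1 (norm_eq_zero.1 h1)).symm
  have hmemH : ∀ Y, Y ∈ observedSpace ζ (missingTimes T s N K) ↔
      ∃ k ∈ modelSpace R (observedBlocks s N K), U k = Y := fun Y => by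
    rw [hobs, mem_observedBlockSpace_iff hU]
  have hYmem := (hmemH _).2 ⟨_, hmem, rfl⟩
  refine ⟨C, U (embed R (symbolA T a) - Q), hC, ⟨hYmem, fun Y' hY' => ?_⟩, fun Y' hY' => ?_,
    fun Z hZ => ?_, h.memL2s_iff.2 ⟨hhm, hhe ▸ hmem⟩, fun g hg => ?_, herr.trans hmseY.symm, ?_⟩
  · obtain ⟨k, hk, rfl⟩ := (hmemH Y').1 hY'
    rw [hmseY, hmse, hpyth k hk]
    exact le_add_of_nonneg_right (sq_nonneg _)
  · obtain ⟨k, hk, rfl⟩ := (hmemH Y').1 hY'.1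
    have h1 := hY'.2 _ hYmem
    rw [hmseY, hmse] at h1
    rw [hunique k hk h1]
  · exact (h.hasStochIntegral_iff (fun ν D hD => h.linearIsometry_indVec hZ hU ν hD) hhm).2
      (by rw [hhe])
  · obtain ⟨hgm, hgs⟩ := h.memL2s_iff.1 hg
    rw [herr, h.spectralError_eq hT ha hgm]
    refine ⟨?_, fun heq => ?_⟩
    · rw [hpyth _ hgs]
      exact le_add_of_nonneg_right (sq_nonneg _)
    · exact h.ae_eq_of_embed_eq hgm hhm ((hunique _ hgs heq.le).trans hhe.symm)
  · rw [hmseY]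
    exact hsum
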